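/- Let $n\ge 1$ and $m\ge 0$ be integers and let $M=[0,1]\times\mathbb T^n$, $\mathbb T^n=\mathbb R^n/\mathbb Z^n$, with the Euclidean metric $e$. Points of $M$ are written $(x,y)$ and tangent vectors $u=(v,w)\in\mathbb R\times\mathbb R^n$. Let $P_k$ be the space of complex homogeneous polynomials of order $k$ on $\mathbb R^{n+1}$, normed by $L^2(S^n)$, with $P_{-1}=0$. A tensor field of order $k$ on a Riemannian manifold is a function $f(x;u)$, $u\in T_x$, that is a homogeneous polynomial of order $k$ in $u$. A *twisted slab* of dimension $1+n$ is a (Hausdorff, smooth) Riemannian manifold with boundary $(N,g_N)$ with a smooth surjective covering map $p\colon M\to N$ such that $p^*g_N=e$; let $d$ be the (finite) number of sheets of $p$. For a tensor field $F$ on $M$, its pushforward is the fibre average $(p_*F)(x;\xi)=\frac1d\sum_{z\in p^{-1}(x)}F(z;(dp_z)^{-1}\xi)$. The X-ray transform of an $L^2$ tensor field $f$ of order $m$ on $N$ is $I^mf(\gamma)=\int_0^1 f(\gamma(t);\dot\gamma(t))\,dt$ on the geodesics $\gamma\colon[0,1]\to N$ joining boundary points; $I^mf=0$ means that for every $b\in\mathbb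 R^n$ and almost every $a\in\mathbb T^n$ this integral is $0$ for the geodesic starting at $p(0,a)$ with velocity $dp(1,b)$. (Up to reversal and affine reparametrization, these are all the geodesics of $N$ that join boundary points through the interior.) **Theorem.** There is a constant $C=C(n,m)$ such that the following holds for every twisted slab $N$ of dimension $1+n\ge 2$, with covering $p$ of $d$ sheets, and every $L^2$-regular tensor field $f$ of order $m$ on $N$. The following are equivalent: 1. $I^mf=0$. 2. There are $h\in L^2([0,1];P_m)$ with $\int_0^1h(x;u)\,dx=0$ for all $u\in\mathbb R^{n+1}$ and a tensor field $g$ of order $m-1$ on $N$ with coefficients in $H^1_0$ ($H^1$ functions with zero boundary trace) such that $$f=p_*\pi_M^*h+\mathrm dg,$$ where $\pi_M\colon M\to[0,1]$ is the projection, $(\pi_M^*h)(x,y;u)=h(x;u)$, and $\mathrm d$ is the symmetrized covariant derivative. In addition, if $I^mf=0$, then $h$ and $g$ as in 2 can be chosen so that $$\|h\|_{L^2([0,1];P_m)}+\|g\|_{H^1_0(N)}\le C\sqrt d\,\|f\|_{L^2(N)}.$$ -/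

import Mathlib

open MeasureTheory Set
open scoped Manifold ContDiff Topology

universe u

noncomputable section

namespace TwistedSlab

/-! ### The periodic slab and its universal cover

A point of `ℝ^(1+n)` is written `z = (x, y)` with `x = z 0` and `y = (z 1, …, z n)`; a tangent vector
is written `u = (v, w)` in the same way. Functions and tensor fields on the slab
`M = [0,1] × 𝕋ⁿ` are read as functions on `[0,1] × ℝⁿ` that are `ℤⁿ`-periodic in `y`. -/

/-- `ℝ^(1+n)` with its Euclidean structure. -/
abbrev Vec (n : ℕ) : Type := EuclideanSpace ℝ (Fin (n + 1))

/-- The vector `(x, y) ∈ ℝ × ℝⁿ = ℝ^(1+n)`. -/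
def vec {n : ℕ} (x : ℝ) (y : EuclideanSpace ℝ (Fin n)) : Vec n :=
  WithLp.toLp 2 (Fin.cons x (fun i => y i))

/-- The periodic slab `M = [0,1] × 𝕋ⁿ`, `𝕋ⁿ = ℝⁿ / ℤⁿ`. -/
abbrev Slab (n : ℕ) : Type := Icc (0 : ℝ) 1 × UnitAddTorus (Fin n)

/-- The universal cover `[0,1] × ℝⁿ` of the slab, as a subset of `ℝ^(1+n)`. -/
def strip (n : ℕ) : Set (Vec n) := {z | z 0 ∈ Icc (0 : ℝ) 1}

/-- The fundamental domain `[0,1] × [0,1)ⁿ`. Integration over `M` is integration over it. -/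
def box (n : ℕ) : Set (Vec n) :=
  {z | z 0 ∈ Icc (0 : ℝ) 1 ∧ ∀ i : Fin n, z i.succ ∈ Ico (0 : ℝ) 1}

/-- The quotient map `[0,1] × ℝⁿ → M`. Only its values on `strip n` matter: the first coordinate is
clamped to `[0,1]` to have a function on all of `ℝ^(1+n)`. -/
def quot {n : ℕ} (z : Vec n) : Slab n :=
  (projIcc (0 : ℝ) 1 zero_le_one (z 0), fun i => ((z i.succ : ℝ) : UnitAddCircle))

/-! ### Homogeneous polynomials and symmetric tensors -/

/-- `F : ℝ^(1+n) → ℂ` is a homogeneous polynomial of order `k`. The order is an integer: for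
`k = -1` this says `F = 0`. -/
def IsHomPoly {n : ℕ} (k : ℤ) (F : Vec n → ℂ) : Prop :=
  ∃ q : MvPolynomial (Fin (n + 1)) ℂ,
    (∀ d ∈ q.support, (d.degree : ℤ) = k) ∧
      ∀ u, F u = MvPolynomial.eval (fun i => ((u i : ℝ) : ℂ)) q

/-- The coefficients of `F : [0,1] × ℝⁿ → {polynomials}` are square integrable on `M`: all functions
`F(· ; u)` are. (The coefficients and the functions `F(· ; u)` are finite linear combinations of each
other.) -/
def L2Coeff {n : ℕ} (F : Vec n → Vec n → ℂ) : Prop :=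
  ∀ u, MemLp (fun z => F z u) 2 (volume.restrict (box n))

/-- The square of the norm of a polynomial in `L²(Sⁿ)`, `Sⁿ ⊂ ℝ^(1+n)` the unit sphere with its
surface measure. -/
def polyNormSq {n : ℕ} (F : Vec n → ℂ) : ℝ :=
  ∫ u : Metric.sphere (0 : Vec n) 1, ‖F u‖ ^ 2 ∂((volume : Measure (Vec n)).toSphere)

/-- `‖F‖²` in `L²(M; {polynomials})`. -/
def slabNormSq {n : ℕ} (F : Vec n → Vec n → ℂ) : ℝ :=
  ∫ z in box n, polyNormSq (F z)

/-- The norm of `h` in `L²([0,1]; {polynomials})`. -/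
def intervalNorm {n : ℕ} (h : ℝ → Vec n → ℂ) : ℝ :=
  √(∫ x in Icc (0 : ℝ) 1, polyNormSq (h x))

/-- `F` has coefficients in `H¹₀(M)`, and `DF 0, …, DF n` are its weak partial derivatives with
respect to `z 0, …, z n`: both are square integrable and Green's formula
`∫_M F ∂_j φ = - ∫_M (∂_j F) φ` holds for all `φ ∈ C^∞(M)`. For `φ` supported in the interior this says
that `∂_j F` is the weak derivative of `F ∈ H¹(M)`; for general `φ` it says in addition that the
boundary integral of the trace of `F` against `φ` vanishes, i.e. that the trace is zero.
A function in `C^∞(M)` is the restriction of a smooth function on `ℝ^(1+n)` that is periodic in `y`. -/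
structure HasGradH10 {n : ℕ} (k : ℤ) (F : Vec n → Vec n → ℂ)
    (DF : Fin (n + 1) → Vec n → Vec n → ℂ) : Prop where
  memL2 : L2Coeff F
  grad_poly : ∀ j z, IsHomPoly k (DF j z)
  grad_memL2 : ∀ j, L2Coeff (DF j)
  green : ∀ φ : Vec n → ℂ, ContDiff ℝ ∞ φ →
    (∀ (z : Vec n) (i : Fin n), φ (z + EuclideanSpace.single i.succ (1 : ℝ)) = φ z) →
    ∀ (u : Vec n) (j : Fin (n + 1)),
      ∫ z in box n, F z u * fderiv ℝ φ z (EuclideanSpace.single j (1 : ℝ)) =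
        - ∫ z in box n, DF j z u * φ z

/-! ### Riemannian manifolds with boundary and their geodesics -/

section Manifold

variable {n : ℕ} {N : Type u} [TopologicalSpace N]
  [ChartedSpace (EuclideanHalfSpace (n + 1)) N]

/-- Smooth Riemannian metrics on a smooth manifold with boundary of dimension `1 + n`. -/
abbrev SmoothMetric (n : ℕ) (N : Type u) [TopologicalSpace N]
    [ChartedSpace (EuclideanHalfSpace (n + 1)) N] [IsManifold (𝓡∂ (n + 1)) ∞ N] :=
  Bundle.ContMDiffRiemannianMetric (𝓡∂ (n + 1)) ∞ (Vec n) (fun x : N => TangentSpace (𝓡∂ (n + 1)) x)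

/-- The coefficients `g_ij(y) a^i b^j` of the metric in the chart around `x₀`. -/
def metricInChart [IsManifold (𝓡∂ (n + 1)) ∞ N] (g : SmoothMetric n N) (x₀ : N) (y a b : Vec n) : ℝ :=
  g.inner ((extChartAt (𝓡∂ (n + 1)) x₀).symm y)
    (mfderivWithin 𝓘(ℝ, Vec n) (𝓡∂ (n + 1)) (extChartAt (𝓡∂ (n + 1)) x₀).symm
      (range (𝓡∂ (n + 1))) y a)
    (mfderivWithin 𝓘(ℝ, Vec n) (𝓡∂ (n + 1)) (extChartAt (𝓡∂ (n + 1)) x₀).symm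
      (range (𝓡∂ (n + 1))) y b)

/-- The velocity of a curve `γ : [0,1] → N`. -/
def velocity (γ : ℝ → N) (t : ℝ) : TangentSpace (𝓡∂ (n + 1)) (γ t) :=
  mfderivWithin 𝓘(ℝ, ℝ) (𝓡∂ (n + 1)) γ (Icc (0 : ℝ) 1) t (1 : ℝ)

/-- `γ : [0,1] → N` is a geodesic: it is smooth, and for `0 < t < 1` it satisfies the geodesic equation
in the form `d/dt (g_ij(σ) σ'^j) = ½ (∂_i g_jk)(σ) σ'^j σ'^k` (the Euler-Lagrange equation of the
energy), where `σ` is `γ` in the chart around `γ t`. -/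
def IsGeodesic [IsManifold (𝓡∂ (n + 1)) ∞ N] (g : SmoothMetric n N) (γ : ℝ → N) : Prop :=
  ContMDiffOn 𝓘(ℝ, ℝ) (𝓡∂ (n + 1)) ∞ γ (Icc (0 : ℝ) 1) ∧
  ∀ t ∈ Ioo (0 : ℝ) 1, ∀ w : Vec n,
    let σ : ℝ → Vec n := fun s => extChartAt (𝓡∂ (n + 1)) (γ t) (γ s)
    HasDerivAt (fun s => metricInChart g (γ t) (σ s) (deriv σ s) w)
      ((1 / 2 : ℝ) * fderivWithin ℝ (fun y => metricInChart g (γ t) y (deriv σ t) (deriv σ t))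
        (range (𝓡∂ (n + 1))) (σ t) w) t

/-- A tensor field of order `k` on `N`: for each `x` a homogeneous polynomial of order `k` on the
tangent space `T_x N` (which is `ℝ^(1+n)` by the chart at `x`). -/
def IsTensorField (k : ℤ) (f : (x : N) → TangentSpace (𝓡∂ (n + 1)) x → ℂ) : Prop :=
  ∀ x : N, IsHomPoly (n := n) k (f x)

/-- The integral `∫₀¹ f(γ(t); γ'(t)) dt` of a tensor field over a geodesic `γ : [0,1] → N`. -/
def rayIntegral (f : (x : N) → TangentSpace (𝓡∂ (n + 1)) x → ℂ) (γ : ℝ → N) : ℂ :=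
  ∫ t in (0 : ℝ)..1, f (γ t) (velocity γ t)

/-! ### Twisted slabs -/

/-- The map `p : M → N` read on the universal cover `[0,1] × ℝⁿ` of `M`. -/
def lift (p : Slab n → N) : Vec n → N := fun z => p (quot z)

/-- The differential of `p` at (the image in `M` of) `z ∈ [0,1] × ℝⁿ`. -/
def dp (p : Slab n → N) (z : Vec n) : Vec n →L[ℝ] TangentSpace (𝓡∂ (n + 1)) (lift p z) :=
  mfderivWithin 𝓘(ℝ, Vec n) (𝓡∂ (n + 1)) (lift p) (strip n) z

/-- `p : M → N` is a smooth covering map with `p^* g` equal to the Euclidean metric of `M`: so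
`(N, g)` is a twisted slab of dimension `1 + n`. -/
structure IsTwistedSlab [IsManifold (𝓡∂ (n + 1)) ∞ N] (g : SmoothMetric n N) (p : Slab n → N) : Prop where
  covering : IsCoveringMap p
  surjective : Function.Surjective p
  smooth : ContMDiffOn 𝓘(ℝ, Vec n) (𝓡∂ (n + 1)) ∞ (lift p) (strip n)
  isometric : ∀ z ∈ strip n, ∀ a b : Vec n,
    g.inner (lift p z) (dp p z a) (dp p z b) = inner ℝ a b

/-- The number of sheets of `p` (`N` is connected, so it can be counted at any point). -/
def sheets (p : Slab n → N) : ℕ := Nat.card (p ⁻¹' {lift p (0 : Vec n)})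

/-- The pullback `p^* f` of a tensor field on `N`, `(p^* f)(z; u) = f(p(z); dp_z u)`. Since `p` is a
local isometry, this is also the expression of `f` in local Euclidean coordinates of `N`. -/
def pullback (p : Slab n → N) (f : (x : N) → TangentSpace (𝓡∂ (n + 1)) x → ℂ) :
    Vec n → Vec n → ℂ :=
  fun z u => f (lift p z) (dp p z u)

/-- The pushforward `p_* F` of a tensor field on `M`: the average over the fibre
`p^{-1}(x) = {z ∈ [0,1] × [0,1)ⁿ | p(z) = x}` of the tensors `F(z; ·)`, carried to `T_x N` by the
isomorphisms `dp_z`. -/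
def pushforward (p : Slab n → N) (F : Vec n → Vec n → ℂ) :
    (x : N) → TangentSpace (𝓡∂ (n + 1)) x → ℂ :=
  fun x ξ => ((sheets p : ℂ))⁻¹ *
    ∑ᶠ z ∈ {z : Vec n | z ∈ box n ∧ lift p z = x}, F z ((dp p z).inverse ξ)

/-- The `L²(N)` norm of a tensor field with expression `F = p^* f` in the local Euclidean coordinates.
As `p` is a local isometry with `sheets p` sheets, `∫_N = (1 / sheets p) ∫_M p^*`. -/
def l2Norm (p : Slab n → N) (F : Vec n → Vec n → ℂ) : ℝ :=
  √((sheets p : ℝ)⁻¹ * slabNormSq F)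

/-- The `H¹(N)` norm of a tensor field with expression `F = p^* f` in the local Euclidean coordinates
and partial derivatives `DF j` in these coordinates. -/
def h1Norm (p : Slab n → N) (F : Vec n → Vec n → ℂ)
    (DF : Fin (n + 1) → Vec n → Vec n → ℂ) : ℝ :=
  √((sheets p : ℝ)⁻¹ * (slabNormSq F + ∑ j, slabNormSq (DF j)))

/-- The X-ray transform of `f` vanishes: for all `b ∈ ℝⁿ` and almost all `a ∈ 𝕋ⁿ`, the integral of `f`
over the geodesic `γ : [0,1] → N` joining boundary points that has initial point `p(0, a)` and initial
velocity `dp(1, b)` is zero. Up to affine reparametrization and reversal these are all the geodesics of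
`N` that join boundary points through the interior. -/
def XrayVanishes [IsManifold (𝓡∂ (n + 1)) ∞ N] (g : SmoothMetric n N) (p : Slab n → N)
    (f : (x : N) → TangentSpace (𝓡∂ (n + 1)) x → ℂ) : Prop :=
  ∀ b : EuclideanSpace ℝ (Fin n), ∀ᵐ a : EuclideanSpace ℝ (Fin n),
    ∀ γ : ℝ → N, IsGeodesic g γ →
      γ 0 ∈ (𝓡∂ (n + 1)).boundary N → γ 1 ∈ (𝓡∂ (n + 1)).boundary N →
      γ 0 = lift p (vec 0 a) →
      (velocity γ 0 : Vec n) = (dp p (vec 0 a) (vec 1 b) : Vec n) →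
      rayIntegral f γ = 0

/-- `f = p_* π_M^* h + d φ` as `L²` tensor fields of order `m` on `N`, where
* `h ∈ L²([0,1]; {homogeneous polynomials of order m})` has `∫₀¹ h(x; u) dx = 0` for all `u`,
* `φ` is a tensor field of order `m - 1` on `N` with coefficients in `H¹₀`, and `Dφ j` are its weak
  partial derivatives in the local Euclidean coordinates given by `p`.

In these coordinates `(d φ)(z; u) = ∑ j, u_j ∂_j φ(z; u)` is the symmetrized covariant derivative. -/
structure IsKernelDecomp (p : Slab n → N) (m : ℕ)
    (f : (x : N) → TangentSpace (𝓡∂ (n + 1)) x → ℂ) (h : ℝ → Vec n → ℂ)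
    (φ : (x : N) → TangentSpace (𝓡∂ (n + 1)) x → ℂ)
    (Dφ : Fin (n + 1) → Vec n → Vec n → ℂ) : Prop where
  h_poly : ∀ x, IsHomPoly (m : ℤ) (h x)
  h_memL2 : ∀ u, MemLp (fun x => h x u) 2 (volume.restrict (Icc (0 : ℝ) 1))
  h_mean : ∀ u, ∫ x in (0 : ℝ)..1, h x u = 0
  φ_tensor : IsTensorField ((m : ℤ) - 1) φ
  φ_grad : HasGradH10 ((m : ℤ) - 1) (pullback p φ) Dφ
  eq : ∀ᵐ z ∂(volume.restrict (box n)), ∀ u : Vec n,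
    pullback p f z u =
      pullback p (pushforward p (fun z' => h (z' 0))) z u + ∑ j, ((u j : ℝ) : ℂ) * Dφ j z u

end Manifold

end TwistedSlab

end

/-!
Everything is read on the strip `[0,1] × ℝⁿ`, which covers `M` and `N`. Lifts to it are unique, so the
deck transformations of the strip over `N` act simply transitively on the fibres; being local isometries
of a convex set with interior, they are restrictions of affine isometries (`exists_deck`), and they fix
or reverse the first coordinate (`apply_zero_of_mem_deck`). Tensor fields on `N` become tensor fields on
the strip that are invariant under this group, and `p^* p_*` becomes an average over the group modulo
the translations by `ℤⁿ` (`pullback_pushforward`). In the chart of `N` given by a local inverse of the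
covering the geodesic equation reads `c'' = 0`, so that the geodesics are the images of straight lines
(`geodesic_eq_line`).

*The ray transform.* For fixed `b`, the integrals of a periodic function along the segments of direction
`(1, b)` are a periodic function of the starting point. They vanish almost everywhere if and only if
its Fourier coefficients do, that is, if the given function is orthogonal to the exponentials
`e^{2πi k·(y - x b)}`, `k ∈ ℤⁿ` (`StripPeriodic.ae_line_integral_eq_zero_iff`).

*The decomposition on `M`.* Expand in Fourier modes `e^{2πi k·y}`. For `k = 0` orthogonality says that
the mode, a polynomial with coefficients depending on `x`, has mean zero in `x`: this is `h`. For
`k ≠ 0`, with `κ = 2πk` and `u = (u_0, w)`, one has to solve `(u_0 ∂_x + i κ·w) G = F` in `H¹₀(0,1)`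
where `F` is orthogonal to `e^{-i (κ·b) x}` at `u = (1, b)`. In linear coordinates in which `κ·w` is one
of the variables, this is a problem for polynomials in a single frequency `s`: the coefficient of `s⁰`
has mean zero, hence a primitive in `H¹₀(0,1)`; subtracting `(∂_x + i s)` of that primitive and dividing
by `s` lowers the degree (`exists_primitives`, `exists_mode`). The solutions can be summed because of
Korn's inequality: for functions with vanishing boundary trace
`⟨∂_j g, ∂_l g'⟩ = ⟨∂_l g, ∂_j g'⟩`, and then the norm of the symmetrized derivative of `G` dominates
that of the full derivative, with a constant that does not depend on `k` (`korn`,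
`exists_slab_decomposition`).

*Passage to `N`.* If the pullback of a tensor field `f` on `N` is `π_M^* h + dG`, then, being invariant,
it is also the average of the right-hand side over the deck transformations (`pullback_eq_deckAvg`).
The average of `G` is the pullback of `p_* G`. That its weak derivative is the average of the
transformed derivatives, boundary trace included, needs an argument, for a deck transformation need not
normalize `ℤⁿ` and may destroy the periodicity of test functions; the sum over those with the same
linear part does not (`green_deckAvg`). Averages do not increase `L²` norms (`slabNormSq_deckAvg_le`),
and the factor `√d` is the ratio of the norms on `M` and `N`.

*The converse.* The average of a function of `x` alone with mean zero is of the same kind in each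
direction `u`, since deck transformations act on `x` by `x` or `1 - x`, so it is orthogonal to the above
exponentials (`integral_deckAvg_mul_rayExpo`). The symmetrized derivative is orthogonal to them by
Green's formula, as their derivative in the direction `(1, b)` is zero
(`Green.integral_sum_mul_rayExpo`).
-/

noncomputable section

namespace TwistedSlab

/-! ### The strip and its quotient -/

section

variable {n : ℕ}

section Basic

theorem vec_zero (x : ℝ) (y : EuclideanSpace ℝ (Fin n)) : vec x y 0 = x := rfl
theorem vec_succ (x : ℝ) (y : EuclideanSpace ℝ (Fin n)) (i : Fin n) : vec x y i.succ = y i := rfl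

theorem isClosed_strip : IsClosed (strip n) :=
  isClosed_Icc.preimage (EuclideanSpace.proj (0 : Fin (n+1)) : Vec n →L[ℝ] ℝ).continuous

theorem convex_strip : Convex ℝ (strip n) :=
  (convex_Icc (0:ℝ) 1).linear_preimage (EuclideanSpace.proj (0 : Fin (n+1)) : Vec n →L[ℝ] ℝ).toLinearMap

theorem interior_strip_nonempty : (interior (strip n)).Nonempty := by
  refine ⟨vec (1/2) 0, mem_interior.2 ⟨{z | z 0 ∈ Ioo (0:ℝ) 1}, fun z hz => Ioo_subset_Icc_self hz,
    isOpen_Ioo.preimage (EuclideanSpace.proj (0 : Fin (n+1)) : Vec n →L[ℝ] ℝ).continuous, ?_⟩⟩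
  simp only [mem_ofPred_eq, vec_zero, mem_Ioo]
  norm_num

theorem uniqueDiffOn_strip : UniqueDiffOn ℝ (strip n) :=
  uniqueDiffOn_convex convex_strip interior_strip_nonempty

theorem continuous_quot : Continuous (quot (n := n)) := by
  unfold quot
  refine Continuous.prodMk (by fun_prop) (continuous_pi fun i => ?_)
  exact (AddCircle.continuous_mk' 1).comp (by fun_prop)

/-- Two points of the strip have the same image in `M` iff they differ by an integer translation. -/
theorem quot_eq_quot_iff {z z' : Vec n} (hz : z ∈ strip n) (hz' : z' ∈ strip n) :
    quot z = quot z' ↔ z 0 = z' 0 ∧ ∀ i : Fin n, ∃ k : ℤ, z' i.succ = z i.succ + k := by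
  change (_, _) = (_, _) ↔ _
  rw [Prod.mk.injEq, funext_iff]
  refine and_congr ?_ (forall_congr' fun i => ?_)
  · rw [← Subtype.coe_inj, coe_projIcc, coe_projIcc, min_eq_right hz.2, max_eq_right hz.1,
      min_eq_right hz'.2, max_eq_right hz'.1]
  · rw [← sub_eq_zero, ← neg_eq_zero, neg_sub, ← AddCircle.coe_sub, AddCircle.coe_eq_zero_iff]
    refine exists_congr fun k => ?_
    rw [zsmul_eq_mul, mul_one, eq_comm, sub_eq_iff_eq_add']

theorem quot_surjective (s : Slab n) : ∃ z ∈ box n, quot z = s := by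
  refine ⟨vec s.1 (WithLp.toLp 2 fun i => (AddCircle.equivIco 1 0 (s.2 i) : ℝ)),
    ⟨s.1.2, fun i => by
      have := (AddCircle.equivIco (1:ℝ) 0 (s.2 i)).2
      exact ⟨this.1, this.2.trans_eq (zero_add 1)⟩⟩, ?_⟩
  refine Prod.ext (projIcc_val zero_le_one _) (funext fun i => ?_)
  exact AddCircle.coe_equivIco

theorem quot_injOn_box : InjOn (quot (n := n)) (box n) := by
  intro z hz z' hz' h
  obtain ⟨h0, h1⟩ := (quot_eq_quot_iff hz.1 hz'.1).1 h
  ext i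
  refine Fin.cases h0 (fun i => ?_) i
  have := congrFun (congrArg Prod.snd h) i
  exact (AddCircle.coe_eq_coe_iff_of_mem_Ico (p := (1:ℝ)) (a := 0) (by simpa using hz.2 i)
    (by simpa using hz'.2 i)).1 this

end Basic

/-- A continuous map of a simply connected space into `N` lifts through `[0,1] × ℝⁿ → M → N`. -/
theorem exists_lift_to_strip {N : Type u} [TopologicalSpace N] {p : Slab n → N} (hp : IsCoveringMap p)
    {A : Type*} [TopologicalSpace A] [SimplyConnectedSpace A] [LocallyPathConnectedSpace A]
    {f : A → N} (hf : Continuous f) (a₀ : A) {z₀ : Vec n} (hz₀ : z₀ ∈ strip n)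
    (h : lift p z₀ = f a₀) :
    ∃ F : A → Vec n, Continuous F ∧ (∀ a, F a ∈ strip n) ∧ F a₀ = z₀ ∧ ∀ a, lift p (F a) = f a := by
  obtain ⟨F₁, ⟨h1, h2⟩, -⟩ := hp.existsUnique_continuousMap_lifts (f := ⟨f, hf⟩) (a₀ := a₀)
    (e₀ := quot z₀) h
  have key (i : Fin n) : ∃ G : C(A, ℝ), G a₀ = z₀ i.succ ∧
      (fun x : ℝ => (x : UnitAddCircle)) ∘ G = fun a => (F₁ a).2 i :=
    ((AddCircle.isCoveringMap_coe (1:ℝ)).existsUnique_continuousMap_lifts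
      (f := ⟨fun a => (F₁ a).2 i, by fun_prop⟩) (a₀ := a₀) (e₀ := z₀ i.succ)
      (by rw [ContinuousMap.coe_mk, h1]; rfl)).exists
  -- The lift to `M` given by `p` is lifted further, one circle at a time.
  -- Its first coordinate needs no lifting.
  choose G hG hG' using key
  have hq : ∀ a, quot (vec ((F₁ a).1 : ℝ) (WithLp.toLp 2 fun i => G i a)) = F₁ a := fun a =>
    Prod.ext (projIcc_val zero_le_one _) (funext fun i => congrFun (hG' i) a)
  refine ⟨fun a => vec (F₁ a).1 (WithLp.toLp 2 fun i => G i a), ?_, fun a => (F₁ a).1.2, ?_, fun a => ?_⟩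
  · refine (PiLp.continuous_toLp 2 _).comp (continuous_pi fun i => ?_)
    refine Fin.cases ?_ (fun i => ?_) i
    · simp only [Fin.cons_zero]; fun_prop
    · simp only [Fin.cons_succ]; fun_prop
  · ext i
    refine Fin.cases ?_ (fun i => ?_) i
    · rw [vec_zero, h1]
      exact congrArg Subtype.val (projIcc_of_mem zero_le_one hz₀)
    · rw [vec_succ]; exact hG i
  · rw [lift, hq]; exact congrFun h2 a

/-- Uniqueness of lifts to the strip. -/
theorem eq_of_lift_eq {N : Type u} [TopologicalSpace N] {p : Slab n → N} (hp : IsCoveringMap p)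
    {A : Type*} [TopologicalSpace A] [PreconnectedSpace A] {F F' : A → Vec n}
    (hF : Continuous F) (hF' : Continuous F') (hs : ∀ a, F a ∈ strip n) (hs' : ∀ a, F' a ∈ strip n)
    (h : ∀ a, lift p (F a) = lift p (F' a)) {a₀ : A} (h₀ : F a₀ = F' a₀) : F = F' := by
  have h1 : quot ∘ F = quot ∘ F' := hp.eq_of_comp_eq (continuous_quot.comp hF)
    (continuous_quot.comp hF') (funext h) a₀ (by simp [h₀])
  have h2 (i : Fin n) : (fun a => F a i.succ) = fun a => F' a i.succ :=
    (AddCircle.isCoveringMap_coe (1:ℝ)).eq_of_comp_eq (by fun_prop) (by fun_prop)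
      (funext fun a => congrFun (congrArg Prod.snd (congrFun h1 a)) i) a₀ (by simp [h₀])
  funext a
  ext i
  refine Fin.cases ?_ (fun i => congrFun (h2 i) a) i
  exact ((quot_eq_quot_iff (hs a) (hs' a)).1 (congrFun h1 a)).1

end

/-! ### Smoothness of lifts and local inverses of the covering -/

section

/-- A continuous one-sided inverse of a smooth map with invertible derivatives is smooth; the sets
`S`, `T` need not be open. -/
theorem contDiffOn_of_rightInverse {E F : Type*} [NormedAddCommGroup E] [NormedSpace ℝ E]
    [CompleteSpace E] [NormedAddCommGroup F] [NormedSpace ℝ F] {S : Set E} {T : Set F}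
    (hS : UniqueDiffOn ℝ S) (hT : UniqueDiffOn ℝ T) {ψ : E → F} {η : F → E}
    (hψ : ContDiffOn ℝ ∞ ψ S) (hη : ContinuousOn η T) (hm : MapsTo η T S)
    (hinv : ∀ y ∈ T, ψ (η y) = y)
    (hA : ∀ z ∈ S, ∃ A : E ≃L[ℝ] F, HasFDerivWithinAt ψ (A : E →L[ℝ] F) S z) :
    ContDiffOn ℝ ∞ η T := by
  have hder : ∀ y ∈ T, HasFDerivWithinAt η (fderivWithin ℝ ψ S (η y)).inverse T y := by
    intro y hy
    obtain ⟨A, hA⟩ := hA _ (hm hy)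
    rw [hA.fderivWithin (hS _ (hm hy)), ContinuousLinearMap.inverse_equiv]
    -- At each point `η` has the inverse of the derivative of `ψ` as its derivative, so its smoothness
    -- bootstraps: `η ∈ C^k` gives `η' ∈ C^k`.
    refine HasFDerivWithinAt.of_local_left_inverse ?_ hA hy ?_
    · exact tendsto_nhdsWithin_iff.2 ⟨hη y hy, eventually_nhdsWithin_of_forall hm⟩
    · exact eventually_nhdsWithin_of_forall hinv
  have key : ∀ k : ℕ, ContDiffOn ℝ k η T := by
    intro k
    induction k with
    | zero => exact contDiffOn_zero.2 hη
    | succ k ih =>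
      push_cast
      rw [contDiffOn_succ_iff_hasFDerivWithinAt_of_uniqueDiffOn hT]
      refine ⟨fun h => absurd h (by exact_mod_cast WithTop.coe_ne_top), _, ?_, hder⟩
      intro y hy
      obtain ⟨A, hA⟩ := hA _ (hm hy)
      have h1 : ContDiffOn ℝ k (fderivWithin ℝ ψ S) S :=
        hψ.fderivWithin hS (by exact_mod_cast le_top)
      have h2 : ContDiffAt ℝ k ContinuousLinearMap.inverse (fderivWithin ℝ ψ S (η y)) := by
        rw [hA.fderivWithin (hS _ (hm hy))]
        exact contDiffAt_map_inverse A
      exact h2.comp_contDiffWithinAt y ((h1.comp ih hm) y hy)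
  exact contDiffOn_infty.2 key

variable {n : ℕ} {N : Type u} [TopologicalSpace N]
  [ChartedSpace (EuclideanHalfSpace (n + 1)) N] [IsManifold (𝓡∂ (n + 1)) ∞ N]
  {g : SmoothMetric n N} {p : Slab n → N}

/-- `dp p z` as a map of `ℝ^(1+n)` to itself: the tangent spaces of `N` are copies of `ℝ^(1+n)`. -/
def dpV (p : Slab n → N) (z : Vec n) : Vec n →L[ℝ] Vec n := dp p z

namespace IsTwistedSlab

variable (H : IsTwistedSlab g p)
include H

theorem continuous_lift : Continuous (lift p) := H.covering.continuous.comp continuous_quot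

theorem hasMFDerivWithinAt {z : Vec n} (hz : z ∈ strip n) :
    HasMFDerivWithinAt 𝓘(ℝ, Vec n) (𝓡∂ (n + 1)) (lift p) (strip n) z (dpV p z) :=
  (H.smooth.mdifferentiableOn (by simp) z hz).hasMFDerivWithinAt

/-- `dp z` as a linear isomorphism of `ℝ^(1+n)`. -/
theorem exists_equiv {z : Vec n} (hz : z ∈ strip n) :
    ∃ A : Vec n ≃L[ℝ] Vec n, (A : Vec n →L[ℝ] Vec n) = dpV p z := by
  have hinj : Function.Injective (dpV p z) := by
    rw [injective_iff_map_eq_zero]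
    intro a ha
    have h := H.isometric z hz a a
    have h0 : g.inner (lift p z) (dp p z a) (dp p z a) = 0 := by
      have : dp p z a = 0 := ha
      rw [this, map_zero]
    rw [h0] at h
    exact inner_self_eq_zero.1 h.symm
  exact ⟨(LinearEquiv.ofInjectiveEndo (dpV p z).toLinearMap hinj).toContinuousLinearEquiv, by
    ext1 x; rfl⟩

theorem contDiffOn_chart (x₀ : N) :
    ContDiffOn ℝ ∞ (extChartAt (𝓡∂ (n + 1)) x₀ ∘ lift p)
      (strip n ∩ lift p ⁻¹' (chartAt (EuclideanHalfSpace (n + 1)) x₀).source) := by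
  intro z hz
  rw [← contMDiffWithinAt_iff_contDiffWithinAt]
  exact (contMDiffAt_extChartAt' hz.2).comp_contMDiffWithinAt z ((H.smooth z hz.1).mono inter_subset_left)

theorem hasFDerivWithinAt_chart {x₀ : N} {z : Vec n} (hz : z ∈ strip n)
    (hzx : lift p z ∈ (chartAt (EuclideanHalfSpace (n + 1)) x₀).source) :
    ∃ B : Vec n ≃L[ℝ] Vec n,
      (B : Vec n →L[ℝ] Vec n) = mfderiv (𝓡∂ (n + 1)) 𝓘(ℝ, Vec n) (extChartAt (𝓡∂ (n + 1)) x₀) (lift p z) ∧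
      HasFDerivWithinAt (extChartAt (𝓡∂ (n + 1)) x₀ ∘ lift p)
        ((B : Vec n →L[ℝ] Vec n) ∘L dpV p z) (strip n) z := by
  have : IsManifold (𝓡∂ (n + 1)) 1 N := IsManifold.of_le (n := ∞) (by simp)
  obtain ⟨B, hB⟩ := isInvertible_mfderiv_extChartAt (I := 𝓡∂ (n + 1)) (x := x₀) (y := lift p z)
    (by rwa [extChartAt_source])
  refine ⟨B, hB, ?_⟩
  have h1 := (mdifferentiableAt_extChartAt (I := 𝓡∂ (n + 1)) hzx).hasMFDerivAt
  have h2 := HasMFDerivAt.comp_hasMFDerivWithinAt z h1 (H.hasMFDerivWithinAt hz)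
  rw [← hB] at h2
  exact hasMFDerivWithinAt_iff_hasFDerivWithinAt.1 h2

/-- A continuous lift of a differentiable map is differentiable. -/
theorem hasFDerivWithinAt_of_lift {E : Type*} [NormedAddCommGroup E] [NormedSpace ℝ E]
    {k : E → N} {G : E → Vec n} {s : Set E} {a : E} (ha : a ∈ s)
    (hG : ContinuousWithinAt G s a) (hGs : ∀ x ∈ s, G x ∈ strip n)
    (hGk : ∀ x ∈ s, lift p (G x) = k x) {k' : E →L[ℝ] Vec n}
    (hk : HasMFDerivWithinAt 𝓘(ℝ, E) (𝓡∂ (n + 1)) k s a k') :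
    HasFDerivWithinAt G ((dpV p (G a)).inverse ∘L k') s a := by
  have : IsManifold (𝓡∂ (n + 1)) 1 N := IsManifold.of_le (n := ∞) (by simp)
  obtain ⟨A, hA⟩ := H.exists_equiv (hGs a ha)
  have hka := hGk a ha
  have hsrc : k a ∈ (chartAt (EuclideanHalfSpace (n + 1)) (k a)).source := mem_chart_source _ _
  obtain ⟨B, hB, hψ⟩ := H.hasFDerivWithinAt_chart (x₀ := k a) (hGs a ha) (by rw [hka]; exact hsrc)
  have h1 := HasMFDerivAt.comp_hasMFDerivWithinAt a
    (mdifferentiableAt_extChartAt (I := 𝓡∂ (n + 1)) hsrc).hasMFDerivAt hk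
  rw [hasMFDerivWithinAt_iff_hasFDerivWithinAt] at h1
  have hB' : (B : Vec n →L[ℝ] Vec n) =
      mfderiv (𝓡∂ (n + 1)) 𝓘(ℝ, Vec n) (extChartAt (𝓡∂ (n + 1)) (k a)) (k a) := by
    rw [hB, hka]
  have h2 : HasFDerivWithinAt (extChartAt (𝓡∂ (n + 1)) (k a) ∘ k)
    ((B : Vec n →L[ℝ] Vec n) ∘L k') s a := by
    rw [hB']; exact h1
  rw [← hA] at hψ ⊢
  have h3 := hψ.of_comp_of_leftInverse (g := G) (s := s) (a := a)
    (h := extChartAt (𝓡∂ (n + 1)) (k a) ∘ k)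
    (f'symm := (A.symm : Vec n →L[ℝ] Vec n) ∘L (B.symm : Vec n →L[ℝ] Vec n))
    (tendsto_nhdsWithin_iff.2 ⟨hG, eventually_nhdsWithin_of_forall hGs⟩) h2
    (eventually_nhdsWithin_of_forall fun x hx => by simp [hGk x hx]) (fun x => by simp) ha
  rw [ContinuousLinearMap.inverse_equiv]
  have h4 : ((A.symm : Vec n →L[ℝ] Vec n) ∘L (B.symm : Vec n →L[ℝ] Vec n)) ∘L
      ((B : Vec n →L[ℝ] Vec n) ∘L k') = (A.symm : Vec n →L[ℝ] Vec n) ∘L k' := by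
    ext1 x
    simp
  rwa [h4] at h3

end IsTwistedSlab

/-- The quotient map has continuous local sections. -/
theorem exists_section_quot (z₀ : Vec n) :
    ∃ S : Slab n → Vec n, (∀ s, S s ∈ strip n) ∧ (∀ᶠ s in 𝓝 (quot z₀), ContinuousAt S s) ∧
      (∀ᶠ s in 𝓝 (quot z₀), quot (S s) = s) ∧ ∀ᶠ z in 𝓝[strip n] z₀, S (quot z) = z := by
  choose e he he' using fun i : Fin n => AddCircle.isLocalHomeomorph_coe (1:ℝ) (z₀ i.succ)
  have hsrc : ∀ᶠ s in 𝓝 (quot z₀), ∀ i, s.2 i ∈ (e i).target := by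
    rw [Filter.eventually_all]
    intro i
    have : Filter.Tendsto (fun s : Slab n => s.2 i) (𝓝 (quot z₀)) (𝓝 ((quot z₀).2 i)) :=
      (continuous_apply i |>.comp continuous_snd).tendsto _
    refine this ((e i).open_target.mem_nhds ?_)
    change ((z₀ i.succ : ℝ) : UnitAddCircle) ∈ _
    have h2 := (e i).map_source (he i)
    rwa [← he' i] at h2
  refine ⟨fun s => vec s.1 (WithLp.toLp 2 fun i => (e i).symm (s.2 i)), fun s => s.1.2, ?_, ?_, ?_⟩
  · filter_upwards [hsrc] with s hs
    refine (PiLp.continuous_toLp 2 _).continuousAt.comp (continuousAt_pi.2 fun i => ?_)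
    refine Fin.cases ?_ (fun i => ?_) i
    · simp only [Fin.cons_zero]; fun_prop
    · simp only [Fin.cons_succ]
      exact ContinuousAt.comp' (f := fun s : Slab n => s.2 i) ((e i).continuousAt_symm (hs i))
        (continuous_apply i |>.comp continuous_snd).continuousAt
  · filter_upwards [hsrc] with s hs
    refine Prod.ext (projIcc_val zero_le_one _) (funext fun i => ?_)
    change (((e i).symm (s.2 i) : ℝ) : UnitAddCircle) = s.2 i
    have h2 := (e i).right_inv (hs i)
    rwa [← he' i] at h2
  · have h1 : ∀ᶠ z in 𝓝[strip n] z₀, ∀ i : Fin n, z i.succ ∈ (e i).source := by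
      rw [Filter.eventually_all]
      intro i
      have : Filter.Tendsto (fun z : Vec n => z i.succ) (𝓝 z₀) (𝓝 (z₀ i.succ)) :=
        Continuous.tendsto (by fun_prop) _
      exact (this.mono_left nhdsWithin_le_nhds) ((e i).open_source.mem_nhds (he i))
    filter_upwards [h1, self_mem_nhdsWithin] with z hz hzs
    ext i
    refine Fin.cases ?_ (fun i => ?_) i
    · exact congrArg Subtype.val (projIcc_of_mem zero_le_one hzs)
    · change (e i).symm ((z i.succ : ℝ) : UnitAddCircle) = z i.succ
      have h2 := (e i).left_inv (hz i)
      rwa [← he' i] at h2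

/-- Local inverses of `p` in charts: near `z₀` the map `lift p` followed by the chart at
`lift p z₀` has a smooth inverse `η`, defined on a neighbourhood in the half space. -/
theorem IsTwistedSlab.exists_local_inverse (H : IsTwistedSlab g p) (z₀ : Vec n) :
    ∃ η : Vec n → Vec n, ∃ V : Set (Vec n), IsOpen V ∧
      extChartAt (𝓡∂ (n + 1)) (lift p z₀) (lift p z₀) ∈ V ∧
      ContDiffOn ℝ ∞ η (range (𝓡∂ (n + 1)) ∩ V) ∧
      (∀ y ∈ range (𝓡∂ (n + 1)) ∩ V, η y ∈ strip n ∧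
        lift p (η y) = (extChartAt (𝓡∂ (n + 1)) (lift p z₀)).symm y ∧
        y ∈ (extChartAt (𝓡∂ (n + 1)) (lift p z₀)).target) ∧
      ∀ᶠ z in 𝓝[strip n] z₀, η (extChartAt (𝓡∂ (n + 1)) (lift p z₀) (lift p z)) = z := by
  obtain ⟨S, hS1, hS2, hS3, hS4⟩ := exists_section_quot z₀
  obtain ⟨e, he, he'⟩ := H.covering.isLocalHomeomorph (quot z₀)
  set x₀ := lift p z₀ with hx₀
  set φ := extChartAt (𝓡∂ (n + 1)) x₀ with hφ
  have hex : e (quot z₀) = x₀ := by rw [← he']; rfl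
  have hxt : x₀ ∈ e.target := hex ▸ e.map_source he
  have hesymm : e.symm x₀ = quot z₀ := by rw [← hex, e.left_inv he]
  have hφ0 : φ.symm (φ x₀) = x₀ := extChartAt_to_inv x₀
  -- the properties that hold near `φ x₀` in the half space
  have hcont : Filter.Tendsto (fun y => e.symm (φ.symm y)) (𝓝[range (𝓡∂ (n + 1))] (φ x₀)) (𝓝 (quot z₀)) := by
    have h1 : Filter.Tendsto φ.symm (𝓝[range (𝓡∂ (n + 1))] (φ x₀)) (𝓝 x₀) := by
      have := (continuousAt_extChartAt_symm (I := 𝓡∂ (n + 1)) x₀).tendsto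
      rw [← hφ, hφ0] at this
      exact this.mono_left nhdsWithin_le_nhds
    have h2 := (e.continuousAt_symm hxt).tendsto
    rw [hesymm] at h2
    exact h2.comp h1
  have hcφ : ContinuousAt φ.symm (φ x₀) := continuousAt_extChartAt_symm x₀
  have hev : ∀ᶠ y in 𝓝[range (𝓡∂ (n + 1))] (φ x₀), y ∈ φ.target ∧ φ.symm y ∈ e.target ∧
      ContinuousAt S (e.symm (φ.symm y)) ∧ quot (S (e.symm (φ.symm y))) = e.symm (φ.symm y) := by
    refine Filter.Eventually.and (extChartAt_target_mem_nhdsWithin x₀) (Filter.Eventually.and ?_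
      ((hcont.eventually hS2).and (hcont.eventually hS3)))
    have : Filter.Tendsto φ.symm (𝓝[range (𝓡∂ (n + 1))] (φ x₀)) (𝓝 x₀) := by
      have := hcφ.tendsto
      rw [hφ0] at this
      exact this.mono_left nhdsWithin_le_nhds
    exact this (e.open_target.mem_nhds hxt)
  obtain ⟨V, hVo, hxV, hV⟩ := mem_nhdsWithin.1 hev
  have hlift : ∀ y ∈ range (𝓡∂ (n + 1)) ∩ V, lift p (S (e.symm (φ.symm y))) = φ.symm y := by
    intro y hy
    obtain ⟨h1, h2, h3, h4⟩ := hV ⟨hy.2, hy.1⟩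
    rw [lift, h4, he', e.right_inv h2]
  refine ⟨fun y => S (e.symm (φ.symm y)), V, hVo, hxV, ?_, fun y hy => ⟨hS1 _, hlift y hy,
    (hV ⟨hy.2, hy.1⟩).1⟩, ?_⟩
  · have hopen : IsOpen (lift p ⁻¹' (chartAt (EuclideanHalfSpace (n + 1)) x₀).source) :=
      (chartAt (EuclideanHalfSpace (n + 1)) x₀).open_source.preimage H.continuous_lift
    refine contDiffOn_of_rightInverse (ψ := φ ∘ lift p)
      (S := strip n ∩ lift p ⁻¹' (chartAt (EuclideanHalfSpace (n + 1)) x₀).source)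
      (uniqueDiffOn_strip.inter hopen)
      ((𝓡∂ (n + 1)).uniqueDiffOn.inter hVo) (H.contDiffOn_chart x₀) ?_ ?_ ?_ ?_
    · intro y hy
      obtain ⟨h1, h2, h3, h4⟩ := hV ⟨hy.2, hy.1⟩
      have hc : ContinuousWithinAt φ.symm (range (𝓡∂ (n + 1)) ∩ V) y :=
        (continuousAt_extChartAt_symm'' h1).continuousWithinAt
      exact ContinuousAt.comp_continuousWithinAt (f := fun y => e.symm (φ.symm y)) h3
        (ContinuousAt.comp_continuousWithinAt (f := φ.symm) (e.continuousAt_symm h2) hc)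
    · intro y hy
      refine ⟨hS1 _, ?_⟩
      rw [mem_preimage, hlift y hy, ← extChartAt_source (𝓡∂ (n + 1))]
      exact φ.map_target (hV ⟨hy.2, hy.1⟩).1
    · intro y hy
      rw [Function.comp, hlift y hy, φ.right_inv (hV ⟨hy.2, hy.1⟩).1]
    · intro z hz
      obtain ⟨A, hA⟩ := H.exists_equiv hz.1
      obtain ⟨B, hB, hB'⟩ := H.hasFDerivWithinAt_chart hz.1 hz.2
      rw [← hA] at hB'
      exact ⟨A.trans B, hB'.mono inter_subset_left⟩
  · have h1 : ∀ᶠ z in 𝓝 z₀, quot z ∈ e.source :=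
      continuous_quot.continuousAt.eventually (e.open_source.mem_nhds he)
    have h2 : ∀ᶠ z in 𝓝 z₀, lift p z ∈ φ.source :=
      H.continuous_lift.continuousAt.eventually (extChartAt_source_mem_nhds x₀)
    filter_upwards [h1.filter_mono nhdsWithin_le_nhds, h2.filter_mono nhdsWithin_le_nhds, hS4]
      with z hz1 hz2 hz3
    rw [φ.left_inv hz2, lift, he', e.left_inv hz1, hz3]

end

/-! ### The metric of `N` in local coordinates -/

section

variable {n : ℕ} {N : Type u} [TopologicalSpace N]
  [ChartedSpace (EuclideanHalfSpace (n + 1)) N] [IsManifold (𝓡∂ (n + 1)) ∞ N]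
  {g : SmoothMetric n N} {p : Slab n → N}

theorem two_le_infty : (2 : WithTop ℕ∞) ≤ ∞ :=
  WithTop.coe_le_coe.2 (le_top : (2 : ℕ∞) ≤ ⊤)

namespace IsTwistedSlab

/-- In a chart, the metric is the pullback of the Euclidean metric by a local inverse `η` of the
covering. -/
theorem exists_equiv_of_local_inverse (H : IsTwistedSlab g p) {x₀ : N} {η : Vec n → Vec n}
    {V : Set (Vec n)} (hη : ContDiffOn ℝ ∞ η (range (𝓡∂ (n + 1)) ∩ V))
    (hinv : ∀ y ∈ range (𝓡∂ (n + 1)) ∩ V, η y ∈ strip n ∧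
        lift p (η y) = (extChartAt (𝓡∂ (n + 1)) x₀).symm y ∧
        y ∈ (extChartAt (𝓡∂ (n + 1)) x₀).target) {y : Vec n} (hy : y ∈ range (𝓡∂ (n + 1)) ∩ V) :
    ∃ β : Vec n ≃L[ℝ] Vec n, HasFDerivWithinAt η (β : Vec n →L[ℝ] Vec n) (range (𝓡∂ (n + 1)) ∩ V) y ∧
      ∀ a b, metricInChart g x₀ y a b = inner ℝ (β a) (β b) := by
  have : IsManifold (𝓡∂ (n + 1)) 1 N := IsManifold.of_le (n := ∞) (by simp)
  obtain ⟨B, hB⟩ := isInvertible_mfderivWithin_extChartAt_symm (I := 𝓡∂ (n + 1)) (hinv y hy).2.2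
  have hk := (mdifferentiableWithinAt_extChartAt_symm (I := 𝓡∂ (n + 1))
    (hinv y hy).2.2).hasMFDerivWithinAt.mono (inter_subset_left (t := V))
  obtain ⟨A, hA⟩ := H.exists_equiv (hinv y hy).1
  have h1 := H.hasFDerivWithinAt_of_lift (G := η) hy (hη.continuousOn y hy) (fun x hx => (hinv x hx).1)
    (fun x hx => (hinv x hx).2.1) hk
  let B' : Vec n ≃L[ℝ] Vec n := B
  refine ⟨B'.trans A.symm, ?_, fun a b => ?_⟩
  · rw [← hB, ← hA, ContinuousLinearMap.inverse_equiv] at h1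
    exact h1
  · have hx := (hinv y hy).2.1
    have h2 := H.isometric (η y) (hinv y hy).1 (A.symm (B' a)) (A.symm (B' b))
    have h3 : ∀ v, dp p (η y) v = A v := fun v =>
      (congrArg (fun L : Vec n →L[ℝ] Vec n => L v) hA).symm
    rw [h3, h3] at h2
    simp only [A.apply_symm_apply] at h2
    rw [ContinuousLinearEquiv.trans_apply, ContinuousLinearEquiv.trans_apply, ← h2, metricInChart, ← hB]
    have h4 : ∀ x x' : N, x = x' → ∀ v w : Vec n, g.inner x v w = g.inner x' v w := by
      rintro x _ rfl v w; rfl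
    exact h4 _ _ hx.symm _ _

/-- The boundary components `x = 0` and `x = 1` of the strip are mapped to the boundary of `N`. -/
theorem mem_boundary (H : IsTwistedSlab g p) {z : Vec n} (hz : z 0 = 0 ∨ z 0 = 1) :
    lift p z ∈ (𝓡∂ (n + 1)).boundary N := by
  have hzs : z ∈ strip n := by
    rcases hz with h | h <;> simp [strip, h]
  obtain ⟨η, V, hVo, hxV, hη, hinv, hev⟩ := H.exists_local_inverse z
  by_contra hb
  have hint : (𝓡∂ (n + 1)).IsInteriorPoint (lift p z) :=
    ((𝓡∂ (n + 1)).isInteriorPoint_or_isBoundaryPoint _).resolve_right hb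
  set y := extChartAt (𝓡∂ (n + 1)) (lift p z) (lift p z) with hy
  have hyT : y ∈ range (𝓡∂ (n + 1)) ∩ V := ⟨interior_subset hint, hxV⟩
  have hT : range (𝓡∂ (n + 1)) ∩ V ∈ 𝓝 y :=
    Filter.inter_mem (mem_interior_iff_mem_nhds.1 hint) (hVo.mem_nhds hxV)
  obtain ⟨β, hβ, -⟩ := H.exists_equiv_of_local_inverse hη hinv hyT
  have hηy : η y = z := hev.self_of_nhdsWithin hzs
  have hd : HasFDerivAt (fun y => η y 0) ((EuclideanSpace.proj (0 : Fin (n + 1)) : Vec n →L[ℝ] ℝ) ∘L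
      (β : Vec n →L[ℝ] Vec n)) y :=
    (EuclideanSpace.proj (0 : Fin (n + 1)) : Vec n →L[ℝ] ℝ).hasFDerivAt.comp y (hβ.hasFDerivAt hT)
  have hext : IsLocalExtr (fun y => η y 0) y := by
    rcases hz with h | h
    · left
      filter_upwards [hT] with x hx
      rw [hηy, h]; exact (hinv x hx).1.1
    · right
      filter_upwards [hT] with x hx
      rw [hηy, h]; exact (hinv x hx).1.2
  -- At an interior point the chart domain is a neighbourhood, so the submersion `y ↦ η y 0` would have
  -- a local extremum.
  have h0 := hext.hasFDerivAt_eq_zero hd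
  have h1 := congrArg (fun L : Vec n →L[ℝ] ℝ => L (β.symm (EuclideanSpace.single 0 1))) h0
  simp at h1

/-- The two sides of the geodesic equation for a curve `γ` in `N`, computed by means of a lift `c` to
the strip: they differ by `⟪c'', β w⟫`. -/
theorem hasDerivAt_metricInChart (H : IsTwistedSlab g p) {γ : ℝ → N} {c : ℝ → Vec n} {t : ℝ} {x₀ : N}
    (hx₀ : lift p (c t) = x₀) (hc : ContinuousAt c t)
    (hcs : ∀ᶠ s in 𝓝 t, c s ∈ strip n ∧ lift p (c s) = γ s)
    (hγ : ContMDiffAt 𝓘(ℝ, ℝ) (𝓡∂ (n + 1)) ∞ γ t) :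
    ContDiffAt ℝ ∞ c t ∧ ∃ β : Vec n ≃L[ℝ] Vec n, ∀ w : Vec n,
      let σ : ℝ → Vec n := fun s => extChartAt (𝓡∂ (n + 1)) x₀ (γ s)
      HasDerivAt (fun s => metricInChart g x₀ (σ s) (deriv σ s) w)
        ((1 / 2 : ℝ) * fderivWithin ℝ (fun y => metricInChart g x₀ y (deriv σ t) (deriv σ t))
          (range (𝓡∂ (n + 1))) (σ t) w + inner ℝ (deriv (deriv c) t) (β w)) t := by
  subst hx₀
  obtain ⟨hct, hγt⟩ := hcs.self_of_nhds
  obtain ⟨η, V, hVo, hxV, hη, hinv, hev⟩ := H.exists_local_inverse (c t)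
  set x₀ := lift p (c t) with hx₀
  set σ : ℝ → Vec n := fun s => extChartAt (𝓡∂ (n + 1)) x₀ (γ s) with hσ
  set R := range (𝓡∂ (n + 1)) with hR
  set T := R ∩ V with hT
  have hTu : UniqueDiffOn ℝ T := (𝓡∂ (n + 1)).uniqueDiffOn.inter hVo
  have hσt : σ t = extChartAt (𝓡∂ (n + 1)) x₀ x₀ := by rw [hσ]; simp only [← hγt]
  have hσd : ContDiffAt ℝ ∞ σ t := by
    rw [← contMDiffAt_iff_contDiffAt]
    refine ContMDiffAt.comp t (contMDiffAt_extChartAt' ?_) hγ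
    rw [← hγt]; exact mem_chart_source _ _
  have hσR : ∀ s, σ s ∈ R := fun s => by
    rw [hσ, hR]; simp only [extChartAt_coe]; exact mem_range_self _
  have hσV : ∀ᶠ s in 𝓝 t, σ s ∈ V := hσd.continuousAt.eventually (hVo.mem_nhds (by rwa [hσt]))
  have hcη : ∀ᶠ s in 𝓝 t, η (σ s) = c s := by
    have h1 : Filter.Tendsto c (𝓝 t) (𝓝[strip n] (c t)) :=
      tendsto_nhdsWithin_iff.2 ⟨hc, hcs.mono fun s h => h.1⟩
    filter_upwards [h1.eventually hev, hcs] with s h2 h3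
    rw [h3.2] at h2
    exact h2
  have hσ1 : ∀ᶠ s in 𝓝 t, ContDiffAt ℝ 1 σ s :=
    (hσd.of_le (by exact_mod_cast le_top)).eventually (by simp)
  obtain ⟨U, hU, hUo, htU⟩ := eventually_nhds_iff.1 (hσV.and (hcη.and hσ1))
  have hmaps : MapsTo σ U T := fun s hs => ⟨hσR s, (hU s hs).1⟩
  have hcd : ContDiffAt ℝ ∞ c t := by
    have h1 : ContDiffWithinAt ℝ ∞ (η ∘ σ) U t :=
      (hη (σ t) (hmaps htU)).comp t hσd.contDiffWithinAt hmaps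
    exact (h1.contDiffAt (hUo.mem_nhds htU)).congr_of_eventuallyEq (hcη.mono fun s h => h.symm)
  refine ⟨hcd, ?_⟩
  set D : Vec n → Vec n →L[ℝ] Vec n := fderivWithin ℝ η T with hD
  have hmet : ∀ y ∈ T, ∀ a b, metricInChart g x₀ y a b = inner ℝ (D y a) (D y b) := by
    intro y hy a b
    obtain ⟨β, hβ, hβ'⟩ := H.exists_equiv_of_local_inverse hη hinv hy
    rw [hD, hβ.fderivWithin (hTu y hy)]
    exact hβ' a b
  have hηd : ∀ y ∈ T, HasFDerivWithinAt η (D y) T y := fun y hy =>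
    ((hη.differentiableOn (by simp)) y hy).hasFDerivWithinAt
  have hDd : HasFDerivWithinAt D (fderivWithin ℝ D T (σ t)) T (σ t) :=
    (((hη.fderivWithin (m := ∞) hTu (by simp)).differentiableOn (by simp)) _ (hmaps htU)).hasFDerivWithinAt
  set D2 := fderivWithin ℝ D T (σ t) with hD2
  have hsymm : ∀ v w, D2 v w = D2 w v := by
    have hcl : σ t ∈ closure (interior T) := by
      rw [hT, interior_inter, hVo.interior_eq]
      have h1 := (𝓡∂ (n + 1)).range_subset_closure_interior (hσR t)
      rw [inter_comm]
      exact hVo.inter_closure ⟨(hmaps htU).2, h1⟩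
    exact (hη (σ t) (hmaps htU)).isSymmSndFDerivWithinAt
      (by simpa using two_le_infty) hTu hcl (hmaps htU)
  have hσ' : ∀ s ∈ U, HasDerivAt σ (deriv σ s) s := fun s hs =>
    ((hU s hs).2.2.differentiableAt (by simp)).hasDerivAt
  have hc' : ∀ s ∈ U, deriv c s = D (σ s) (deriv σ s) := by
    intro s hs
    have h1 : HasDerivWithinAt (η ∘ σ) (D (σ s) (deriv σ s)) U s :=
      (hηd (σ s) (hmaps hs)).comp_hasDerivWithinAt s (hσ' s hs).hasDerivWithinAt hmaps
    have h2 := h1.hasDerivAt (hUo.mem_nhds hs)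
    refine (h2.congr_of_eventuallyEq ?_).deriv
    filter_upwards [hUo.mem_nhds hs] with r hr
    exact (hU r hr).2.1.symm
  obtain ⟨β, hβ, -⟩ := H.exists_equiv_of_local_inverse hη hinv (hmaps htU)
  have hDβ : D (σ t) = (β : Vec n →L[ℝ] Vec n) := hβ.fderivWithin (hTu _ (hmaps htU))
  refine ⟨β, fun w => ?_⟩
  -- The metric in the chart is `⟪D y a, D y b⟫`, and `D (σ s) (σ' s) = c' s`, so the left-hand side is
  -- `d/ds ⟪c', D (σ s) w⟫`.
  have hc2 : HasDerivAt (deriv c) (deriv (deriv c) t) t := by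
    have : ContDiffAt ℝ 1 (deriv c) t := by
      have h2 : ContDiffAt ℝ 1 (fderiv ℝ c) t := hcd.fderiv_right (m := 1)
        (by simpa [one_add_one_eq_two] using two_le_infty)
      exact h2.clm_apply contDiffAt_const
    exact (this.differentiableAt (by simp)).hasDerivAt
  have hDσ : HasDerivAt (fun s => D (σ s) w) (D2 (deriv σ t) w) t := by
    have h1 : HasDerivWithinAt (D ∘ σ) (D2 (deriv σ t)) U t :=
      hDd.comp_hasDerivWithinAt t (hσ' t htU).hasDerivWithinAt hmaps
    have h2 := h1.hasDerivAt (hUo.mem_nhds htU)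
    simpa using h2.clm_apply (hasDerivAt_const t w)
  have hL : HasDerivAt (fun s => metricInChart g x₀ (σ s) (deriv σ s) w)
      (inner ℝ (deriv c t) (D2 (deriv σ t) w) + inner ℝ (deriv (deriv c) t) (D (σ t) w)) t := by
    refine (hc2.inner ℝ hDσ).congr_of_eventuallyEq ?_
    filter_upwards [hUo.mem_nhds htU] with s hs
    rw [hmet _ (hmaps hs), hc' s hs]
  -- The right-hand side is `⟪c', D2 w σ'⟫`; symmetry of the second derivative `D2` of `η` identifies it
  -- with one of the two terms above.
  have hRd : fderivWithin ℝ (fun y => metricInChart g x₀ y (deriv σ t) (deriv σ t)) R (σ t) w =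
      2 * inner ℝ (deriv c t) (D2 w (deriv σ t)) := by
    have h1 : HasFDerivWithinAt (fun y => D y (deriv σ t)) (D2.flip (deriv σ t)) T (σ t) :=
      by simpa using hDd.clm_apply (hasFDerivWithinAt_const (deriv σ t) (σ t) T)
    have h2 := (h1.inner ℝ h1)
    have h3 : HasFDerivWithinAt (fun y => metricInChart g x₀ y (deriv σ t) (deriv σ t)) _ T (σ t) :=
      h2.congr (fun y hy => hmet y hy _ _) (hmet _ (hmaps htU) _ _)
    rw [← fderivWithin_inter (hVo.mem_nhds (hmaps htU).2), h3.fderivWithin (hTu _ (hmaps htU)), hc' t htU]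
    simp [real_inner_comm, two_mul]
  change HasDerivAt (fun s => metricInChart g x₀ (σ s) (deriv σ s) w)
    ((1 / 2 : ℝ) * fderivWithin ℝ (fun y => metricInChart g x₀ y (deriv σ t) (deriv σ t)) R (σ t) w +
      inner ℝ (deriv (deriv c) t) (β w)) t
  have hDw : D (σ t) w = β w := congrArg (fun L : Vec n →L[ℝ] Vec n => L w) hDβ
  rw [hRd, ← hDw, hsymm w]
  convert hL using 1
  ring

end IsTwistedSlab

end

/-! ### Geodesics and the X-ray transform on the strip -/

section

variable {n : ℕ} {N : Type u} [TopologicalSpace N]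
  [ChartedSpace (EuclideanHalfSpace (n + 1)) N] [IsManifold (𝓡∂ (n + 1)) ∞ N]
  {g : SmoothMetric n N} {p : Slab n → N}

/-- The straight line in the strip from `(0, a)` to `(1, a + b)`. -/
def line (a b : EuclideanSpace ℝ (Fin n)) (t : ℝ) : Vec n := vec t (a + t • b)

theorem line_eq (a b : EuclideanSpace ℝ (Fin n)) (t : ℝ) : line a b t = vec 0 a + t • vec 1 b := by
  ext i
  refine Fin.cases ?_ (fun i => ?_) i
  · simp [line, vec]
  · simp [line, vec]

theorem line_mem_strip (a b : EuclideanSpace ℝ (Fin n)) {t : ℝ} (ht : t ∈ Icc (0 : ℝ) 1) :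
    line a b t ∈ strip n := ht

theorem line_at_zero (a b : EuclideanSpace ℝ (Fin n)) : line a b 0 = vec 0 a := by simp [line]

theorem hasDerivAt_line (a b : EuclideanSpace ℝ (Fin n)) (t : ℝ) :
    HasDerivAt (line a b) (vec 1 b) t := by
  have : HasDerivAt (fun t : ℝ => vec 0 a + t • vec 1 b) ((1 : ℝ) • vec 1 b) t :=
    ((hasDerivAt_id t).smul_const (vec 1 b)).const_add (vec 0 a)
  rw [one_smul] at this
  exact this.congr_of_eventuallyEq (Filter.Eventually.of_forall (line_eq a b))

theorem contDiff_line (a b : EuclideanSpace ℝ (Fin n)) : ContDiff ℝ ∞ (line a b) := by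
  rw [show line a b = fun t : ℝ => vec 0 a + t • vec 1 b from funext (line_eq a b)]
  fun_prop

/-- The velocity of a curve in `N`, computed by means of a lift to the strip. -/
theorem IsTwistedSlab.velocity_eq (H : IsTwistedSlab g p) {γ : ℝ → N} {c : ℝ → Vec n} {v : Vec n}
    (hc : ∀ s ∈ Icc (0 : ℝ) 1, c s ∈ strip n) (hcγ : ∀ s ∈ Icc (0 : ℝ) 1, γ s = lift p (c s))
    {t : ℝ} (ht : t ∈ Icc (0 : ℝ) 1) (hv : HasDerivWithinAt c v (Icc 0 1) t) :
    (velocity γ t : Vec n) = dpV p (c t) v := by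
  have h1 : HasMFDerivWithinAt 𝓘(ℝ, ℝ) 𝓘(ℝ, Vec n) c (Icc (0 : ℝ) 1) t
      (ContinuousLinearMap.toSpanSingleton ℝ v) :=
    hasMFDerivWithinAt_iff_hasFDerivWithinAt.2 hv.hasFDerivWithinAt
  have h2 := (HasMFDerivWithinAt.comp t (H.hasMFDerivWithinAt (hc t ht)) h1 hc).congr_mono
    (f₁ := γ) hcγ (hcγ t ht) Subset.rfl
  have h3 := h2.mfderivWithin ((uniqueMDiffWithinAt_iff_uniqueDiffWithinAt).2
    (uniqueDiffOn_Icc zero_lt_one t ht))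
  have h4 := congrArg (fun L : ℝ →L[ℝ] Vec n => L 1) h3
  refine h4.trans ?_
  change dpV p (c t) (ContinuousLinearMap.toSpanSingleton ℝ v 1) = _
  simp

/-- The ray integral of a curve whose lift is a line, as an integral over that line. -/
theorem rayIntegral_eq (H : IsTwistedSlab g p) (f : (x : N) → TangentSpace (𝓡∂ (n + 1)) x → ℂ)
    {γ : ℝ → N} {a b : EuclideanSpace ℝ (Fin n)}
    (hγ : ∀ s ∈ Icc (0 : ℝ) 1, γ s = lift p (line a b s)) :
    rayIntegral f γ = ∫ t in (0 : ℝ)..1, pullback p f (line a b t) (vec 1 b) := by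
  refine intervalIntegral.integral_congr fun t ht => ?_
  rw [uIcc_of_le zero_le_one] at ht
  have hv := H.velocity_eq (fun s hs => line_mem_strip a b hs) hγ ht
    (hasDerivAt_line a b t).hasDerivWithinAt
  have key : ∀ (x x' : N) (v v' : Vec n), x = x' → v = v' → f x v = f x' v' := by
    rintro x _ v _ rfl rfl; rfl
  exact key _ _ _ _ (hγ t ht) hv

/-- Straight lines in the strip are mapped to geodesics of `N`. -/
theorem IsTwistedSlab.isGeodesic_line (H : IsTwistedSlab g p) (a b : EuclideanSpace ℝ (Fin n)) :
    IsGeodesic g (fun t => lift p (line a b t)) := by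
  have hsm : ContMDiffOn 𝓘(ℝ, ℝ) (𝓡∂ (n + 1)) ∞ (fun t => lift p (line a b t)) (Icc (0 : ℝ) 1) :=
    H.smooth.comp (contDiff_line a b).contMDiff.contMDiffOn fun t ht => line_mem_strip a b ht
  refine ⟨hsm, fun t ht w => ?_⟩
  have hnhds : Icc (0 : ℝ) 1 ∈ 𝓝 t := Icc_mem_nhds ht.1 ht.2
  obtain ⟨-, β, hβ⟩ := H.hasDerivAt_metricInChart (γ := fun t => lift p (line a b t))
    (c := line a b) (t := t) rfl (contDiff_line a b).continuous.continuousAt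
    (by filter_upwards [hnhds] with s hs using ⟨line_mem_strip a b hs, rfl⟩)
    (hsm.contMDiffAt hnhds)
  have h2 : deriv (deriv (line a b)) t = 0 := by
    rw [show deriv (line a b) = fun _ => vec 1 b from funext fun s => (hasDerivAt_line a b s).deriv]
    simp
  have h3 := hβ w
  rw [h2, inner_zero_left] at h3
  simpa only [add_zero] using h3

/-- Geodesics are determined by their initial data: they are images of straight lines. -/
theorem IsTwistedSlab.geodesic_eq_line (H : IsTwistedSlab g p) {γ : ℝ → N} (hγ : IsGeodesic g γ)
    {a b : EuclideanSpace ℝ (Fin n)} (h0 : γ 0 = lift p (vec 0 a))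
    (hv : (velocity γ 0 : Vec n) = (dp p (vec 0 a) (vec 1 b) : Vec n)) :
    ∀ s ∈ Icc (0 : ℝ) 1, γ s = lift p (line a b s) := by
  have ha : vec 0 a ∈ strip n := by simp [strip, vec_zero]
  have h01 : (0 : ℝ) ∈ Icc (0 : ℝ) 1 := ⟨le_rfl, zero_le_one⟩
  obtain ⟨c, hc, hcs, hc0, hcγ⟩ := exists_lift_to_strip H.covering
    (f := fun t : ℝ => γ (projIcc 0 1 zero_le_one t))
    (hγ.1.continuousOn.comp_continuous (by fun_prop) fun t => (projIcc 0 1 zero_le_one t).2)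
    (0 : ℝ) ha (by simp [h0])
  replace hcγ : ∀ s ∈ Icc (0 : ℝ) 1, lift p (c s) = γ s := fun s hs => by
    rw [hcγ, projIcc_of_mem _ hs]
  -- In terms of a lift `c`, the geodesic equation says `⟪c'', β w⟫ = 0` for all `w`, hence `c'' = 0`.
  have key : ∀ t ∈ Ioo (0 : ℝ) 1, ContDiffAt ℝ ∞ c t ∧ deriv (deriv c) t = 0 := by
    intro t ht
    have hnhds : Icc (0 : ℝ) 1 ∈ 𝓝 t := Icc_mem_nhds ht.1 ht.2
    obtain ⟨h1, β, hβ⟩ := H.hasDerivAt_metricInChart (γ := γ) (c := c) (t := t) (x₀ := γ t)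
      (hcγ t (Ioo_subset_Icc_self ht)) hc.continuousAt
      (by filter_upwards [hnhds] with s hs using ⟨hcs s, hcγ s hs⟩)
      (hγ.1.contMDiffAt hnhds)
    refine ⟨h1, ?_⟩
    have h2 := (hγ.2 t ht (β.symm (deriv (deriv c) t))).unique (hβ (β.symm (deriv (deriv c) t)))
    rw [β.apply_symm_apply, left_eq_add] at h2
    exact inner_self_eq_zero.1 h2
  have hcd : ∀ t ∈ Ioo (0 : ℝ) 1, DifferentiableAt ℝ (deriv c) t := by
    intro t ht
    have h1 : ContDiffAt ℝ 1 (fderiv ℝ c) t :=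
      (key t ht).1.fderiv_right (m := 1) (by simpa [one_add_one_eq_two] using two_le_infty)
    exact (h1.clm_apply contDiffAt_const).differentiableAt (by simp)
  set v := deriv c (1 / 2) with hvdef
  have hhalf : (1 / 2 : ℝ) ∈ Ioo (0 : ℝ) 1 := by norm_num
  have hconst : ∀ t ∈ Ioo (0 : ℝ) 1, deriv c t = v := fun t ht =>
    isOpen_Ioo.is_const_of_deriv_eq_zero isPreconnected_Ioo
      (fun s hs => (hcd s hs).differentiableWithinAt) (fun s hs => (key s hs).2) ht hhalf
  have hlin : EqOn c (fun t => (c (1 / 2) - (1 / 2 : ℝ) • v) + t • v) (Ioo 0 1) := by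
    intro t ht
    have hd : ∀ s ∈ Ioo (0 : ℝ) 1, HasDerivAt (fun s => c s - s • v) 0 s := by
      intro s hs
      have h1 := ((key s hs).1.differentiableAt (by simp)).hasDerivAt.sub
        ((hasDerivAt_id s).smul_const v)
      rw [hconst s hs, one_smul, sub_self] at h1
      exact h1
    have h2 := isOpen_Ioo.is_const_of_deriv_eq_zero isPreconnected_Ioo (f := fun s => c s - s • v)
      (fun s hs => (hd s hs).differentiableAt.differentiableWithinAt) (fun s hs => (hd s hs).deriv)
      ht hhalf
    rw [← h2]; simp
  replace hlin : EqOn c (fun t => (c (1 / 2) - (1 / 2 : ℝ) • v) + t • v) (Icc 0 1) := by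
    -- The geodesic equation is available in the open interval only; the ends follow by continuity.
    have := hlin.closure hc (by fun_prop)
    rwa [closure_Ioo zero_ne_one] at this
  have hK : c (1 / 2) - (1 / 2 : ℝ) • v = vec 0 a := by
    have := hlin h01
    simp only [zero_smul, add_zero] at this
    rw [← this, hc0]
  rw [hK] at hlin
  -- comparison of the initial velocities
  have hder : HasDerivWithinAt c v (Icc 0 1) 0 := by
    have h1 : HasDerivAt (fun t : ℝ => vec 0 a + t • v) ((1 : ℝ) • v) 0 :=
      ((hasDerivAt_id (0 : ℝ)).smul_const v).const_add (vec 0 a)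
    rw [one_smul] at h1
    exact h1.hasDerivWithinAt.congr hlin (hlin h01)
  have hv2 := H.velocity_eq (γ := γ) (fun s _ => hcs s) (fun s hs => (hcγ s hs).symm) h01 hder
  have hvb : v = vec 1 b := by
    obtain ⟨A, hA⟩ := H.exists_equiv ha
    have h1 : dpV p (vec 0 a) v = dpV p (vec 0 a) (vec 1 b) := by
      rw [hc0] at hv2
      exact hv2.symm.trans hv
    rw [← hA] at h1
    exact A.injective h1
  intro s hs
  rw [← hcγ s hs, hlin hs, hvb, line_eq]

/-- The X-ray transform on `N` in terms of integrals over lines in the strip. -/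
theorem IsTwistedSlab.xrayVanishes_iff (H : IsTwistedSlab g p)
    (f : (x : N) → TangentSpace (𝓡∂ (n + 1)) x → ℂ) :
    XrayVanishes g p f ↔ ∀ b : EuclideanSpace ℝ (Fin n), ∀ᵐ a : EuclideanSpace ℝ (Fin n),
      ∫ t in (0 : ℝ)..1, pullback p f (line a b t) (vec 1 b) = 0 := by
  refine forall_congr' fun b => Filter.eventually_congr (Filter.Eventually.of_forall fun a => ?_)
  constructor
  · intro h
    have h1 := h (fun t => lift p (line a b t)) (H.isGeodesic_line a b)
      (H.mem_boundary (Or.inl rfl)) (H.mem_boundary (Or.inr rfl)) (by rw [line_at_zero]) ?_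
    · rwa [rayIntegral_eq H f (fun s _ => rfl)] at h1
    · have h2 := H.velocity_eq (γ := fun t => lift p (line a b t)) (fun s hs => line_mem_strip a b hs)
        (fun s _ => rfl) (t := 0) ⟨le_rfl, zero_le_one⟩ (hasDerivAt_line a b 0).hasDerivWithinAt
      rw [line_at_zero] at h2
      exact h2
  · intro h γ hγ _ _ h0 hv
    rw [rayIntegral_eq H f (H.geodesic_eq_line hγ h0 hv), h]

end

/-! ### Deck transformations -/

section

/-- A distance preserving map on a set with nonempty interior is the restriction of an affine
isometry. -/
theorem exists_affineIsometryEquiv_of_dist_eq {k : ℕ} {S : Set (EuclideanSpace ℝ (Fin k))}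
    (hS : (interior S).Nonempty) {f : EuclideanSpace ℝ (Fin k) → EuclideanSpace ℝ (Fin k)}
    (hf : ∀ z ∈ S, ∀ w ∈ S, dist (f z) (f w) = dist z w) :
    ∃ γ : EuclideanSpace ℝ (Fin k) ≃ᵃⁱ[ℝ] EuclideanSpace ℝ (Fin k), ∀ z ∈ S, γ z = f z := by
  obtain ⟨w₀, hw₀⟩ := hS
  obtain ⟨ε, hε, hball⟩ := Metric.isOpen_iff.1 isOpen_interior w₀ hw₀
  have hw₀S : w₀ ∈ S := interior_subset hw₀
  set h : EuclideanSpace ℝ (Fin k) → EuclideanSpace ℝ (Fin k) := fun z => f z - f w₀ with hh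
  have hnorm : ∀ z ∈ S, ‖h z‖ = ‖z - w₀‖ := fun z hz => by
    rw [hh, ← dist_eq_norm, hf z hz w₀ hw₀S, dist_eq_norm]
  have hinner : ∀ z ∈ S, ∀ w ∈ S, inner ℝ (h z) (h w) = inner ℝ (z - w₀) (w - w₀) := by
    intro z hz w hw
    have h1 : ‖h z - h w‖ = ‖(z - w₀) - (w - w₀)‖ := by
      rw [hh, sub_sub_sub_cancel_right, sub_sub_sub_cancel_right, ← dist_eq_norm, hf z hz w hw,
        dist_eq_norm]
    rw [real_inner_eq_norm_mul_self_add_norm_mul_self_sub_norm_sub_mul_self_div_two,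
      real_inner_eq_norm_mul_self_add_norm_mul_self_sub_norm_sub_mul_self_div_two, h1, hnorm z hz,
      hnorm w hw]
  set δ := ε / 2 with hδ
  have hδ0 : δ ≠ 0 := by positivity
  have hmem : ∀ i : Fin k, w₀ + δ • EuclideanSpace.single i (1 : ℝ) ∈ S := fun i => by
    refine interior_subset (hball ?_)
    rw [Metric.mem_ball, dist_eq_norm, add_sub_cancel_left, norm_smul]
    simp [abs_of_pos hε, hδ]
    linarith
  -- The images of the coordinate directions at `w₀`; they form an orthonormal basis.
  set b : Fin k → EuclideanSpace ℝ (Fin k) := fun i => δ⁻¹ • h (w₀ + δ • EuclideanSpace.single i 1) with hb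
  have hbz : ∀ i, ∀ z ∈ S, inner ℝ (b i) (h z) = (z - w₀) i := by
    intro i z hz
    rw [hb, real_inner_smul_left, hinner _ (hmem i) z hz, add_sub_cancel_left, real_inner_smul_left,
      EuclideanSpace.inner_single_left]
    simp [hδ0]
  have hbo : Orthonormal ℝ b := by
    rw [orthonormal_iff_ite]
    intro i j
    conv_lhs => rw [hb]
    rw [real_inner_smul_right, ← hb]
    rw [hbz i _ (hmem j), add_sub_cancel_left]
    simp [hδ0]
  let B : OrthonormalBasis (Fin k) ℝ (EuclideanSpace ℝ (Fin k)) :=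
    OrthonormalBasis.mk hbo ((hbo.linearIndependent.span_eq_top_of_card_eq_finrank' (by simp)).ge)
  have hB : ∀ i, B i = b i := fun i => by simp [B]
  refine ⟨(AffineIsometryEquiv.vaddConst ℝ w₀).symm.trans
    (B.repr.symm.toAffineIsometryEquiv.trans (AffineIsometryEquiv.vaddConst ℝ (f w₀))), fun z hz => ?_⟩
  have h1 : B.repr.symm (z - w₀) = h z := by
    rw [LinearIsometryEquiv.symm_apply_eq]
    ext i
    rw [B.repr_apply_apply, hB, hbz i z hz]
  simp only [AffineIsometryEquiv.coe_trans, Function.comp_apply, AffineIsometryEquiv.coe_vaddConst_symm,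
    LinearIsometryEquiv.coe_toAffineIsometryEquiv, AffineIsometryEquiv.coe_vaddConst, vsub_eq_sub, vadd_eq_add]
  rw [h1, hh]; simp

variable {n : ℕ} {N : Type u} {p : Slab n → N}

/-- The deck transformations of the covering `[0,1] × ℝⁿ → N`, as a group of affine isometries of
`ℝ^(1+n)`. -/
def deck (p : Slab n → N) : Subgroup (Vec n ≃ᵃⁱ[ℝ] Vec n) where
  carrier := {γ | (∀ z, γ z ∈ strip n ↔ z ∈ strip n) ∧ ∀ z ∈ strip n, lift p (γ z) = lift p z}
  one_mem' := ⟨fun _ => Iff.rfl, fun _ _ => rfl⟩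
  mul_mem' := fun {γ δ} hγ hδ => ⟨fun z => (hγ.1 _).trans (hδ.1 z), fun z hz =>
    (hγ.2 _ ((hδ.1 z).2 hz)).trans (hδ.2 z hz)⟩
  inv_mem' := fun {γ} hγ => by
    have h1 : ∀ z, γ⁻¹ z ∈ strip n ↔ z ∈ strip n := fun z => by
      rw [← hγ.1]
      exact iff_of_eq (congrArg (· ∈ strip n) (γ.apply_symm_apply z))
    refine ⟨h1, fun z hz => ?_⟩
    rw [← hγ.2 _ ((h1 z).2 hz)]
    exact congrArg (lift p) (γ.apply_symm_apply z)

theorem mem_strip_of_mem_deck {γ : Vec n ≃ᵃⁱ[ℝ] Vec n} (hγ : γ ∈ deck p) {z : Vec n}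
    (hz : z ∈ strip n) : γ z ∈ strip n := (hγ.1 z).2 hz

theorem apply_eq_add (γ : Vec n ≃ᵃⁱ[ℝ] Vec n) (z w : Vec n) :
    γ z = γ w + γ.linearIsometryEquiv (z - w) := by
  have := γ.map_vadd w (z - w)
  simpa [add_comm] using this

theorem hasFDerivAt_affineIsometryEquiv (γ : Vec n ≃ᵃⁱ[ℝ] Vec n) (z : Vec n) :
    HasFDerivAt γ (γ.linearIsometryEquiv.toContinuousLinearEquiv : Vec n →L[ℝ] Vec n) z := by
  have h1 : HasFDerivAt (fun w => γ z + γ.linearIsometryEquiv (w - z))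
      (γ.linearIsometryEquiv.toContinuousLinearEquiv : Vec n →L[ℝ] Vec n) z := by
    refine HasFDerivAt.const_add _ ?_
    exact (γ.linearIsometryEquiv.toContinuousLinearEquiv.hasFDerivAt).comp z
      ((hasFDerivAt_id z).sub_const z)
  exact h1.congr_of_eventuallyEq (Filter.Eventually.of_forall fun w => apply_eq_add γ w z)

namespace IsTwistedSlab

variable [TopologicalSpace N] [ChartedSpace (EuclideanHalfSpace (n + 1)) N]
  [IsManifold (𝓡∂ (n + 1)) ∞ N] {g : SmoothMetric n N} (H : IsTwistedSlab g p)
include H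

/-- The differentials of `lift p` at two points of a fibre differ by an isometry. -/
theorem norm_inverse_dpV {z w : Vec n} (hz : z ∈ strip n) (hw : w ∈ strip n)
    (h : lift p w = lift p z) (a : Vec n) : ‖(dpV p w).inverse (dpV p z a)‖ = ‖a‖ := by
  obtain ⟨A, hA⟩ := H.exists_equiv hw
  set v := (dpV p w).inverse (dpV p z a) with hv
  have h1 : dp p w v = (dpV p z a : Vec n) := by
    have : A v = dpV p z a := by rw [hv, ← hA, ContinuousLinearMap.inverse_equiv]; simp
    rw [← this]
    exact (congrArg (fun L : Vec n →L[ℝ] Vec n => L v) hA).symm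
  have h2 := H.isometric w hw v v
  have h3 := H.isometric z hz a a
  have key : ∀ (x x' : N) (v v' : Vec n), x = x' → v = v' → g.inner x v v = g.inner x' v' v' := by
    rintro x _ v _ rfl rfl; rfl
  have h4 := key _ _ _ _ h h1
  have h5 : ‖v‖ ^ 2 = ‖a‖ ^ 2 := by
    rw [← real_inner_self_eq_norm_sq, ← real_inner_self_eq_norm_sq, ← h2, ← h3]
    exact h4
  exact (sq_eq_sq₀ (norm_nonneg _) (norm_nonneg _)).1 h5

/-- The lift of `lift p` that takes `z` to `w`, as a map of the strip to itself that does not increase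
distances. -/
theorem exists_lift_self {z w : Vec n} (hw : w ∈ strip n)
    (h : lift p w = lift p z) : ∃ ρ : Vec n → Vec n, Continuous ρ ∧ (∀ x, ρ x ∈ strip n) ∧ ρ z = w ∧
      (∀ x, lift p (ρ x) = lift p x) ∧
      ∀ x ∈ strip n, ∀ y ∈ strip n, dist (ρ x) (ρ y) ≤ dist x y := by
  obtain ⟨ρ, hρ, hρs, hρz, hρp⟩ := exists_lift_to_strip H.covering H.continuous_lift z hw h
  refine ⟨ρ, hρ, hρs, hρz, hρp, fun x hx y hy => ?_⟩
  have hd : ∀ x ∈ strip n, HasFDerivWithinAt ρ ((dpV p (ρ x)).inverse ∘L dpV p x) (strip n) x :=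
    fun x hx => H.hasFDerivWithinAt_of_lift hx hρ.continuousWithinAt (fun x _ => hρs x)
      (fun x _ => hρp x) (H.hasMFDerivWithinAt hx)
  have h1 := convex_strip.norm_image_sub_le_of_norm_hasFDerivWithin_le (f := ρ) (C := 1) hd
    (fun x hx => ContinuousLinearMap.opNorm_le_bound _ zero_le_one fun a => by
      rw [one_mul]
      exact (H.norm_inverse_dpV hx (hρs x) (hρp x) a).le) hy hx
  rw [dist_eq_norm, dist_eq_norm]
  simpa using h1

/-- The deck transformations act transitively on the fibres. -/
theorem exists_deck {z w : Vec n} (hz : z ∈ strip n) (hw : w ∈ strip n) (h : lift p w = lift p z) :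
    ∃ γ ∈ deck p, γ z = w := by
  obtain ⟨ρ, hρ, hρs, hρz, hρp, hρd⟩ := H.exists_lift_self hw h
  obtain ⟨ρ', hρ', hρs', hρz', hρp', hρd'⟩ := H.exists_lift_self hz h.symm
  have hc : PreconnectedSpace (strip n) := Subtype.preconnectedSpace convex_strip.isPreconnected
  -- The lifts that take `z` to `w` and `w` to `z` are inverse to each other by uniqueness. As neither
  -- increases distances, both are isometries.
  have h1 : ∀ x ∈ strip n, ρ' (ρ x) = x := by
    have := eq_of_lift_eq H.covering (A := strip n) (F := fun x => ρ' (ρ x)) (F' := fun x => x)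
      (by fun_prop) (by fun_prop) (fun a => hρs' _) (fun a => a.2) (fun a => by rw [hρp', hρp])
      (a₀ := ⟨z, hz⟩) (by simp [hρz, hρz'])
    exact fun x hx => congrFun this ⟨x, hx⟩
  have h2 : ∀ x ∈ strip n, ρ (ρ' x) = x := by
    have := eq_of_lift_eq H.covering (A := strip n) (F := fun x => ρ (ρ' x)) (F' := fun x => x)
      (by fun_prop) (by fun_prop) (fun a => hρs _) (fun a => a.2) (fun a => by rw [hρp, hρp'])
      (a₀ := ⟨w, hw⟩) (by simp [hρz, hρz'])
    exact fun x hx => congrFun this ⟨x, hx⟩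
  obtain ⟨γ, hγ⟩ := exists_affineIsometryEquiv_of_dist_eq interior_strip_nonempty (f := ρ)
    (fun x hx y hy => le_antisymm (hρd x hx y hy) (by
      conv_lhs => rw [← h1 x hx, ← h1 y hy]
      exact hρd' _ (hρs x) _ (hρs y)))
  refine ⟨γ, ⟨fun x => ⟨fun hx => ?_, fun hx => by rw [hγ x hx]; exact hρs x⟩, fun x hx => by
    rw [hγ x hx, hρp]⟩, by rw [hγ z hz, hρz]⟩
  have h3 : γ (ρ' (γ x)) = γ x := by rw [hγ _ (hρs' _), h2 _ hx]
  rw [← γ.injective h3]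
  exact hρs' _

/-- Deck transformations are compatible with the differentials of `lift p`. -/
theorem dpV_deck {γ : Vec n ≃ᵃⁱ[ℝ] Vec n} (hγ : γ ∈ deck p) {z : Vec n} (hz : z ∈ strip n) (v : Vec n) :
    (dpV p (γ z)).inverse (dpV p z v) = γ.linearIsometryEquiv v := by
  have h1 := H.hasFDerivWithinAt_of_lift (G := γ) hz γ.continuous.continuousWithinAt
    (fun x hx => mem_strip_of_mem_deck hγ hx) (fun x hx => hγ.2 x hx) (H.hasMFDerivWithinAt hz)
  have h2 := (uniqueDiffOn_strip z hz).eq h1 (hasFDerivAt_affineIsometryEquiv γ z).hasFDerivWithinAt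
  exact congrArg (fun L : Vec n →L[ℝ] Vec n => L v) h2

theorem dpV_deck' {γ : Vec n ≃ᵃⁱ[ℝ] Vec n} (hγ : γ ∈ deck p) {z : Vec n} (hz : z ∈ strip n) (v : Vec n) :
    dpV p (γ z) (γ.linearIsometryEquiv v) = dpV p z v := by
  obtain ⟨A, hA⟩ := H.exists_equiv (mem_strip_of_mem_deck hγ hz)
  rw [← H.dpV_deck hγ hz v, ← hA, ContinuousLinearMap.inverse_equiv]
  simp

/-- Deck transformations act freely. -/
theorem deck_eq_of_apply_eq {γ δ : Vec n ≃ᵃⁱ[ℝ] Vec n} (hγ : γ ∈ deck p) (hδ : δ ∈ deck p) {z : Vec n}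
    (hz : z ∈ strip n) (h : γ z = δ z) : γ = δ := by
  have h1 : ∀ v, γ.linearIsometryEquiv v = δ.linearIsometryEquiv v := fun v => by
    rw [← H.dpV_deck hγ hz, ← H.dpV_deck hδ hz, h]
  ext1 w
  rw [apply_eq_add γ w z, apply_eq_add δ w z, h, h1]

/-- Tensor fields on `N`, read on the strip, are invariant under the deck group. -/
theorem pullback_deck (f : (x : N) → TangentSpace (𝓡∂ (n + 1)) x → ℂ) {γ : Vec n ≃ᵃⁱ[ℝ] Vec n}
    (hγ : γ ∈ deck p) {z : Vec n} (hz : z ∈ strip n) (v : Vec n) :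
    pullback p f (γ z) (γ.linearIsometryEquiv v) = pullback p f z v := by
  have key : ∀ (x x' : N) (v v' : Vec n), x = x' → v = v' → f x v = f x' v' := by
    rintro x _ v _ rfl rfl; rfl
  exact key _ _ _ _ (hγ.2 z hz) (H.dpV_deck' hγ hz v)

end IsTwistedSlab

/-- An isometry of the strip preserves or reverses the first coordinate. -/
theorem apply_zero_of_mem_deck {γ : Vec n ≃ᵃⁱ[ℝ] Vec n} (hγ : γ ∈ deck p) :
    ((∀ z, γ z 0 = z 0) ∧ ∀ v, γ.linearIsometryEquiv v 0 = v 0) ∨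
      ((∀ z, γ z 0 = 1 - z 0) ∧ ∀ v, γ.linearIsometryEquiv v 0 = - v 0) := by
  set R := γ.linearIsometryEquiv with hR
  -- The gradient of the first coordinate of `γ`. A nonzero `y`-component would lead out of the strip.
  set r : Vec n := R.symm (EuclideanSpace.single 0 1) with hr
  have h1 : ∀ v, R v 0 = inner ℝ r v := fun v => by
    rw [hr, ← R.inner_map_map, R.apply_symm_apply, EuclideanSpace.inner_single_left]; simp
  have h2 : ∀ z, γ z 0 = γ 0 0 + inner ℝ r z := fun z => by
    rw [apply_eq_add γ z 0, sub_zero, PiLp.add_apply, ← hR, h1]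
  have hrn : ‖r‖ = 1 := by rw [hr, R.symm.norm_map]; simp
  have hsucc : ∀ i : Fin n, r i.succ = 0 := by
    intro i
    by_contra hne
    have h3 : ∀ s : ℝ, γ 0 0 + s * r i.succ ∈ Icc (0 : ℝ) 1 := fun s => by
      have h4 : EuclideanSpace.single i.succ s ∈ strip n := by
        simp [strip, (Fin.succ_ne_zero i).symm]
      have h5 : γ (EuclideanSpace.single i.succ s) 0 ∈ Icc (0 : ℝ) 1 := mem_strip_of_mem_deck hγ h4
      rw [h2, EuclideanSpace.inner_single_right] at h5
      simpa using h5
    have h4 := (h3 (2 / r i.succ)).2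
    have h5 := (h3 0).1
    rw [div_mul_cancel₀ _ hne] at h4
    linarith
  have hinner : ∀ v, inner ℝ r v = r 0 * v 0 := fun v => by
    rw [PiLp.inner_apply, Fin.sum_univ_succ]
    simp [hsucc, mul_comm]
  have hr0 : r 0 = 1 ∨ r 0 = -1 := by
    have h3 : r 0 * r 0 = 1 := by rw [← hinner, real_inner_self_eq_norm_sq, hrn]; norm_num
    exact mul_self_eq_one_iff.1 h3
  have h0 : γ 0 0 ∈ Icc (0 : ℝ) 1 := mem_strip_of_mem_deck hγ (by simp [strip])
  have h1' : γ (EuclideanSpace.single 0 1) 0 ∈ Icc (0 : ℝ) 1 :=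
    mem_strip_of_mem_deck hγ (by simp [strip])
  rw [h2, hinner] at h1'
  simp only [PiLp.single_apply, if_true, mul_one] at h1'
  rcases hr0 with h | h
  · left
    rw [h] at h1'
    refine ⟨fun z => ?_, fun v => by rw [h1, hinner, h, one_mul]⟩
    rw [h2, hinner, h, one_mul, show γ 0 0 = 0 by linarith [h0.1, h1'.2], zero_add]
  · right
    rw [h] at h1'
    refine ⟨fun z => ?_, fun v => by rw [h1, hinner, h, neg_one_mul]⟩
    rw [h2, hinner, h, show γ 0 0 = 1 by linarith [h0.2, h1'.1]]; ring

end

/-! ### Translations, the fundamental domain and the number of sheets -/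

section

variable {n : ℕ} {N : Type u} {p : Slab n → N}

/-- The translation by `l ∈ ℤⁿ` in the `y`-directions. -/
def transl (l : Fin n → ℤ) : Vec n ≃ᵃⁱ[ℝ] Vec n :=
  AffineIsometryEquiv.constVAdd ℝ (Vec n) (vec 0 (WithLp.toLp 2 fun i => (l i : ℝ)))

theorem transl_zero (l : Fin n → ℤ) (z : Vec n) : transl l z 0 = z 0 := by
  simp [transl, vec]

theorem transl_succ (l : Fin n → ℤ) (z : Vec n) (i : Fin n) : transl l z i.succ = z i.succ + l i := by
  simp [transl, vec, add_comm]

theorem transl_linear (l : Fin n → ℤ) (v : Vec n) : (transl l).linearIsometryEquiv v = v := by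
  have h := apply_eq_add (transl l) v 0
  rw [sub_zero] at h
  rw [← add_right_inj (transl l 0), ← h]
  simp [transl]

theorem transl_mem_strip (l : Fin n → ℤ) (z : Vec n) : transl l z ∈ strip n ↔ z ∈ strip n := by
  simp only [strip, mem_ofPred_eq, transl_zero]

theorem quot_transl (l : Fin n → ℤ) (z : Vec n) : quot (transl l z) = quot z := by
  unfold quot
  rw [transl_zero]
  congr 1
  funext i
  rw [transl_succ, AddCircle.coe_add, add_eq_left, AddCircle.coe_eq_zero_iff]
  exact ⟨l i, by simp⟩

theorem lift_transl (l : Fin n → ℤ) (z : Vec n) : lift p (transl l z) = lift p z := by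
  rw [lift, quot_transl]; rfl

theorem transl_mem_deck (l : Fin n → ℤ) : transl l ∈ deck p :=
  ⟨transl_mem_strip l, fun z _ => lift_transl l z⟩

/-- The integer translation that takes a point of the strip to the box. -/
def floorNeg (z : Vec n) : Fin n → ℤ := fun i => -⌊z i.succ⌋

theorem transl_floorNeg_mem_box {z : Vec n} (hz : z ∈ strip n) : transl (floorNeg z) z ∈ box n := by
  refine ⟨(transl_mem_strip _ _).2 hz, fun i => ?_⟩
  rw [transl_succ, floorNeg]
  push_cast
  exact ⟨by linarith [Int.floor_le (z i.succ)], by linarith [Int.lt_floor_add_one (z i.succ)]⟩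

theorem eq_zero_of_transl_mem_box {z : Vec n} {l : Fin n → ℤ} (hz : z ∈ box n)
    (h : transl l z ∈ box n) : l = 0 := by
  funext i
  have h1 := hz.2 i
  have h2 := h.2 i
  rw [transl_succ] at h2
  have h3 : (l i : ℝ) < 1 := by linarith [h1.1, h2.2]
  have h4 : (-1 : ℝ) < l i := by linarith [h1.2, h2.1]
  have h5 : l i < 1 := by exact_mod_cast h3
  have h6 : -1 < l i := by exact_mod_cast h4
  simp only [Pi.zero_apply]; omega

theorem transl_zero_eq : transl (0 : Fin n → ℤ) = 1 := by
  ext1 z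
  ext i
  refine Fin.cases (transl_zero _ _) (fun i => ?_) i
  rw [transl_succ]; simp

theorem norm_le_of_mem_box {z : Vec n} (hz : z ∈ box n) : ‖z‖ ≤ √(n + 1) := by
  rw [EuclideanSpace.norm_eq]
  refine Real.sqrt_le_sqrt ?_
  have h1 : ∀ i, ‖z i‖ ^ 2 ≤ 1 := by
    intro i
    have h2 : 0 ≤ z i ∧ z i ≤ 1 := by
      refine Fin.cases hz.1 (fun i => ?_) i
      exact ⟨(hz.2 i).1, (hz.2 i).2.le⟩
    rw [Real.norm_eq_abs, abs_of_nonneg h2.1]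
    exact pow_le_one₀ h2.1 h2.2
  calc ∑ i, ‖z i‖ ^ 2 ≤ ∑ _i : Fin (n + 1), (1 : ℝ) := Finset.sum_le_sum fun i _ => h1 i
    _ = n + 1 := by simp

namespace IsTwistedSlab

variable [TopologicalSpace N] [ChartedSpace (EuclideanHalfSpace (n + 1)) N]
  [IsManifold (𝓡∂ (n + 1)) ∞ N] {g : SmoothMetric n N} (H : IsTwistedSlab g p)
include H

/-- The fibres of `lift p` are discrete and closed, so they have finitely many points in a ball. -/
theorem finite_fibre_ball [T2Space N] (x : N) (r : ℝ) :
    {z | z ∈ strip n ∧ lift p z = x ∧ ‖z‖ ≤ r}.Finite := by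
  set K := {z | z ∈ strip n ∧ lift p z = x ∧ ‖z‖ ≤ r} with hKdef
  have hK : IsCompact K := by
    have : K = (strip n ∩ lift p ⁻¹' {x}) ∩ Metric.closedBall 0 r := by
      ext z
      simp only [hKdef, mem_inter_iff, mem_preimage, mem_singleton_iff, mem_closedBall_zero_iff,
        mem_ofPred_eq, and_assoc]
    rw [this]
    exact (isCompact_closedBall 0 r).inter_left
      (isClosed_strip.inter (isClosed_singleton.preimage H.continuous_lift))
  rw [← inter_self K]
  refine hK.induction_on (p := fun s => (s ∩ K).Finite) (by simp)
    (fun s t hst ht => ht.subset (inter_subset_inter_left _ hst))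
    (fun s t hs ht => by rw [union_inter_distrib_right]; exact hs.union ht) fun z hz => ?_
  obtain ⟨η, V, -, -, -, -, hev⟩ := H.exists_local_inverse z
  refine ⟨_, nhdsWithin_mono z (fun w hw => hw.1) hev, ?_⟩
  refine (finite_singleton z).subset fun w hw => ?_
  have h1 := hev.self_of_nhdsWithin hz.1
  have h2 := hw.1
  simp only [mem_ofPred_eq] at h2
  rw [mem_singleton_iff, ← h2, hw.2.2.1, ← hz.2.1, h1]

/-- A deck transformation is determined by the image of `0`, which lies in a fibre and, if some point of
a ball is taken to the box, in a larger ball. -/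
theorem finite_deck [T2Space N] (r : ℝ) :
    {γ | γ ∈ deck p ∧ ∃ z : Vec n, ‖z‖ ≤ r ∧ γ z ∈ box n}.Finite := by
  have h0 : (0 : Vec n) ∈ strip n := by simp [strip]
  refine Finite.of_finite_image (f := fun γ => γ 0)
    ((H.finite_fibre_ball (lift p 0) (r + √(n + 1))).subset ?_)
    fun γ hγ δ hδ h => H.deck_eq_of_apply_eq hγ.1 hδ.1 h0 h
  rintro _ ⟨γ, ⟨hγ, z, hz, hγz⟩, rfl⟩
  refine ⟨mem_strip_of_mem_deck hγ h0, hγ.2 _ h0, ?_⟩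
  have h1 : ‖γ 0 - γ z‖ = ‖z‖ := by rw [← dist_eq_norm, γ.dist_map, dist_zero_left]
  calc ‖γ 0‖ = ‖(γ 0 - γ z) + γ z‖ := by simp
    _ ≤ _ := (norm_add_le _ _).trans (add_le_add (h1.trans_le hz) (norm_le_of_mem_box hγz))

theorem finite_deckBox [T2Space N] (z : Vec n) : {γ | γ ∈ deck p ∧ γ z ∈ box n}.Finite :=
  (H.finite_deck ‖z‖).subset fun _ hγ => ⟨hγ.1, z, le_rfl, hγ.2⟩

/-- Each deck transformation taking `z` to the box has a multiple by a translation that takes `w` to the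
box. -/
theorem ncard_deckBox_le [T2Space N] {z w : Vec n} (hz : z ∈ strip n) (hw : w ∈ strip n) :
    {γ | γ ∈ deck p ∧ γ z ∈ box n}.ncard ≤ {γ | γ ∈ deck p ∧ γ w ∈ box n}.ncard := by
  refine ncard_le_ncard_of_injOn (fun γ => transl (floorNeg (γ w)) * γ)
    (fun γ hγ => ⟨mul_mem (transl_mem_deck _) hγ.1,
      transl_floorNeg_mem_box (mem_strip_of_mem_deck hγ.1 hw)⟩) ?_ (H.finite_deckBox w)
  intro γ hγ δ hδ h
  have hz' := congrArg (fun ε : Vec n ≃ᵃⁱ[ℝ] Vec n => ε z) h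
  have hz'' : transl (floorNeg (γ w)) (γ z) = transl (floorNeg (δ w)) (δ z) := hz'
  have h1 := quot_transl (floorNeg (γ w)) (γ z)
  rw [hz'', quot_transl] at h1
  exact (H.deck_eq_of_apply_eq hδ.1 hγ.1 hz (quot_injOn_box hδ.2 hγ.2 h1)).symm

theorem bijOn_deckBox {z : Vec n} (hz : z ∈ strip n) :
    BijOn (fun γ : Vec n ≃ᵃⁱ[ℝ] Vec n => γ z) {γ | γ ∈ deck p ∧ γ z ∈ box n}
      {w | w ∈ box n ∧ lift p w = lift p z} :=
  ⟨fun γ hγ => ⟨hγ.2, hγ.1.2 z hz⟩, fun γ hγ δ hδ h => H.deck_eq_of_apply_eq hγ.1 hδ.1 hz h,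
    fun w hw => by
      obtain ⟨γ, hγ, hγz⟩ := H.exists_deck hz hw.1.1 hw.2
      exact ⟨γ, ⟨hγ, by rw [hγz]; exact hw.1⟩, hγz⟩⟩

/-- The number of deck transformations that take a given point to the box is the number of sheets. -/
theorem ncard_deckBox [T2Space N] {z : Vec n} (hz : z ∈ strip n) :
    {γ | γ ∈ deck p ∧ γ z ∈ box n}.ncard = sheets p := by
  have h0 : (0 : Vec n) ∈ strip n := by simp [strip]
  refine ((H.ncard_deckBox_le hz h0).antisymm (H.ncard_deckBox_le h0 hz)).trans ?_
  rw [← (H.bijOn_deckBox h0).injOn.ncard_image, (H.bijOn_deckBox h0).image_eq, sheets,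
    Nat.card_coe_set_eq]
  have h1 : quot '' {w | w ∈ box n ∧ lift p w = lift p 0} = p ⁻¹' {lift p (0 : Vec n)} := by
    ext s
    constructor
    · rintro ⟨w, hw, rfl⟩; exact hw.2
    · intro hs
      obtain ⟨w, hw, rfl⟩ := quot_surjective s
      exact ⟨w, ⟨hw, hs⟩, rfl⟩
  rw [← h1, (quot_injOn_box.mono fun w hw => hw.1).ncard_image]

theorem sheets_pos [T2Space N] : 0 < sheets p := by
  have h0 : (0 : Vec n) ∈ strip n := by simp [strip]
  rw [← H.ncard_deckBox h0]
  refine (ncard_pos (H.finite_deckBox 0)).2 ⟨1, one_mem _, ?_⟩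
  exact ⟨h0, fun i => by simp⟩

end IsTwistedSlab

variable [TopologicalSpace N]

open Classical in
/-- The finitely many deck transformations that take some point of the box to the box. (If this set
were infinite, which it is not for a twisted slab, the value would be empty.) -/
def deckFinset (p : Slab n → N) : Finset (Vec n ≃ᵃⁱ[ℝ] Vec n) :=
  if h : {γ | γ ∈ deck p ∧ ∃ z ∈ box n, γ z ∈ box n}.Finite then h.toFinset else ∅

namespace IsTwistedSlab

variable [ChartedSpace (EuclideanHalfSpace (n + 1)) N]
  [IsManifold (𝓡∂ (n + 1)) ∞ N] {g : SmoothMetric n N} (H : IsTwistedSlab g p) [T2Space N]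
include H

theorem mem_deckFinset {γ : Vec n ≃ᵃⁱ[ℝ] Vec n} :
    γ ∈ deckFinset p ↔ γ ∈ deck p ∧ ∃ z ∈ box n, γ z ∈ box n := by
  have h : {γ | γ ∈ deck p ∧ ∃ z ∈ box n, γ z ∈ box n}.Finite :=
    (H.finite_deck (√(n + 1))).subset fun γ hγ => ⟨hγ.1, hγ.2.imp fun z hz =>
      ⟨norm_le_of_mem_box hz.1, hz.2⟩⟩
  rw [deckFinset, dif_pos h, Finite.mem_toFinset]
  rfl

theorem inv_mem_deckFinset {γ : Vec n ≃ᵃⁱ[ℝ] Vec n} (hγ : γ ∈ deckFinset p) :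
    γ⁻¹ ∈ deckFinset p := by
  rw [H.mem_deckFinset] at hγ ⊢
  obtain ⟨h1, z, hz, hγz⟩ := hγ
  refine ⟨inv_mem h1, γ z, hγz, ?_⟩
  have : γ⁻¹ (γ z) = z := γ.symm_apply_apply z
  rwa [this]

open Classical in
theorem coe_filter_deckFinset {z : Vec n} (hz : z ∈ box n) :
    (((deckFinset p).filter fun γ => γ z ∈ box n : Finset _) : Set (Vec n ≃ᵃⁱ[ℝ] Vec n)) =
      {γ | γ ∈ deck p ∧ γ z ∈ box n} := by
  ext γ
  simp only [Finset.coe_filter, H.mem_deckFinset, mem_ofPred_eq]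
  exact ⟨fun h => ⟨h.1.1, h.2⟩, fun h => ⟨⟨h.1, z, hz, h.2⟩, h.2⟩⟩

open Classical in
theorem card_filter_deckFinset {z : Vec n} (hz : z ∈ box n) :
    ((deckFinset p).filter fun γ => γ z ∈ box n).card = sheets p := by
  rw [← H.ncard_deckBox hz.1, ← H.coe_filter_deckFinset hz, ncard_coe_finset]

omit [T2Space N] in
/-- `p^* p_*` is the average over the deck transformations, modulo translations. -/
theorem pullback_pushforward_eq_finsum (F : Vec n → Vec n → ℂ) {z : Vec n} (hz : z ∈ strip n) (u : Vec n) :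
    pullback p (pushforward p F) z u = ((sheets p : ℂ))⁻¹ *
      ∑ᶠ γ ∈ {γ | γ ∈ deck p ∧ γ z ∈ box n}, F (γ z) (γ.linearIsometryEquiv u) := by
  have h1 : pullback p (pushforward p F) z u = ((sheets p : ℂ))⁻¹ *
      ∑ᶠ w ∈ {w : Vec n | w ∈ box n ∧ lift p w = lift p z}, F w ((dpV p w).inverse (dpV p z u)) := rfl
  rw [h1, ← (H.bijOn_deckBox hz).image_eq, finsum_mem_image (H.bijOn_deckBox hz).injOn]
  congr 1
  exact finsum_mem_congr rfl fun γ hγ => by rw [H.dpV_deck hγ.1 hz]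

open Classical in
theorem pullback_pushforward (F : Vec n → Vec n → ℂ) {z : Vec n} (hz : z ∈ box n) (u : Vec n) :
    pullback p (pushforward p F) z u = ((sheets p : ℂ))⁻¹ *
      ∑ γ ∈ deckFinset p, if γ z ∈ box n then F (γ z) (γ.linearIsometryEquiv u) else 0 := by
  rw [H.pullback_pushforward_eq_finsum F hz.1, ← H.coe_filter_deckFinset hz, finsum_mem_coe_finset,
    Finset.sum_filter]

end IsTwistedSlab

end

/-! ### Fourier series on the cell -/

section

open scoped Pointwise

variable {n : ℕ}

/-- The unit cell `[0,1)ⁿ` of the lattice `ℤⁿ`. -/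
def cell (n : ℕ) : Set (EuclideanSpace ℝ (Fin n)) := {y | ∀ i, y i ∈ Ico (0 : ℝ) 1}

/-- The point `l ∈ ℤⁿ` of `ℝⁿ`. -/
def intVec (l : Fin n → ℤ) : EuclideanSpace ℝ (Fin n) := WithLp.toLp 2 fun i => (l i : ℝ)

theorem intVec_apply (l : Fin n → ℤ) (i : Fin n) : intVec l i = l i := rfl

/-- `ℝ × ℝⁿ ≃ ℝ^(1+n)` -/
def vecEquiv (n : ℕ) : ℝ × EuclideanSpace ℝ (Fin n) ≃ᵐ Vec n :=
  (((MeasurableEquiv.refl ℝ).prodCongr (MeasurableEquiv.toLp 2 (Fin n → ℝ)).symm).trans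
    (MeasurableEquiv.piFinSuccAbove (fun _ : Fin (n + 1) => ℝ) 0).symm).trans
    (MeasurableEquiv.toLp 2 (Fin (n + 1) → ℝ))

theorem vecEquiv_apply (q : ℝ × EuclideanSpace ℝ (Fin n)) : vecEquiv n q = vec q.1 q.2 := by
  ext i
  refine Fin.cases ?_ (fun i => ?_) i <;> simp [vecEquiv, vec, MeasurableEquiv.piFinSuccAbove] <;> rfl

theorem measurePreserving_vecEquiv : MeasurePreserving (vecEquiv n) (volume.prod volume) volume := by
  refine ((EuclideanSpace.volume_preserving_symm_measurableEquiv_toLp (Fin (n+1))).symm.comp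
    (volume_preserving_piFinSuccAbove (fun _ : Fin (n + 1) => ℝ) 0).symm).comp ?_
  exact (MeasurePreserving.id volume).prod
    (EuclideanSpace.volume_preserving_symm_measurableEquiv_toLp (Fin n))

theorem measurableSet_cell : MeasurableSet (cell n) := by
  have : cell n = ⋂ i, (fun y : EuclideanSpace ℝ (Fin n) => y i) ⁻¹' Ico 0 1 := by
    ext y; simp [cell]
  rw [this]
  exact MeasurableSet.iInter fun i => (by fun_prop : Measurable fun y : EuclideanSpace ℝ (Fin n) => y i)
    measurableSet_Ico

theorem box_eq_image : vecEquiv n ⁻¹' box n = Icc (0 : ℝ) 1 ×ˢ cell n := by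
  ext q
  simp [box, cell, vecEquiv_apply, vec]

theorem measurableSet_box : MeasurableSet (box n) := by
  rw [← (vecEquiv n).measurableSet_preimage, box_eq_image]
  exact measurableSet_Icc.prod measurableSet_cell

theorem measurePreserving_vecEquiv_box : MeasurePreserving (vecEquiv n)
    ((volume.restrict (Icc (0 : ℝ) 1)).prod (volume.restrict (cell n))) (volume.restrict (box n)) := by
  have h := measurePreserving_vecEquiv.restrict_preimage (measurableSet_box (n := n))
  rwa [box_eq_image, ← Measure.prod_restrict] at h

theorem cell_ae_eq : ((MeasurableEquiv.toLp 2 (Fin n → ℝ)) ⁻¹' cell n : Set (Fin n → ℝ)) =ᵐ[volume]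
    {x : Fin n → ℝ | ∀ i, x i ∈ Ioc (0 : ℝ) (0 + 1)} := by
  have h1 : ((MeasurableEquiv.toLp 2 (Fin n → ℝ)) ⁻¹' cell n : Set (Fin n → ℝ)) =
      univ.pi fun _ => Ico 0 1 := by ext; simp [cell]
  have h2 : {x : Fin n → ℝ | ∀ i, x i ∈ Ioc (0 : ℝ) (0 + 1)} = univ.pi fun _ => Ioc 0 1 := by
    ext; simp
  rw [h1, h2]
  exact (Measure.univ_pi_Ico_ae_eq_Icc).trans (Measure.univ_pi_Ioc_ae_eq_Icc).symm

theorem measurePreserving_toLp_cell : MeasurePreserving (MeasurableEquiv.toLp 2 (Fin n → ℝ))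
    (volume.restrict {x : Fin n → ℝ | ∀ i, x i ∈ Ioc (0 : ℝ) (0 + 1)}) (volume.restrict (cell n)) := by
  rw [← Measure.restrict_congr_set (cell_ae_eq (n := n))]
  exact (EuclideanSpace.volume_preserving_symm_measurableEquiv_toLp (Fin n)).symm.restrict_preimage
    measurableSet_cell

theorem volume_cell : volume (cell n) = 1 := by
  have h := (measurePreserving_toLp_cell (n := n)).measure_preimage_equiv univ
  rw [Measure.restrict_apply_univ, preimage_univ, Measure.restrict_apply_univ] at h
  rw [← h]
  have h2 : {x : Fin n → ℝ | ∀ i, x i ∈ Ioc (0 : ℝ) (0 + 1)} = univ.pi fun _ => Ioc 0 1 := by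
    ext; simp
  rw [h2, Real.volume_pi_Ioc]
  simp

instance : IsProbabilityMeasure (volume.restrict (cell n)) :=
  ⟨by rw [Measure.restrict_apply_univ, volume_cell]⟩

instance : IsProbabilityMeasure (volume.restrict (Icc (0 : ℝ) 1)) :=
  ⟨by rw [Measure.restrict_apply_univ]; simp⟩

instance : IsProbabilityMeasure (volume.restrict (box n)) :=
  measurePreserving_vecEquiv_box.map_eq ▸ Measure.isProbabilityMeasure_map (by fun_prop)

/-- The exponential `e^{2πi k·y}`. -/
def expo (k : Fin n → ℤ) (y : EuclideanSpace ℝ (Fin n)) : ℂ :=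
  Complex.exp (2 * Real.pi * Complex.I * (∑ i, k i * y i : ℝ))

theorem expo_eq_mFourier (k : Fin n → ℤ) (x : Fin n → ℝ) :
    UnitAddTorus.mFourier k (fun i => (x i : UnitAddCircle)) = expo k (WithLp.toLp 2 x) := by
  simp only [UnitAddTorus.mFourier, ContinuousMap.coe_mk, fourier_coe_apply, expo, ← Complex.exp_sum]
  congr 1
  push_cast
  rw [Finset.mul_sum]
  exact Finset.sum_congr rfl fun i _ => by ring

theorem norm_expo (k : Fin n → ℤ) (y : EuclideanSpace ℝ (Fin n)) : ‖expo k y‖ = 1 := by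
  rw [expo, Complex.norm_exp]; simp

theorem expo_neg (k : Fin n → ℤ) (y : EuclideanSpace ℝ (Fin n)) :
    expo (-k) y = starRingEnd ℂ (expo k y) := by
  rw [expo, expo, ← Complex.exp_conj]
  congr 1
  simp [Complex.conj_ofNat]

theorem expo_add_intVec (k l : Fin n → ℤ) (y : EuclideanSpace ℝ (Fin n)) :
    expo k (y + intVec l) = expo k y := by
  rw [expo, expo, Complex.exp_eq_exp_iff_exists_int]
  refine ⟨∑ i, k i * l i, ?_⟩
  simp only [PiLp.add_apply, intVec_apply]
  push_cast
  simp only [mul_add, Finset.sum_add_distrib]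
  ring

theorem expo_add (k : Fin n → ℤ) (y v : EuclideanSpace ℝ (Fin n)) :
    expo k (y + v) = expo k y * expo k v := by
  rw [expo, expo, expo, ← Complex.exp_add]
  congr 1
  simp only [PiLp.add_apply, mul_add, Finset.sum_add_distrib]
  push_cast
  ring

theorem expo_zero_left (y : EuclideanSpace ℝ (Fin n)) : expo 0 y = 1 := by simp [expo]


theorem hasFDerivAt_cexp {V : Type*} [NormedAddCommGroup V] [NormedSpace ℝ V] (L : V →L[ℝ] ℝ) (z : V) :
    HasFDerivAt (fun z => Complex.exp (2 * Real.pi * Complex.I * (L z : ℝ)))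
      ((2 * Real.pi * Complex.I * Complex.exp (2 * Real.pi * Complex.I * (L z : ℝ))) •
        Complex.ofRealCLM.comp L) z := by
  have h1 : HasFDerivAt (fun z => (2 * Real.pi * Complex.I * (L z : ℝ) : ℂ))
      ((2 * Real.pi * Complex.I : ℂ) • Complex.ofRealCLM.comp L) z :=
    ((Complex.ofRealCLM.comp L).hasFDerivAt (x := z)).const_mul (2 * Real.pi * Complex.I : ℂ)
  convert! h1.cexp using 1
  rw [smul_smul, mul_comm]

theorem contDiff_cexp {V : Type*} [NormedAddCommGroup V] [NormedSpace ℝ V] (L : V →L[ℝ] ℝ) :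
    ContDiff ℝ ∞ (fun z => Complex.exp (2 * Real.pi * Complex.I * (L z : ℝ))) :=
  (contDiff_const.mul (Complex.ofRealCLM.comp L).contDiff).cexp

/-- The functional `y ↦ k·y`. -/
def dotCLM (k : Fin n → ℤ) : EuclideanSpace ℝ (Fin n) →L[ℝ] ℝ :=
  ∑ i, (k i : ℝ) • EuclideanSpace.proj i

theorem dotCLM_apply (k : Fin n → ℤ) (y : EuclideanSpace ℝ (Fin n)) :
    dotCLM k y = ∑ i, k i * y i := by
  simp [dotCLM]

theorem expo_eq (k : Fin n → ℤ) :
    expo k = fun y => Complex.exp (2 * Real.pi * Complex.I * (dotCLM k y : ℝ)) := by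
  funext y; rw [expo, dotCLM_apply]

theorem continuous_expo (k : Fin n → ℤ) : Continuous (expo k) := by
  rw [expo_eq]; exact (contDiff_cexp _).continuous

/-- A function on `ℝⁿ` with `ℤⁿ` as periods. -/
def IsPeriodic {X : Type*} (Q : EuclideanSpace ℝ (Fin n) → X) : Prop :=
  ∀ (l : Fin n → ℤ) y, Q (y + intVec l) = Q y

/-- The lattice `ℤⁿ ⊂ ℝⁿ`. -/
abbrev intLattice (n : ℕ) : AddSubgroup (EuclideanSpace ℝ (Fin n)) :=
  (Submodule.span ℤ (range (EuclideanSpace.basisFun (Fin n) ℝ).toBasis)).toAddSubgroup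

theorem exists_intVec_of_mem_span {v : EuclideanSpace ℝ (Fin n)}
    (hv : v ∈ Submodule.span ℤ (range (EuclideanSpace.basisFun (Fin n) ℝ).toBasis)) :
    ∃ l, v = intVec l := by
  induction hv using Submodule.span_induction with
  | mem x h =>
    obtain ⟨i, rfl⟩ := h
    refine ⟨Pi.single i 1, ?_⟩
    ext j
    simp [intVec_apply, Pi.single_apply]
  | zero => exact ⟨0, by ext j; simp [intVec_apply]⟩
  | add x y _ _ hx hy =>
    obtain ⟨l, rfl⟩ := hx
    obtain ⟨l', rfl⟩ := hy
    exact ⟨l + l', by ext j; simp [intVec_apply]⟩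
  | smul a x _ hx =>
    obtain ⟨l, rfl⟩ := hx
    exact ⟨a • l, by ext j; simp [intVec_apply]⟩

instance : Countable (intLattice n) :=
  inferInstanceAs (Countable (Submodule.span ℤ (range (EuclideanSpace.basisFun (Fin n) ℝ).toBasis)))

theorem isAddFundamentalDomain_cell : IsAddFundamentalDomain
    (intLattice n) (cell n) volume := by
  have : cell n = ZSpan.fundamentalDomain (EuclideanSpace.basisFun (Fin n) ℝ).toBasis := by
    ext y; simp [cell, ZSpan.mem_fundamentalDomain]
  rw [this]
  exact ZSpan.isAddFundamentalDomain' _ _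

theorem isAddFundamentalDomain_vadd_cell (v : EuclideanSpace ℝ (Fin n)) : IsAddFundamentalDomain
    (intLattice n) (v +ᵥ cell n) volume :=
  isAddFundamentalDomain_cell.vadd_of_comm v

theorem IsPeriodic.vadd {X : Type*} {Q : EuclideanSpace ℝ (Fin n) → X} (hQ : IsPeriodic Q)
    (g : intLattice n)
    (y : EuclideanSpace ℝ (Fin n)) : Q (g +ᵥ y) = Q y := by
  obtain ⟨l, hl⟩ := exists_intVec_of_mem_span g.2
  rw [AddSubgroup.vadd_def, vadd_eq_add, hl, add_comm, hQ]

theorem setLIntegral_cell_add {Q : EuclideanSpace ℝ (Fin n) → ENNReal} (hQ : IsPeriodic Q)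
    (v : EuclideanSpace ℝ (Fin n)) : ∫⁻ y in cell n, Q (y + v) = ∫⁻ y in cell n, Q y := by
  rw [isAddFundamentalDomain_cell.setLIntegral_eq (isAddFundamentalDomain_vadd_cell v) Q hQ.vadd]
  have h := (measurePreserving_add_right volume v).setLIntegral_comp_preimage_emb
    (measurableEmbedding_addRight v) Q (v +ᵥ cell n)
  rw [← h]
  congr 2
  ext y
  simp [mem_vadd_set_iff_neg_vadd_mem, vadd_eq_add]

/-- The integral of a periodic function over the cell is invariant under translations: translates of the
cell are fundamental domains too. -/
theorem setIntegral_cell_add {Q : EuclideanSpace ℝ (Fin n) → ℂ} (hQ : IsPeriodic Q)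
    (v : EuclideanSpace ℝ (Fin n)) : ∫ y in cell n, Q (y + v) = ∫ y in cell n, Q y := by
  rw [isAddFundamentalDomain_cell.setIntegral_eq (isAddFundamentalDomain_vadd_cell v) hQ.vadd]
  have h := (measurePreserving_add_right volume v).setIntegral_preimage_emb
    (measurableEmbedding_addRight v) Q (v +ᵥ cell n)
  rw [← h]
  congr 2
  ext y
  simp [mem_vadd_set_iff_neg_vadd_mem, vadd_eq_add]

/-- The point of the cell in the same class modulo `ℤⁿ`. -/
def fractVec (y : EuclideanSpace ℝ (Fin n)) : EuclideanSpace ℝ (Fin n) :=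
  WithLp.toLp 2 fun i => Int.fract (y i)

theorem measurable_fractVec : Measurable (fractVec (n := n)) := by
  unfold fractVec
  refine (MeasurableEquiv.toLp 2 (Fin n → ℝ)).measurable.comp (measurable_pi_lambda _ fun _ => ?_)
  exact measurable_fract.comp (by fun_prop)

theorem isPeriodic_fractVec : IsPeriodic (fractVec (n := n)) := by
  intro l y
  ext i
  simp [fractVec, intVec_apply]

theorem fractVec_eq_self {y : EuclideanSpace ℝ (Fin n)} (hy : y ∈ cell n) : fractVec y = y := by
  ext i
  exact Int.fract_eq_self.2 (hy i)

theorem IsPeriodic.apply_fractVec {X : Type*} {Q : EuclideanSpace ℝ (Fin n) → X} (hQ : IsPeriodic Q)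
    (y : EuclideanSpace ℝ (Fin n)) : Q (fractVec y) = Q y := by
  rw [← hQ (fun i => -⌊y i⌋) y]
  congr 1
  ext i
  simp [fractVec, intVec_apply, Int.fract, sub_eq_add_neg]

theorem measurePreserving_fractVec_add (v : EuclideanSpace ℝ (Fin n)) :
    MeasurePreserving (fun y => fractVec (y + v)) (volume.restrict (cell n))
      (volume.restrict (cell n)) := by
  have hm : Measurable fun y : EuclideanSpace ℝ (Fin n) => fractVec (y + v) :=
    measurable_fractVec.comp (by fun_prop)
  refine ⟨hm, ?_⟩
  ext A hA
  rw [Measure.map_apply hm hA]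
  have h := setLIntegral_cell_add (n := n) (Q := fun y => A.indicator 1 (fractVec y))
    (fun l y => by simp only [isPeriodic_fractVec l y]) v
  have e1 : ∀ y : EuclideanSpace ℝ (Fin n), A.indicator (1 : EuclideanSpace ℝ (Fin n) → ENNReal) (fractVec (y + v)) =
    ((fun y => fractVec (y + v)) ⁻¹' A).indicator 1 y := fun y => rfl
  simp only [e1] at h
  rw [lintegral_indicator_one (hm hA)] at h
  rw [h, ← lintegral_indicator_one hA]
  refine setLIntegral_congr_fun measurableSet_cell fun y hy => ?_
  simp only [fractVec_eq_self hy]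

section Completeness

/-- The measure on the circle for which Mathlib states completeness of the Fourier series on the torus:
the Haar probability measure. -/
local instance : MeasureSpace UnitAddCircle := ⟨AddCircle.haarAddCircle⟩

/-- **Completeness of the exponentials** in `L²(𝕋ⁿ)`. -/
theorem ae_eq_zero_of_forall_expo {Q : EuclideanSpace ℝ (Fin n) → ℂ}
    (hQ : MemLp Q 2 (volume.restrict (cell n)))
    (h : ∀ k, ∫ y in cell n, Q y * expo k y = 0) : Q =ᵐ[volume.restrict (cell n)] 0 := by
  set C : Set (Fin n → ℝ) := {x | ∀ i, x i ∈ Ioc (0 : ℝ) (0 + 1)} with hC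
  set R : UnitAddTorus (Fin n) → Fin n → ℝ :=
    fun θ => (UnitAddTorus.measurableEquivPiIoc (fun _ : Fin n => (0 : ℝ)) θ : Fin n → ℝ) with hR
  have hCm : MeasurableSet C := by
    have : C = univ.pi fun _ => Ioc 0 (0 + 1) := by ext; simp [hC]
    rw [this]
    exact MeasurableSet.univ_pi fun _ => measurableSet_Ioc
  have hmp : MeasurePreserving R volume (volume.restrict C) := by
    refine MeasurePreserving.comp (g := ((↑) : C → Fin n → ℝ)) ?_
      (UnitAddTorus.measurePreserving_equivPiIoc (fun _ : Fin n => (0 : ℝ)))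
    exact measurePreserving_subtype_coe hCm
  have hmp' := (measurePreserving_toLp_cell (n := n)).comp hmp
  have hRx : ∀ x ∈ C, R (fun i => (x i : UnitAddCircle)) = x := by
    intro x hx
    have := (UnitAddTorus.measurableEquivPiIoc (fun _ : Fin n => (0 : ℝ))).apply_symm_apply ⟨x, hx⟩
    exact congrArg Subtype.val this
  set f : UnitAddTorus (Fin n) → ℂ := fun θ => Q (MeasurableEquiv.toLp 2 (Fin n → ℝ) (R θ)) with hf
  have hfm : MemLp f 2 volume := hQ.comp_measurePreserving hmp'
  have hcoeff : ∀ k, UnitAddTorus.mFourierCoeff f k = 0 := by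
    intro k
    rw [UnitAddTorus.mFourierCoeff_eq_integral f k (fun _ => 0)]
    rw [← h (-k), ← measurePreserving_toLp_cell.integral_comp' (fun y => Q y * expo (-k) y)]
    refine setIntegral_congr_fun hCm fun x hx => ?_
    simp only [hf, hRx x hx, expo_eq_mFourier, smul_eq_mul]
    rw [mul_comm]
    rfl
  have hzero : hfm.toLp f = 0 := by
    refine HasSum.unique (UnitAddTorus.hasSum_mFourier_series_L2 (hfm.toLp f)) ?_
    have : ∀ k, UnitAddTorus.mFourierCoeff (hfm.toLp f) k = 0 := by
      intro k
      rw [← hcoeff k]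
      exact integral_congr_ae (ae_eq_rfl.smul hfm.coeFn_toLp)
    simp only [this, zero_smul]
    exact hasSum_zero
  have hf0 : f =ᵐ[volume] 0 := by
    have := hfm.coeFn_toLp
    rw [hzero] at this
    exact this.symm.trans (Lp.coeFn_zero _ _ _)
  have h1 : ∀ᵐ x ∂(volume.restrict C), Q (MeasurableEquiv.toLp 2 (Fin n → ℝ) x) = 0 := by
    rw [← hmp.map_eq]
    exact ((MeasurableEmbedding.subtype_coe hCm).comp
      (UnitAddTorus.measurableEquivPiIoc (fun _ : Fin n => (0 : ℝ))).measurableEmbedding).ae_map_iff.2 hf0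
  rw [← measurePreserving_toLp_cell.map_eq]
  exact ((MeasurableEquiv.toLp 2 (Fin n → ℝ)).measurableEmbedding.ae_map_iff).2 h1

end Completeness

end

/-! ### The X-ray transform in terms of Fourier coefficients -/

section

open scoped Pointwise

variable {n : ℕ}

/-- A function on `ℝ × ℝⁿ` that is `ℤⁿ`-periodic in the second variable over the strip. -/
def StripPeriodic {X : Type*} (P : Vec n → X) : Prop :=
  ∀ z ∈ strip n, ∀ l : Fin n → ℤ, P (transl l z) = P z

theorem transl_vec (l : Fin n → ℤ) (t : ℝ) (y : EuclideanSpace ℝ (Fin n)) :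
    transl l (vec t y) = vec t (y + intVec l) := by
  ext i
  refine Fin.cases ?_ (fun i => ?_) i
  · rw [transl_zero]; rfl
  · rw [transl_succ]; rfl

theorem StripPeriodic.isPeriodic {X : Type*} {P : Vec n → X} (hP : StripPeriodic P) {t : ℝ}
    (ht : t ∈ Icc (0 : ℝ) 1) : IsPeriodic fun y => P (vec t y) := by
  intro l y
  change P (vec t (y + intVec l)) = P (vec t y)
  rw [← transl_vec]
  exact hP _ ht l

theorem integral_box (P : Vec n → ℂ) (hP : IntegrableOn P (box n)) :
    ∫ z in box n, P z = ∫ t in (0 : ℝ)..1, ∫ y in cell n, P (vec t y) := by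
  rw [← measurePreserving_vecEquiv_box.integral_comp']
  rw [integral_prod (fun q => P (vecEquiv n q)) ((measurePreserving_vecEquiv_box.integrable_comp_emb
    (vecEquiv n).measurableEmbedding).2 hP), integral_Icc_eq_integral_Ioc,
    intervalIntegral.integral_of_le zero_le_one]
  simp only [vecEquiv_apply]

/-- The shear `(t, y) ↦ (t, y + t b)` of `[0,1] × 𝕋ⁿ`. -/
def shear (b : EuclideanSpace ℝ (Fin n)) (q : ℝ × EuclideanSpace ℝ (Fin n)) :
    ℝ × EuclideanSpace ℝ (Fin n) := (q.1, fractVec (q.2 + q.1 • b))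

/-- The shear acts on each fibre `{t} × 𝕋ⁿ` by a translation. -/
theorem measurePreserving_shear (b : EuclideanSpace ℝ (Fin n)) : MeasurePreserving (shear b)
    ((volume.restrict (Icc (0 : ℝ) 1)).prod (volume.restrict (cell n)))
    ((volume.restrict (Icc (0 : ℝ) 1)).prod (volume.restrict (cell n))) := by
  refine MeasurePreserving.skew_product (g := fun t y => fractVec (y + t • b))
    (MeasurePreserving.id _) ?_ (Filter.Eventually.of_forall fun t =>
      (measurePreserving_fractVec_add (t • b)).map_eq)
  exact measurable_fractVec.comp (by fun_prop)

theorem StripPeriodic.comp_shear {X : Type*} {P : Vec n → X} (hP : StripPeriodic P)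
    (b : EuclideanSpace ℝ (Fin n)) {q : ℝ × EuclideanSpace ℝ (Fin n)} (hq : q.1 ∈ Icc (0 : ℝ) 1) :
    P (vecEquiv n (shear b q)) = P (line q.2 b q.1) := by
  rw [vecEquiv_apply]
  exact (hP.isPeriodic hq).apply_fractVec (q.2 + q.1 • b)

theorem ae_fst_mem : ∀ᵐ q ∂((volume.restrict (Icc (0 : ℝ) 1)).prod (volume.restrict (cell n))),
    q.1 ∈ Icc (0 : ℝ) 1 :=
  Measure.quasiMeasurePreserving_fst.ae (ae_restrict_mem measurableSet_Icc)

theorem StripPeriodic.memLp_comp_line {P : Vec n → ℂ} (hP : StripPeriodic P) {r : ENNReal}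
    (hP2 : MemLp P r (volume.restrict (box n))) (b : EuclideanSpace ℝ (Fin n)) :
    MemLp (fun q : ℝ × EuclideanSpace ℝ (Fin n) => P (line q.2 b q.1)) r
      ((volume.restrict (Icc (0 : ℝ) 1)).prod (volume.restrict (cell n))) := by
  have h := (hP2.comp_measurePreserving measurePreserving_vecEquiv_box).comp_measurePreserving
    (measurePreserving_shear b)
  refine h.ae_eq ?_
  filter_upwards [ae_fst_mem] with q hq
  exact hP.comp_shear b hq

theorem StripPeriodic.integral_comp_line {P : Vec n → ℂ} (hP : StripPeriodic P)
    (hP2 : IntegrableOn P (box n)) (b : EuclideanSpace ℝ (Fin n)) :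
    ∫ y in cell n, ∫ t in (0 : ℝ)..1, P (line y b t) = ∫ z in box n, P z := by
  have h1 : Integrable (fun q : ℝ × EuclideanSpace ℝ (Fin n) => P (line q.2 b q.1))
      ((volume.restrict (Icc (0 : ℝ) 1)).prod (volume.restrict (cell n))) :=
    memLp_one_iff_integrable.1 (hP.memLp_comp_line (memLp_one_iff_integrable.2 hP2) b)
  have h2 := integral_prod_symm _ h1
  simp only [integral_Icc_eq_integral_Ioc, ← intervalIntegral.integral_of_le zero_le_one] at h2
  rw [← h2, ← measurePreserving_vecEquiv_box.integral_comp']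
  have h3 : ∫ q, P (vecEquiv n q) ∂((volume.restrict (Icc (0 : ℝ) 1)).prod (volume.restrict (cell n))) =
      ∫ q, P (vecEquiv n (shear b q))
        ∂((volume.restrict (Icc (0 : ℝ) 1)).prod (volume.restrict (cell n))) := by
    conv_lhs => rw [← (measurePreserving_shear b).map_eq]
    refine integral_map (measurePreserving_shear b).measurable.aemeasurable ?_
    rw [(measurePreserving_shear b).map_eq]
    exact ((measurePreserving_vecEquiv_box.integrable_comp_emb
      (vecEquiv n).measurableEmbedding).2 hP2).aestronglyMeasurable
  rw [h3]
  refine integral_congr_ae ?_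
  filter_upwards [ae_fst_mem] with q hq
  exact (hP.comp_shear b hq).symm

/-- The `y`-component of a point of `ℝ^(1+n)`. -/
def tailCLM (n : ℕ) : Vec n →L[ℝ] EuclideanSpace ℝ (Fin n) :=
  LinearMap.toContinuousLinearMap
    { toFun := fun z => WithLp.toLp 2 fun i => z i.succ
      map_add' := fun _ _ => rfl
      map_smul' := fun _ _ => rfl }

theorem tailCLM_apply (z : Vec n) (i : Fin n) : tailCLM n z i = z i.succ := rfl

theorem tailCLM_vec (t : ℝ) (y : EuclideanSpace ℝ (Fin n)) : tailCLM n (vec t y) = y := rfl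

/-- The exponential `e^{2πi k·(y - x b)}`, which is constant along the lines of direction `(1, b)`. -/
def rayExpo (k : Fin n → ℤ) (b : EuclideanSpace ℝ (Fin n)) (z : Vec n) : ℂ :=
  expo k (tailCLM n z - z 0 • b)

theorem rayExpo_line (k : Fin n → ℤ) (y b : EuclideanSpace ℝ (Fin n)) (t : ℝ) :
    rayExpo k b (line y b t) = expo k y := by
  rw [rayExpo, line, tailCLM_vec]
  congr 1
  simp [vec]

theorem stripPeriodic_rayExpo (k : Fin n → ℤ) (b : EuclideanSpace ℝ (Fin n)) :
    StripPeriodic (rayExpo k b) := by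
  intro z _ l
  have : tailCLM n (transl l z) = tailCLM n z + intVec l := by
    ext i; exact transl_succ l z i
  rw [rayExpo, this, transl_zero, rayExpo, add_sub_right_comm, expo_add_intVec]

theorem norm_rayExpo (k : Fin n → ℤ) (b : EuclideanSpace ℝ (Fin n)) (z : Vec n) :
    ‖rayExpo k b z‖ = 1 := norm_expo _ _

theorem continuous_rayExpo (k : Fin n → ℤ) (b : EuclideanSpace ℝ (Fin n)) :
    Continuous (rayExpo k b) :=
  (continuous_expo k).comp (by fun_prop)

theorem memLp_mul_of_norm_one {X : Type*} [TopologicalSpace X] [MeasurableSpace X]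
    [OpensMeasurableSpace X] [SecondCountableTopologyEither X ℂ] {μ : Measure X} {r : ENNReal}
    {P E : X → ℂ} (hP : MemLp P r μ) (hE : Continuous E) (hE1 : ∀ z, ‖E z‖ = 1) :
    MemLp (fun z => P z * E z) r μ :=
  hP.mono (hP.1.mul hE.aestronglyMeasurable)
    (Filter.Eventually.of_forall fun z => by rw [norm_mul, hE1, mul_one])

theorem norm_integral_sq_le {X : Type*} [MeasurableSpace X] {μ : Measure X} [IsProbabilityMeasure μ]
    {f : X → ℂ} (hf : MemLp f 2 μ) : ‖∫ x, f x ∂μ‖ ^ 2 ≤ ∫ x, ‖f x‖ ^ 2 ∂μ := by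
  have h1 : Integrable (fun x => ‖f x‖) μ := (hf.integrable one_le_two).norm
  have h2 : Integrable (fun x => ‖f x‖ ^ 2) μ := (memLp_two_iff_integrable_sq_norm hf.1).1 hf
  set c := ∫ x, ‖f x‖ ∂μ
  have h3 : 0 ≤ ∫ x, (‖f x‖ - c) ^ 2 ∂μ := integral_nonneg fun x => sq_nonneg _
  have h4 : ∫ x, (‖f x‖ - c) ^ 2 ∂μ = (∫ x, ‖f x‖ ^ 2 ∂μ) - 2 * c * c + c ^ 2 := by
    have : ∀ x, (‖f x‖ - c) ^ 2 = ‖f x‖ ^ 2 - 2 * c * ‖f x‖ + c ^ 2 := fun x => by ring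
    simp only [this]
    have h6 : Integrable (fun x => ‖f x‖ ^ 2 - 2 * c * ‖f x‖) μ := h2.sub (h1.const_mul _)
    rw [integral_add h6 (integrable_const _), integral_sub h2 (h1.const_mul _),
      integral_const_mul, integral_const]
    simp only [probReal_univ, one_smul]
    rfl
  have h5 : ‖∫ x, f x ∂μ‖ ≤ c := norm_integral_le_integral_norm f
  nlinarith [norm_nonneg (∫ x, f x ∂μ)]

/-- A periodic property that holds almost everywhere in the cell holds almost everywhere. -/
theorem cell_ae_of_isPeriodic {A : EuclideanSpace ℝ (Fin n) → Prop} (hA : IsPeriodic A)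
    (h : ∀ᵐ y ∂(volume.restrict (cell n)), A y) : ∀ᵐ y, A y := by
  have h1 := isAddFundamentalDomain_cell.measure_zero_of_invariant {y | ¬ A y} (fun g => ?_) ?_
  · exact h1
  · ext y
    rw [mem_vadd_set_iff_neg_vadd_mem]
    simp only [mem_ofPred_eq, hA.vadd]
  · rw [ae_restrict_iff' measurableSet_cell] at h
    rw [← nonpos_iff_eq_zero, ← (show volume {y | ¬ (y ∈ cell n → A y)} = 0 from h)]
    refine measure_mono fun y hy => ?_
    simp only [mem_ofPred_eq, Classical.not_imp]
    exact ⟨hy.2, hy.1⟩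

/-- The integrals of a periodic function over almost all segments of direction `(1, b)` vanish if and
only if the function is orthogonal to the exponentials that are constant along these segments. -/
theorem StripPeriodic.ae_line_integral_eq_zero_iff {P : Vec n → ℂ} (hP : StripPeriodic P)
    (hP2 : MemLp P 2 (volume.restrict (box n))) (b : EuclideanSpace ℝ (Fin n)) :
    (∀ᵐ a : EuclideanSpace ℝ (Fin n), ∫ t in (0 : ℝ)..1, P (line a b t) = 0) ↔
      ∀ k : Fin n → ℤ, ∫ z in box n, P z * rayExpo k b z = 0 := by
  -- By Fubini along the shear, these integrals are the Fourier coefficients of the ray integrals, as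
  -- a function of the starting point.
  have key : ∀ k : Fin n → ℤ, ∫ z in box n, P z * rayExpo k b z =
      ∫ y in cell n, (∫ t in (0 : ℝ)..1, P (line y b t)) * expo k y := by
    intro k
    have h1 : StripPeriodic fun z => P z * rayExpo k b z := fun z hz l => by
      simp only [hP z hz l, stripPeriodic_rayExpo k b z hz l]
    have h2 : MemLp (fun z => P z * rayExpo k b z) 2 (volume.restrict (box n)) :=
      memLp_mul_of_norm_one hP2 (continuous_rayExpo k b) (norm_rayExpo k b)
    rw [← h1.integral_comp_line (h2.integrable one_le_two) b]
    simp only [rayExpo_line, intervalIntegral.integral_mul_const]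
  constructor
  · intro h k
    rw [key]
    refine (integral_congr_ae (g := 0) ?_).trans (integral_zero _ _)
    filter_upwards [ae_restrict_of_ae h] with y hy
    simp only [hy, zero_mul, Pi.zero_apply]
  · intro h
    refine cell_ae_of_isPeriodic (fun l a => ?_) ?_
    · refine congrArg (· = (0 : ℂ)) (intervalIntegral.integral_congr fun t ht => ?_)
      rw [uIcc_of_le zero_le_one] at ht
      have h1 := hP.isPeriodic ht l (a + t • b)
      simp only [line]
      rwa [add_right_comm] at h1
    · refine ae_eq_zero_of_forall_expo ?_ fun k => (key k).symm.trans (h k)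
      have h1 := hP.memLp_comp_line hP2 b
      have h2 : AEStronglyMeasurable (fun y => ∫ t in (0 : ℝ)..1, P (line y b t))
          (volume.restrict (cell n)) := by
        have := h1.1.prod_swap.integral_prod_right'
        simpa only [integral_Icc_eq_integral_Ioc, ← intervalIntegral.integral_of_le zero_le_one] using! this
      rw [memLp_two_iff_integrable_sq_norm h2]
      have h3 : Integrable (fun q : ℝ × EuclideanSpace ℝ (Fin n) => ‖P (line q.2 b q.1)‖ ^ 2)
        ((volume.restrict (Icc (0 : ℝ) 1)).prod (volume.restrict (cell n))) :=
        (memLp_two_iff_integrable_sq_norm h1.1).1 h1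
      have h4 := h3.integral_prod_right
      refine h4.mono' (h2.norm.pow 2) ?_
      filter_upwards [h3.prod_left_ae, h1.1.prod_swap.prodMk_left] with y hy hy2
      have h5 := norm_integral_sq_le ((memLp_two_iff_integrable_sq_norm hy2).2 hy)
      rw [Real.norm_of_nonneg (by positivity), intervalIntegral.integral_of_le zero_le_one,
        ← integral_Icc_eq_integral_Ioc]
      exact h5

end

/-! ### Coefficients of homogeneous polynomials -/

section

variable {n : ℕ}

/-- The monomial `u^α`. -/
def monom (α : Fin (n + 1) → ℕ) (u : Vec n) : ℂ := ∏ i, ((u i : ℝ) : ℂ) ^ α i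

/-- The multi-indices of order `k`; there are none for `k < 0`. -/
def idx (n : ℕ) (k : ℤ) : Finset (Fin (n + 1) → ℕ) :=
  if 0 ≤ k then Finset.piAntidiag Finset.univ k.toNat else ∅

theorem mem_idx {k : ℤ} {α : Fin (n + 1) → ℕ} : α ∈ idx n k ↔ ((∑ i, α i : ℕ) : ℤ) = k := by
  unfold idx
  split_ifs with h
  · rw [Finset.mem_piAntidiag]
    constructor
    · rintro ⟨h1, -⟩
      have h1' : ∑ i, α i = k.toNat := h1
      omega
    · intro h1
      have h1' : ∑ i, α i = k.toNat := by omega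
      exact ⟨h1', fun i _ => Finset.mem_univ i⟩
  · simp only [Finset.notMem_empty, false_iff]
    omega

/-- A polynomial with given coefficients, as an `MvPolynomial`. -/
def toMv (T : Finset (Fin (n + 1) → ℕ)) (c : (Fin (n + 1) → ℕ) → ℂ) : MvPolynomial (Fin (n + 1)) ℂ :=
  ∑ α ∈ T, MvPolynomial.monomial (Finsupp.equivFunOnFinite.symm α) (c α)

theorem eval_toMv (T : Finset (Fin (n + 1) → ℕ)) (c : (Fin (n + 1) → ℕ) → ℂ) (u : Vec n) :
    MvPolynomial.eval (fun i => ((u i : ℝ) : ℂ)) (toMv T c) = ∑ α ∈ T, c α * monom α u := by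
  simp only [toMv, map_sum, MvPolynomial.eval_monomial, monom]
  refine Finset.sum_congr rfl fun α _ => ?_
  rw [Finsupp.prod_fintype _ _ (by simp)]
  rfl

theorem coeff_toMv (T : Finset (Fin (n + 1) → ℕ)) (c : (Fin (n + 1) → ℕ) → ℂ) (d : Fin (n + 1) →₀ ℕ) :
    (toMv T c).coeff d = if (d : Fin (n + 1) → ℕ) ∈ T then c d else 0 := by
  classical
  simp only [toMv, MvPolynomial.coeff_sum, MvPolynomial.coeff_monomial]
  have : ∀ α : Fin (n + 1) → ℕ, (Finsupp.equivFunOnFinite.symm α = d) ↔ α = d := fun α => by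
    rw [Equiv.symm_apply_eq]; rfl
  simp only [this, Finset.sum_ite_eq']

theorem degree_eq_sum (d : Fin (n + 1) →₀ ℕ) : d.degree = ∑ i, d i := by
  rw [Finsupp.degree]
  exact Finset.sum_subset (Finset.subset_univ _) (by simp)

theorem isHomPoly_iff {k : ℤ} {F : Vec n → ℂ} :
    IsHomPoly k F ↔ ∃ c : (Fin (n + 1) → ℕ) → ℂ, ∀ u, F u = ∑ α ∈ idx n k, c α * monom α u := by
  constructor
  · rintro ⟨q, hq, hF⟩
    refine ⟨fun α => q.coeff (Finsupp.equivFunOnFinite.symm α), fun u => ?_⟩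
    rw [hF, ← eval_toMv]
    congr 1
    ext d
    rw [coeff_toMv]
    have hd : Finsupp.equivFunOnFinite.symm (d : Fin (n + 1) → ℕ) = d :=
      Finsupp.equivFunOnFinite.symm_apply_apply d
    split_ifs with h
    · rw [hd]
    · by_contra h1
      refine h (mem_idx.2 ?_)
      rw [← hq d (MvPolynomial.mem_support_iff.2 h1), degree_eq_sum]
  · rintro ⟨c, hc⟩
    refine ⟨toMv (idx n k) c, fun d hd => ?_, fun u => by rw [hc, eval_toMv]⟩
    rw [MvPolynomial.mem_support_iff, coeff_toMv] at hd
    have h1 : (d : Fin (n + 1) → ℕ) ∈ idx n k := by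
      by_contra h; simp [h] at hd
    rw [degree_eq_sum]
    exact mem_idx.1 h1

theorem isHomPoly_sum_monom (k : ℤ) (c : (Fin (n + 1) → ℕ) → ℂ) :
    IsHomPoly k fun u : Vec n => ∑ α ∈ idx n k, c α * monom α u :=
  isHomPoly_iff.2 ⟨c, fun _ => rfl⟩

/-- A polynomial function on `ℝ^(1+n)` determines its coefficients. -/
theorem coeff_eq_zero_of_forall (T : Finset (Fin (n + 1) → ℕ)) (c : (Fin (n + 1) → ℕ) → ℂ)
    (h : ∀ u : Vec n, ∑ α ∈ T, c α * monom α u = 0) {α : Fin (n + 1) → ℕ} (hα : α ∈ T) : c α = 0 := by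
  have h1 : toMv T c = 0 := by
    refine MvPolynomial.funext_set (fun _ => range ((↑) : ℝ → ℂ))
      (fun _ => infinite_range_of_injective Complex.ofReal_injective) fun x hx => ?_
    choose u hu using fun i => hx i (mem_univ i)
    have h2 := eval_toMv T c (WithLp.toLp 2 u)
    rw [h] at h2
    rw [map_zero, ← h2]
    congr 2
    funext i
    exact (hu i).symm
  have h2 := coeff_toMv T c (Finsupp.equivFunOnFinite.symm α)
  rw [h1] at h2
  simpa [hα] using h2.symm

/-- The coefficients of a polynomial are linear combinations of finitely many of its values. -/
theorem exists_interpolation (T : Finset (Fin (n + 1) → ℕ)) :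
    ∃ (S : Finset (Vec n)) (w : (Fin (n + 1) → ℕ) → Vec n → ℂ), ∀ c : (Fin (n + 1) → ℕ) → ℂ,
      ∀ α ∈ T, c α = ∑ s ∈ S, w α s * ∑ β ∈ T, c β * monom β s := by
  classical
  let ev : Vec n → Module.Dual ℂ (T → ℂ) := fun s =>
    ∑ β : T, monom (β : Fin (n + 1) → ℕ) s • LinearMap.proj β
  have hev : ∀ s (c : T → ℂ), ev s c = ∑ β : T, c β * monom (β : Fin (n + 1) → ℕ) s := by
    intro s c
    simp [ev, LinearMap.sum_apply, mul_comm]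
  have hspan : Submodule.span ℂ (range ev) = ⊤ := by
    by_contra hne
    obtain ⟨φ, hφ, hφ0⟩ := Submodule.exists_le_ker_of_lt_top _ (lt_top_iff_ne_top.2 hne)
    obtain ⟨c, rfl⟩ := (Module.evalEquiv ℂ (T → ℂ)).surjective φ
    have h1 : ∀ s, ev s c = 0 := fun s => hφ0 (Submodule.subset_span (mem_range_self s))
    apply hφ
    have : c = 0 := by
      funext β
      have h2 := coeff_eq_zero_of_forall T (fun α => if h : α ∈ T then c ⟨α, h⟩ else 0)
        (fun u => ?_) β.2
      · simpa using h2
      · rw [← h1 u, hev, ← Finset.sum_coe_sort T]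
        simp
    rw [this, map_zero]
  have h1 : ∀ α : T, ∃ w : Vec n →₀ ℂ, (w.sum fun s a => a • ev s) = LinearMap.proj α := by
    intro α
    rw [← Finsupp.mem_span_range_iff_exists_finsupp, hspan]
    trivial
  choose w hw using h1
  refine ⟨Finset.univ.biUnion fun α => (w α).support,
    fun α s => if h : α ∈ T then w ⟨α, h⟩ s else 0, fun c α hα => ?_⟩
  have h2 := congrArg (fun L : Module.Dual ℂ (T → ℂ) => L fun β => c β) (hw ⟨α, hα⟩)
  simp only [LinearMap.proj_apply] at h2
  rw [← h2, Finsupp.sum_of_support_subset (s := Finset.univ.biUnion fun α => (w α).support) _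
    (Finset.subset_biUnion_of_mem (fun α => (w α).support) (Finset.mem_univ _)) _ (by simp)]
  rw [LinearMap.sum_apply]
  refine Finset.sum_congr rfl fun s _ => ?_
  simp only [dif_pos hα]
  rw [LinearMap.smul_apply, hev, smul_eq_mul, ← Finset.sum_coe_sort T]

/-- Interpolation nodes for the homogeneous polynomials of order `k`. -/
def nodes (n : ℕ) (k : ℤ) : Finset (Vec n) := (exists_interpolation (idx n k)).choose

/-- Interpolation weights for the homogeneous polynomials of order `k`. -/
def weights (k : ℤ) : (Fin (n + 1) → ℕ) → Vec n → ℂ := (exists_interpolation (idx n k)).choose_spec.choose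

/-- The coefficient of `u^α` of a homogeneous polynomial of order `k`, expressed by its values at the
nodes, so that it is defined and linear for arbitrary functions. -/
def coef (k : ℤ) (α : Fin (n + 1) → ℕ) (F : Vec n → ℂ) : ℂ := ∑ s ∈ nodes n k, weights k α s * F s

theorem coef_sum_monom (k : ℤ) (c : (Fin (n + 1) → ℕ) → ℂ) {α : Fin (n + 1) → ℕ} (hα : α ∈ idx n k) :
    coef k α (fun u => ∑ β ∈ idx n k, c β * monom β u) = c α :=
  ((exists_interpolation (idx n k)).choose_spec.choose_spec c α hα).symm

theorem IsHomPoly.eq_sum {k : ℤ} {F : Vec n → ℂ} (hF : IsHomPoly k F) (u : Vec n) :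
    F u = ∑ α ∈ idx n k, coef k α F * monom α u := by
  obtain ⟨c, hc⟩ := isHomPoly_iff.1 hF
  obtain rfl : F = _ := funext hc
  exact Finset.sum_congr rfl fun α hα => by rw [coef_sum_monom k c hα]

theorem IsHomPoly.sum {ι : Type*} {k : ℤ} {F : ι → Vec n → ℂ} (s : Finset ι)
    (hF : ∀ i ∈ s, IsHomPoly k (F i)) : IsHomPoly k fun u => ∑ i ∈ s, F i u := by
  refine isHomPoly_iff.2 ⟨fun α => ∑ i ∈ s, coef k α (F i), fun u => ?_⟩
  simp only [Finset.sum_mul]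
  rw [Finset.sum_comm]
  exact Finset.sum_congr rfl fun i hi => (hF i hi).eq_sum u

theorem IsHomPoly.const_mul {k : ℤ} {F : Vec n → ℂ} (a : ℂ) (hF : IsHomPoly k F) :
    IsHomPoly k fun u => a * F u := by
  refine isHomPoly_iff.2 ⟨fun α => a * coef k α F, fun u => ?_⟩
  simp only [mul_assoc]
  rw [← Finset.mul_sum, ← hF.eq_sum u]

theorem isHomPoly_zero (k : ℤ) : IsHomPoly k fun _ : Vec n => 0 :=
  isHomPoly_iff.2 ⟨fun _ => 0, fun u => by simp⟩

theorem IsHomPoly.comp_linear {k : ℤ} {F : Vec n → ℂ} (hF : IsHomPoly k F) (L : Vec n →ₗ[ℝ] Vec n) :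
    IsHomPoly k fun u => F (L u) := by
  rcases lt_or_ge k 0 with hk | hk
  · have : ∀ u, F u = 0 := fun u => by
      rw [hF.eq_sum u, idx, if_neg (not_le.2 hk), Finset.sum_empty]
    simp only [this]
    exact isHomPoly_zero k
  lift k to ℕ using hk
  obtain ⟨q, hq, hF⟩ := hF
  have hq' : q.IsHomogeneous k := by
    intro d hd
    refine (DFunLike.congr_fun Finsupp.degree_eq_weight_one d).symm.trans ?_
    exact_mod_cast hq d (MvPolynomial.mem_support_iff.2 hd)
  let ℓ : Fin (n + 1) → MvPolynomial (Fin (n + 1)) ℂ := fun i =>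
    ∑ j, MvPolynomial.C ((L (EuclideanSpace.single j 1) i : ℝ) : ℂ) * MvPolynomial.X j
  have hℓ : ∀ i, (ℓ i).IsHomogeneous 1 := fun i => by
    refine MvPolynomial.IsHomogeneous.sum _ _ _ fun j _ => ?_
    simpa using (MvPolynomial.isHomogeneous_C _ _).mul (MvPolynomial.isHomogeneous_X ℂ j)
  refine ⟨MvPolynomial.aeval ℓ q, fun d hd => ?_, fun u => ?_⟩
  · have h1 := hq'.aeval ℓ hℓ (MvPolynomial.mem_support_iff.1 hd)
    have h2 := (DFunLike.congr_fun Finsupp.degree_eq_weight_one d).trans h1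
    rw [one_mul] at h2
    exact_mod_cast h2
  · have h1 := MvPolynomial.comp_aeval_apply ℓ
      (MvPolynomial.aeval (R := ℂ) fun i => ((u i : ℝ) : ℂ)) q
    have e : ∀ (x : Fin (n + 1) → ℂ) p, MvPolynomial.aeval x p = MvPolynomial.eval x p :=
      fun x p => DFunLike.congr_fun (MvPolynomial.coe_aeval_eq_eval x) p
    simp only [e] at h1 ⊢
    rw [h1]
    simp only [hF]
    congr 2
    funext i
    simp only [ℓ, map_sum, map_mul, MvPolynomial.eval_C, MvPolynomial.eval_X]
    have h2 : u = ∑ j, u j • EuclideanSpace.single j (1 : ℝ) := by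
      ext i; simp [Pi.single_apply]
    conv_lhs => rw [h2]
    simp [mul_comm]

theorem continuous_monom (α : Fin (n + 1) → ℕ) : Continuous (monom α) := by
  unfold monom
  fun_prop

theorem IsHomPoly.continuous {k : ℤ} {F : Vec n → ℂ} (hF : IsHomPoly k F) : Continuous F := by
  rw [funext hF.eq_sum]
  exact continuous_finsetSum _ fun α _ => continuous_const.mul (continuous_monom α)

theorem monom_smul (α : Fin (n + 1) → ℕ) (r : ℝ) (u : Vec n) :
    monom α (r • u) = (r : ℂ) ^ (∑ i, α i) * monom α u := by
  simp only [monom, PiLp.smul_apply, smul_eq_mul, Complex.ofReal_mul, mul_pow, Finset.prod_mul_distrib]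
  rw [Finset.prod_pow_eq_pow_sum]

theorem IsHomPoly.smul_apply {k : ℤ} {F : Vec n → ℂ} (hF : IsHomPoly k F) (r : ℝ) (u : Vec n) :
    F (r • u) = (r : ℂ) ^ k.toNat * F u := by
  rw [hF.eq_sum, hF.eq_sum u, Finset.mul_sum]
  refine Finset.sum_congr rfl fun α hα => ?_
  have := mem_idx.1 hα
  rw [monom_smul, show ∑ i, α i = k.toNat by omega]
  ring

theorem norm_monom_le (α : Fin (n + 1) → ℕ) (u : Vec n) : ‖monom α u‖ ≤ ‖u‖ ^ (∑ i, α i) := by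
  rw [monom, norm_prod, ← Finset.prod_pow_eq_pow_sum]
  refine Finset.prod_le_prod (fun _ _ => norm_nonneg _) fun i _ => ?_
  rw [norm_pow, Complex.norm_real]
  exact pow_le_pow_left₀ (norm_nonneg _) (PiLp.norm_apply_le u i) _

theorem IsHomPoly.norm_sq_le {k : ℤ} {F : Vec n → ℂ} (hF : IsHomPoly k F) (u : Vec n) :
    ‖F u‖ ^ 2 ≤ (idx n k).card * (∑ α ∈ idx n k, ‖coef k α F‖ ^ 2) * ‖u‖ ^ (2 * k.toNat) := by
  rw [hF.eq_sum u]
  calc ‖∑ α ∈ idx n k, coef k α F * monom α u‖ ^ 2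
      ≤ (∑ α ∈ idx n k, ‖coef k α F‖ * ‖u‖ ^ k.toNat) ^ 2 := by
        refine pow_le_pow_left₀ (norm_nonneg _) (norm_sum_le_of_le _ fun α hα => ?_) 2
        rw [norm_mul]
        refine mul_le_mul_of_nonneg_left ?_ (norm_nonneg _)
        have h1 := mem_idx.1 hα
        rw [show k.toNat = ∑ i, α i by omega]
        exact norm_monom_le α u
    _ ≤ (idx n k).card * ∑ α ∈ idx n k, (‖coef k α F‖ * ‖u‖ ^ k.toNat) ^ 2 :=
        sq_sum_le_card_mul_sum_sq
    _ = _ := by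
        simp only [mul_pow, ← Finset.sum_mul, mul_assoc, ← pow_mul, mul_comm k.toNat]

theorem IsHomPoly.integrable_norm_sq {k : ℤ} {F : Vec n → ℂ} (hF : IsHomPoly k F) :
    Integrable (fun u : Metric.sphere (0 : Vec n) 1 => ‖F u‖ ^ 2)
      (volume : Measure (Vec n)).toSphere := by
  have h : Continuous fun u : Metric.sphere (0 : Vec n) 1 => ‖F u‖ ^ 2 :=
    ((hF.continuous.comp continuous_subtype_val).norm).pow 2
  exact h.integrable_of_hasCompactSupport (HasCompactSupport.of_compactSpace _)

/-- The norm in `L²(Sⁿ)` is bounded by the coefficients. -/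
theorem exists_polyNormSq_le (n : ℕ) (k : ℤ) : ∃ A : ℝ, 0 ≤ A ∧ ∀ F : Vec n → ℂ, IsHomPoly k F →
    polyNormSq F ≤ A * ∑ α ∈ idx n k, ‖coef k α F‖ ^ 2 := by
  refine ⟨(idx n k).card * ((volume : Measure (Vec n)).toSphere).real univ, by positivity,
    fun F hF => ?_⟩
  calc polyNormSq F ≤ ∫ _u : Metric.sphere (0 : Vec n) 1,
        (idx n k).card * (∑ α ∈ idx n k, ‖coef k α F‖ ^ 2) ∂((volume : Measure (Vec n)).toSphere) := by
        refine integral_mono hF.integrable_norm_sq (integrable_const _) fun u => ?_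
        have h1 := hF.norm_sq_le u
        rwa [norm_eq_of_mem_sphere, one_pow, mul_one] at h1
    _ = _ := by
        rw [integral_const, smul_eq_mul]; ring

theorem polyNormSq_nonneg (F : Vec n → ℂ) : 0 ≤ polyNormSq F := integral_nonneg fun _ => by positivity

theorem IsHomPoly.eq_zero_of_sphere {k : ℤ} {F : Vec n → ℂ} (hF : IsHomPoly k F)
    (h : ∀ u : Metric.sphere (0 : Vec n) 1, F u = 0) (u : Vec n) : F u = 0 := by
  have h1 : EqOn F 0 {0}ᶜ := by
    intro u hu
    have hu' : ‖u‖ ≠ 0 := norm_ne_zero_iff.2 hu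
    have h2 := h ⟨‖u‖⁻¹ • u, by
      rw [mem_sphere_zero_iff_norm, norm_smul, norm_inv, norm_norm, inv_mul_cancel₀ hu']⟩
    have h3 := hF.smul_apply ‖u‖ (‖u‖⁻¹ • u)
    rw [smul_smul, mul_inv_cancel₀ hu', one_smul, h2, mul_zero] at h3
    exact h3
  exact congrFun (Continuous.ext_on (dense_compl_singleton 0) hF.continuous continuous_const h1) u

theorem Lp_norm_sq {X : Type*} [MeasurableSpace X] {μ : Measure X} (f : Lp ℂ 2 μ) :
    ‖f‖ ^ 2 = ∫ x, ‖f x‖ ^ 2 ∂μ := by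
  have h1 : (inner ℂ f f : ℂ) = ((∫ x, ‖f x‖ ^ 2 ∂μ : ℝ) : ℂ) := by
    rw [L2.inner_def, ← integral_complex_ofReal]
    refine integral_congr_ae (Filter.Eventually.of_forall fun x => ?_)
    simp only [inner_self_eq_norm_sq_to_K]
    push_cast
    rfl
  rw [inner_self_eq_norm_sq_to_K] at h1
  exact Complex.ofReal_injective (by rw [Complex.ofReal_pow]; exact h1)

theorem Lp_norm_sq_toLp {X : Type*} [MeasurableSpace X] {μ : Measure X} {f : X → ℂ} (hf : MemLp f 2 μ) :
    ‖hf.toLp f‖ ^ 2 = ∫ x, ‖f x‖ ^ 2 ∂μ := by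
  rw [Lp_norm_sq]
  refine integral_congr_ae ?_
  filter_upwards [hf.coeFn_toLp] with x hx
  rw [hx]

/-- On a finite-dimensional space of continuous functions, the `L²` norm dominates the coefficients with
respect to a basis. -/
theorem exists_norm_le_of_linearIndependent {S ι : Type*} [TopologicalSpace S] [CompactSpace S]
    [MeasurableSpace S] [BorelSpace S] [SecondCountableTopologyEither S ℂ] (σ : Measure S)
    [IsFiniteMeasure σ] [σ.IsOpenPosMeasure]
    [Fintype ι] (m : ι → C(S, ℂ)) (hm : ∀ c : ι → ℂ, (∀ u, ∑ i, c i * m i u = 0) → c = 0) :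
    ∃ B : ℝ, 0 ≤ B ∧ ∀ (c : ι → ℂ) i, ‖c i‖ ^ 2 ≤ B * ∫ u, ‖∑ i, c i * m i u‖ ^ 2 ∂σ := by
  let T₀ : (ι → ℂ) →ₗ[ℂ] C(S, ℂ) := ∑ i, (LinearMap.proj i).smulRight (m i)
  have hT₀ : ∀ (c : ι → ℂ) u, T₀ c u = ∑ i, c i * m i u := by
    intro c u
    simp [T₀, LinearMap.sum_apply, ContinuousMap.sum_apply]
  let T : (ι → ℂ) →ₗ[ℂ] Lp ℂ 2 σ := (ContinuousMap.toLp 2 σ ℂ).toLinearMap ∘ₗ T₀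
  have hker : LinearMap.ker T = ⊥ := by
    rw [LinearMap.ker_eq_bot']
    intro c hc
    have h1 : T₀ c = 0 := ContinuousMap.toLp_injective σ (hc.trans (map_zero _).symm)
    exact hm c fun u => by rw [← hT₀, h1]; rfl
  obtain ⟨K, hK, hKT⟩ := T.exists_antilipschitzWith hker
  refine ⟨(K : ℝ) ^ 2, by positivity, fun c i => ?_⟩
  have h1 := hKT.le_mul_dist c 0
  rw [dist_zero_right, map_zero, dist_zero_right] at h1
  have h2 : ‖T c‖ ^ 2 = ∫ u, ‖∑ i, c i * m i u‖ ^ 2 ∂σ := by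
    rw [Lp_norm_sq]
    refine integral_congr_ae ?_
    filter_upwards [ContinuousMap.coeFn_toLp σ (𝕜 := ℂ) (p := 2) (T₀ c)] with u hu
    change ‖(ContinuousMap.toLp 2 σ ℂ (T₀ c)) u‖ ^ 2 = _
    rw [hu, hT₀]
  calc ‖c i‖ ^ 2 ≤ (K * ‖T c‖) ^ 2 :=
        pow_le_pow_left₀ (norm_nonneg _) ((norm_le_pi_norm c i).trans h1) 2
    _ = _ := by rw [mul_pow, h2]

/-- The coefficients are bounded by the norm in `L²(Sⁿ)`. -/
theorem exists_coef_le (n : ℕ) (k : ℤ) : ∃ B : ℝ, 0 ≤ B ∧ ∀ F : Vec n → ℂ, IsHomPoly k F →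
    ∀ α ∈ idx n k, ‖coef k α F‖ ^ 2 ≤ B * polyNormSq F := by
  have hind : ∀ c : idx n k → ℂ, (∀ u : Metric.sphere (0 : Vec n) 1,
      ∑ α : idx n k, c α * monom (α : Fin (n + 1) → ℕ) (u : Vec n) = 0) → c = 0 := by
    intro c hc
    have h2 : ∀ u, ∑ α ∈ idx n k, (if h : α ∈ idx n k then c ⟨α, h⟩ else 0) * monom α u =
        ∑ α : idx n k, c α * monom (α : Fin (n + 1) → ℕ) u := fun u => by
      rw [← Finset.sum_coe_sort (idx n k)]
      simp
    have h4 := (isHomPoly_sum_monom k fun α => if h : α ∈ idx n k then c ⟨α, h⟩ else 0).eq_zero_of_sphere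
      fun u => (h2 u).trans (hc u)
    funext α
    simpa using coeff_eq_zero_of_forall _ _ h4 α.2
  have hB : ∃ B : ℝ, 0 ≤ B ∧ ∀ (c : idx n k → ℂ) i, ‖c i‖ ^ 2 ≤ B *
      ∫ u : Metric.sphere (0 : Vec n) 1, ‖∑ α : idx n k, c α * monom (α : Fin (n + 1) → ℕ) (u : Vec n)‖ ^ 2
        ∂((volume : Measure (Vec n)).toSphere) :=
    exists_norm_le_of_linearIndependent (volume : Measure (Vec n)).toSphere
      (fun α : idx n k => ⟨fun u => monom (α : Fin (n + 1) → ℕ) (u : Vec n),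
        (continuous_monom _).comp continuous_subtype_val⟩) hind
  obtain ⟨B, hB, h⟩ := hB
  refine ⟨B, hB, fun F hF α hα => ?_⟩
  have h3 := h (fun β => coef k β F) ⟨α, hα⟩
  have h4 : polyNormSq F = ∫ u : Metric.sphere (0 : Vec n) 1,
      ‖∑ α : idx n k, coef k α F * monom (α : Fin (n + 1) → ℕ) (u : Vec n)‖ ^ 2
        ∂((volume : Measure (Vec n)).toSphere) := by
    refine integral_congr_ae (Filter.Eventually.of_forall fun u => ?_)
    simp only
    rw [hF.eq_sum, ← Finset.sum_coe_sort (idx n k)]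
  rw [h4]
  exact h3

end

/-! ### Symmetrized derivatives and Korn's inequality -/

section

variable {n : ℕ}

/-- `α! = ∏ i, (α i)!` -/
def multiFact (α : Fin (n + 1) → ℕ) : ℝ := ∏ i, ((α i).factorial : ℝ)

theorem one_le_multiFact (α : Fin (n + 1) → ℕ) : 1 ≤ multiFact α := by
  unfold multiFact
  rw [← Nat.cast_prod]
  exact_mod_cast Finset.prod_pos fun i _ => Nat.factorial_pos _

theorem multiFact_add_single (α : Fin (n + 1) → ℕ) (j : Fin (n + 1)) :
    multiFact (α + Pi.single j 1) = (α j + 1) * multiFact α := by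
  unfold multiFact
  rw [← Finset.mul_prod_erase _ _ (Finset.mem_univ j),
    ← Finset.mul_prod_erase (a := j) _ (fun i => ((α i).factorial : ℝ)) (Finset.mem_univ j), ← mul_assoc]
  congr 1
  · simp [Nat.factorial_succ]
  · refine Finset.prod_congr rfl fun i hi => ?_
    simp [Finset.ne_of_mem_erase hi]

/-- The multi-index `α - e_j`. -/
def low (α : Fin (n + 1) → ℕ) (j : Fin (n + 1)) : Fin (n + 1) → ℕ := α - Pi.single j 1

theorem low_apply (α : Fin (n + 1) → ℕ) (j : Fin (n + 1)) : low α j j = α j - 1 := by simp [low]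

theorem low_apply_of_ne (α : Fin (n + 1) → ℕ) {j l : Fin (n + 1)} (h : l ≠ j) : low α j l = α l := by
  simp [low, h]

theorem low_comm (α : Fin (n + 1) → ℕ) (j l : Fin (n + 1)) : low (low α j) l = low (low α l) j :=
  tsub_right_comm

theorem low_add_single (α : Fin (n + 1) → ℕ) (j : Fin (n + 1)) : low (α + Pi.single j 1) j = α :=
  add_tsub_cancel_right _ _

theorem low_add {α : Fin (n + 1) → ℕ} {j : Fin (n + 1)} (h : 0 < α j) :
    low α j + Pi.single j 1 = α := by
  funext i
  rcases eq_or_ne i j with rfl | hi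
  · simp [low]; omega
  · simp [low, hi]

theorem add_single_mem_idx {k : ℤ} {β : Fin (n + 1) → ℕ} (j : Fin (n + 1)) :
    β + Pi.single j 1 ∈ idx n k ↔ β ∈ idx n (k - 1) := by
  rw [mem_idx, mem_idx]
  simp only [Pi.add_apply, Finset.sum_add_distrib, Finset.sum_pi_single', Finset.mem_univ, if_true]
  push_cast
  constructor <;> intro h <;> omega

/-- Reindexing by `α = β + e_j`; the multi-indices with `α j = 0` do not contribute. -/
theorem sum_shift {M : Type*} [AddCommMonoid M] (k : ℤ) (j : Fin (n + 1)) (f : (Fin (n + 1) → ℕ) → M) :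
    ∑ α ∈ idx n k, (if 0 < α j then f (low α j) else 0) = ∑ β ∈ idx n (k - 1), f β := by
  rw [← Finset.sum_filter]
  refine Finset.sum_nbij' (fun α => low α j) (fun β => β + Pi.single j 1) ?_ ?_ ?_ ?_ ?_
  · intro α hα
    rw [Finset.mem_filter] at hα
    rw [← add_single_mem_idx j, low_add hα.2]
    exact hα.1
  · intro β hβ
    rw [Finset.mem_filter, add_single_mem_idx]
    exact ⟨hβ, by simp⟩
  · intro α hα
    rw [Finset.mem_filter] at hα
    exact low_add hα.2
  · intro β _
    exact low_add_single _ _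
  · intro α _; rfl

theorem monom_add_single (α : Fin (n + 1) → ℕ) (j : Fin (n + 1)) (u : Vec n) :
    monom (α + Pi.single j 1) u = ((u j : ℝ) : ℂ) * monom α u := by
  unfold monom
  rw [← Finset.mul_prod_erase _ _ (Finset.mem_univ j),
    ← Finset.mul_prod_erase (a := j) _ (fun i => ((u i : ℝ) : ℂ) ^ α i) (Finset.mem_univ j), ← mul_assoc]
  congr 1
  · simp [pow_succ, mul_comm]
  · refine Finset.prod_congr rfl fun i hi => ?_
    simp [Finset.ne_of_mem_erase hi]

/-- The coefficients of the symmetrized derivative `∑ j, u_j (D j)(u)` of a family of polynomials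
`D j` with coefficients `D j β`. -/
def symCoef {M : Type*} [AddCommMonoid M] (D : Fin (n + 1) → (Fin (n + 1) → ℕ) → M)
    (α : Fin (n + 1) → ℕ) : M :=
  ∑ j, if 0 < α j then D j (low α j) else 0

theorem sum_symCoef (k : ℤ) (D : Fin (n + 1) → (Fin (n + 1) → ℕ) → ℂ) (u : Vec n) :
    ∑ α ∈ idx n k, symCoef D α * monom α u =
      ∑ j, ((u j : ℝ) : ℂ) * ∑ β ∈ idx n (k - 1), D j β * monom β u := by
  simp only [symCoef, Finset.sum_mul]
  rw [Finset.sum_comm]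
  refine Finset.sum_congr rfl fun j _ => ?_
  rw [Finset.mul_sum, ← sum_shift k j]
  refine Finset.sum_congr rfl fun α _ => ?_
  split_ifs with h
  · conv_lhs => rw [← low_add h, monom_add_single]
    rw [low_add h]
    ring
  · rw [zero_mul]

section Korn

variable {E : Type*} [NormedAddCommGroup E] [InnerProductSpace ℂ E]
  (D : Fin (n + 1) → (Fin (n + 1) → ℕ) → E)

/-- One term in the expansion of `‖∑ j, u_j D_j‖²`: exchanging the indices `j` and `l` by means of `hD`
turns it into a diagonal term and a term in the expansion of the square of the divergence. -/
theorem korn_term (hD : ∀ j l β β', inner ℂ (D j β) (D l β') = inner ℂ (D l β) (D j β')) (k : ℤ)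
    (j l : Fin (n + 1)) :
    ∑ α ∈ idx n k, multiFact α * (inner ℂ (if 0 < α j then D j (low α j) else 0)
        (if 0 < α l then D l (low α l) else 0)).re =
      (if j = l then ∑ β ∈ idx n (k - 1), multiFact β * ‖D j β‖ ^ 2 else 0) +
      ∑ δ ∈ idx n (k - 1 - 1), multiFact δ * (inner ℂ (((δ l : ℝ) + 1 : ℂ) • D l (δ + Pi.single l 1))
        (((δ j : ℝ) + 1 : ℂ) • D j (δ + Pi.single j 1))).re := by
  have hre : ∀ (a b : ℕ) (x y : E), (inner ℂ (((a : ℝ) + 1 : ℂ) • x) (((b : ℝ) + 1 : ℂ) • y)).re =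
      ((a : ℝ) + 1) * ((b : ℝ) + 1) * (inner ℂ x y).re := by
    intro a b x y
    rw [inner_smul_left, inner_smul_right]
    simp only [map_add, Complex.conj_ofReal, map_one]
    rw [← mul_assoc, ← Complex.ofReal_one, ← Complex.ofReal_add, ← Complex.ofReal_add,
      ← Complex.ofReal_mul, Complex.re_ofReal_mul]
  have hin : ∀ x : E, (inner ℂ x x).re = ‖x‖ ^ 2 := fun x => inner_self_eq_norm_sq (𝕜 := ℂ) x
  simp only [hre]
  rcases eq_or_ne j l with rfl | hjl
  · rw [if_pos rfl, ← sum_shift (k - 1) j, ← Finset.sum_add_distrib, ← sum_shift k j]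
    refine Finset.sum_congr rfl fun α _ => ?_
    split_ifs with h h'
    · have e : low (low α j) j + Pi.single j 1 = low α j := low_add h'
      have e2 : multiFact α = (((low α j) j : ℕ) + 1) * multiFact (low α j) := by
        rw [← multiFact_add_single, low_add h]
      have e3 : multiFact (low α j) = ((low α j) j : ℕ) *
          multiFact (low (low α j) j) := by
        conv_lhs => rw [← e, multiFact_add_single]
        congr 1
        have : ((low (low α j) j) j + 1 : ℕ) = (low α j) j := by
          have := congrFun e j
          rwa [Pi.add_apply, Pi.single_eq_same] at this
        exact_mod_cast this
      have e4 : ((low (low α j) j) j : ℝ) + 1 = ((low α j) j : ℕ) := by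
        have := congrFun e j
        have : ((low (low α j) j) j + 1 : ℕ) = (low α j) j := by
          rwa [Pi.add_apply, Pi.single_eq_same] at this
        exact_mod_cast this
      rw [e, e4, hin, e2]
      linear_combination (((low α j) j : ℕ) : ℝ) * ‖D j (low α j)‖ ^ 2 * e3
    · have e2 : multiFact α = (((low α j) j : ℕ) + 1) * multiFact (low α j) := by
        rw [← multiFact_add_single, low_add h]
      rw [e2, hin, Nat.eq_zero_of_not_pos h']
      simp
    · simp
  · rw [if_neg hjl, zero_add, ← sum_shift (k - 1) l, ← sum_shift k j]
    refine Finset.sum_congr rfl fun α _ => ?_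
    by_cases h : 0 < α j
    · have hl : (low α j) l = α l := low_apply_of_ne α hjl.symm
      rw [if_pos h, if_pos h, hl]
      by_cases h' : 0 < α l
      · rw [if_pos h', if_pos h']
        have e1 : low (low α j) l + Pi.single l 1 = low α j :=
          low_add (by rw [hl]; exact h')
        have e2 : low (low α j) l + Pi.single j 1 = low α l := by
          rw [low_comm, low_add]
          rwa [low_apply_of_ne α hjl]
        have e3 : multiFact α = (((low (low α j) l) j : ℕ) + 1) *
            ((((low (low α j) l) l : ℕ) + 1) *
              multiFact (low (low α j) l)) := by
          rw [← multiFact_add_single, e1]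
          have : (low (low α j) l) j = (low α j) j := low_apply_of_ne _ hjl
          rw [this, ← multiFact_add_single, low_add h]
        rw [e1, e2, e3, hD j l]
        ring
      · rw [if_neg h', if_neg h', inner_zero_right]; simp
    · rw [if_neg h, if_neg h, inner_zero_left]; simp

/-- **Korn's inequality**, algebraic form: if `⟨D_j g, D_l g'⟩ = ⟨D_l g, D_j g'⟩`, then the norm of the
symmetrized derivative dominates that of the full derivative. The difference is the norm of the
divergence. -/
theorem korn (hD : ∀ j l β β', inner ℂ (D j β) (D l β') = inner ℂ (D l β) (D j β')) (k : ℤ) :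
    ∑ j, ∑ β ∈ idx n (k - 1), multiFact β * ‖D j β‖ ^ 2 ≤
      ∑ α ∈ idx n k, multiFact α * ‖symCoef D α‖ ^ 2 := by
  have hin : ∀ x : E, ‖x‖ ^ 2 = (inner ℂ x x).re := fun x => (inner_self_eq_norm_sq (𝕜 := ℂ) x).symm
  have h1 : ∑ α ∈ idx n k, multiFact α * ‖symCoef D α‖ ^ 2 =
      ∑ j, ∑ l, ∑ α ∈ idx n k, multiFact α *
        (inner ℂ (if 0 < α j then D j (low α j) else 0)
        (if 0 < α l then D l (low α l) else 0)).re := by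
    rw [Finset.sum_congr rfl fun j _ => Finset.sum_comm, Finset.sum_comm]
    refine Finset.sum_congr rfl fun α _ => ?_
    simp only [hin, symCoef, sum_inner, inner_sum, Complex.re_sum, Finset.mul_sum]
    exact Finset.sum_comm
  have h2 : ∑ δ ∈ idx n (k - 1 - 1), multiFact δ *
      ‖∑ j, ((δ j : ℝ) + 1 : ℂ) • D j (δ + Pi.single j 1)‖ ^ 2 =
      ∑ j, ∑ l, ∑ δ ∈ idx n (k - 1 - 1), multiFact δ *
        (inner ℂ (((δ l : ℝ) + 1 : ℂ) • D l (δ + Pi.single l 1))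
        (((δ j : ℝ) + 1 : ℂ) • D j (δ + Pi.single j 1))).re := by
    rw [Finset.sum_congr rfl fun j _ => Finset.sum_comm, Finset.sum_comm]
    refine Finset.sum_congr rfl fun δ _ => ?_
    simp only [hin, sum_inner, inner_sum, Complex.re_sum, Finset.mul_sum]
  rw [h1]
  simp only [korn_term D hD, Finset.sum_add_distrib, ← h2]
  simp only [Finset.sum_ite_eq, Finset.mem_univ, if_true]
  refine le_add_of_nonneg_right (Finset.sum_nonneg fun δ _ => ?_)
  exact mul_nonneg (zero_le_one.trans (one_le_multiFact δ)) (by positivity)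

end Korn

end

/-! ### Functions in `H¹₀(0,1)` and orthogonality to exponentials -/

section

/-- Lebesgue measure on `[0,1]`. -/
abbrev unitMeasure : Measure ℝ := volume.restrict (Icc (0 : ℝ) 1)

theorem intervalIntegral_eq_unit (f : ℝ → ℂ) : ∫ t in (0 : ℝ)..1, f t = ∫ t, f t ∂unitMeasure := by
  rw [intervalIntegral.integral_of_le zero_le_one, integral_Icc_eq_integral_Ioc]

theorem unitMeasure_eq : unitMeasure = volume.restrict (Ioc (0 : ℝ) 1) :=
  (Measure.restrict_congr_set Ioc_ae_eq_Icc).symm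

theorem intervalIntegrable_of_unit {q : ℝ → ℂ} (hq : Integrable q unitMeasure) {t : ℝ}
    (ht : t ∈ Icc (0 : ℝ) 1) : IntervalIntegrable q volume 0 t := by
  rw [intervalIntegrable_iff_integrableOn_Ioc_of_le ht.1]
  have h : IntegrableOn q (Icc 0 1) volume := hq
  exact h.mono_set (Ioc_subset_Icc_self.trans (Icc_subset_Icc_right ht.2))

theorem continuousOn_primitive {q : ℝ → ℂ} (hq : Integrable q unitMeasure) :
    ContinuousOn (fun t => ∫ s in (0 : ℝ)..t, q s) (Icc 0 1) := by
  have h : IntegrableOn q (uIcc 0 1) volume := by rw [uIcc_of_le zero_le_one]; exact hq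
  have := intervalIntegral.continuousOn_primitive_interval h
  rwa [uIcc_of_le zero_le_one] at this

/-- Integration by parts for primitives of integrable functions: the square `[0,1]²` is the union of the
two triangles `s ≤ t` and `s > t`. -/
theorem integral_by_parts_unit {q r : ℝ → ℂ} (hq : Integrable q unitMeasure)
    (hr : Integrable r unitMeasure) :
    (∫ t in (0 : ℝ)..1, (∫ s in (0 : ℝ)..t, q s) * r t) +
      ∫ t in (0 : ℝ)..1, q t * ∫ s in (0 : ℝ)..t, r s =
        (∫ t in (0 : ℝ)..1, q t) * ∫ t in (0 : ℝ)..1, r t := by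
  have hqr : Integrable (fun z : ℝ × ℝ => q z.1 * r z.2) (unitMeasure.prod unitMeasure) :=
    hq.mul_prod hr
  have hm : MeasurableSet {z : ℝ × ℝ | z.1 ≤ z.2} := measurableSet_le measurable_fst measurable_snd
  have h1 : ∫ t in (0 : ℝ)..1, (∫ s in (0 : ℝ)..t, q s) * r t =
      ∫ z, {z : ℝ × ℝ | z.1 ≤ z.2}.indicator (fun z => q z.1 * r z.2) z
        ∂(unitMeasure.prod unitMeasure) := by
    rw [integral_prod_symm _ (hqr.indicator hm), intervalIntegral_eq_unit]
    refine setIntegral_congr_fun measurableSet_Icc fun t ht => ?_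
    rw [intervalIntegral.integral_of_le ht.1, ← integral_Icc_eq_integral_Ioc,
      ← integral_mul_const, ← integral_indicator measurableSet_Icc, ← integral_indicator measurableSet_Icc]
    congr 1
    funext s
    simp only [indicator_apply, mem_ofPred_eq, mem_Icc]
    split_ifs <;> first | rfl | (exfalso; grind)
  have h2 : ∫ t in (0 : ℝ)..1, q t * ∫ s in (0 : ℝ)..t, r s =
      ∫ z, {z : ℝ × ℝ | z.1 ≤ z.2}ᶜ.indicator (fun z => q z.1 * r z.2) z
        ∂(unitMeasure.prod unitMeasure) := by
    rw [integral_prod _ (hqr.indicator hm.compl), intervalIntegral_eq_unit]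
    refine setIntegral_congr_fun measurableSet_Icc fun t ht => ?_
    rw [intervalIntegral.integral_of_le ht.1, ← integral_Ico_eq_integral_Ioc,
      ← integral_const_mul, ← integral_indicator measurableSet_Ico, ← integral_indicator measurableSet_Icc]
    congr 1
    funext s
    simp only [indicator_apply, mem_ofPred_eq, mem_Icc, mem_Ico, mem_compl_iff]
    split_ifs <;> first | rfl | (exfalso; grind)
  rw [h1, h2, ← integral_add (hqr.indicator hm) (hqr.indicator hm.compl), intervalIntegral_eq_unit,
    intervalIntegral_eq_unit, ← integral_prod_mul]
  congr 1
  funext z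
  exact indicator_self_add_compl_apply _ _ _

/-- `g ∈ H¹₀(0,1)` with weak derivative `g'`, `g` being the continuous representative. -/
structure IsPrimitive (g g' : ℝ → ℂ) : Prop where
  memLp : MemLp g' 2 unitMeasure
  eq : ∀ t ∈ Icc (0 : ℝ) 1, g t = ∫ s in (0 : ℝ)..t, g' s
  end_eq : g 1 = 0

namespace IsPrimitive

variable {g g' : ℝ → ℂ}

theorem continuousOn (h : IsPrimitive g g') : ContinuousOn g (Icc 0 1) :=
  (continuousOn_primitive (h.memLp.integrable one_le_two)).congr h.eq

theorem memLp_self (h : IsPrimitive g g') : MemLp g 2 unitMeasure := by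
  obtain ⟨C, hC⟩ := isCompact_Icc.exists_bound_of_continuousOn h.continuousOn
  refine MemLp.of_bound (h.continuousOn.aestronglyMeasurable measurableSet_Icc) C ?_
  filter_upwards [ae_restrict_mem measurableSet_Icc] with t ht using hC t ht

theorem integral_eq_zero (h : IsPrimitive g g') : ∫ t in (0 : ℝ)..1, g' t = 0 := by
  rw [← h.eq 1 (right_mem_Icc.2 zero_le_one), h.end_eq]

theorem zero : IsPrimitive 0 0 := ⟨MemLp.zero', fun t _ => by simp, rfl⟩

theorem integral_mul {r : ℝ → ℂ} (h : IsPrimitive g g') (hr : Integrable r unitMeasure) :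
    ∫ t in (0 : ℝ)..1, g t * r t = - ∫ t in (0 : ℝ)..1, g' t * ∫ s in (0 : ℝ)..t, r s := by
  have h1 := integral_by_parts_unit (h.memLp.integrable one_le_two) hr
  rw [h.integral_eq_zero, zero_mul] at h1
  rw [← eq_neg_of_add_eq_zero_left h1]
  refine intervalIntegral.integral_congr fun t ht => ?_
  rw [uIcc_of_le zero_le_one] at ht
  simp only [h.eq t ht]

/-- Integration by parts against a smooth function. -/
theorem integral_mul_deriv (h : IsPrimitive g g') {φ φ' : ℝ → ℂ} (hφ : ∀ t, HasDerivAt φ (φ' t) t)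
    (hφ' : Continuous φ') :
    ∫ t in (0 : ℝ)..1, g t * φ' t = - ∫ t in (0 : ℝ)..1, g' t * φ t := by
  have hc : Continuous φ := continuous_iff_continuousAt.2 fun t => (hφ t).continuousAt
  have hi : IntervalIntegrable g' volume 0 1 :=
    intervalIntegrable_of_unit (h.memLp.integrable one_le_two) (right_mem_Icc.2 zero_le_one)
  rw [h.integral_mul ((hφ'.continuousOn.integrableOn_Icc))]
  have h1 : ∀ t, ∫ s in (0 : ℝ)..t, φ' s = φ t - φ 0 := fun t =>
    intervalIntegral.integral_eq_sub_of_hasDerivAt (fun s _ => hφ s) (hφ'.intervalIntegrable _ _)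
  simp only [h1, mul_sub]
  rw [intervalIntegral.integral_sub (hi.mul_continuousOn hc.continuousOn)
    (hi.mul_const _), intervalIntegral.integral_mul_const, h.integral_eq_zero]
  simp

/-- Integration by parts for two functions in `H¹₀(0,1)`. -/
theorem integral_mul_primitive {r r' : ℝ → ℂ} (h : IsPrimitive g g') (hr : IsPrimitive r r') :
    ∫ t in (0 : ℝ)..1, g t * r' t = - ∫ t in (0 : ℝ)..1, g' t * r t := by
  rw [h.integral_mul (hr.memLp.integrable one_le_two)]
  congr 1
  refine intervalIntegral.integral_congr fun t ht => ?_
  rw [uIcc_of_le zero_le_one] at ht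
  simp only [hr.eq t ht]

theorem conj (h : IsPrimitive g g') :
    IsPrimitive (fun t => starRingEnd ℂ (g t)) (fun t => starRingEnd ℂ (g' t)) where
  memLp := h.memLp.star
  eq t ht := by
    rw [h.eq t ht, intervalIntegral.integral_of_le ht.1, intervalIntegral.integral_of_le ht.1,
      integral_conj]
  end_eq := by rw [h.end_eq, map_zero]

theorem const_mul (h : IsPrimitive g g') (c : ℂ) :
    IsPrimitive (fun t => c * g t) (fun t => c * g' t) where
  memLp := h.memLp.const_mul c
  eq t ht := by rw [h.eq t ht, intervalIntegral.integral_const_mul]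
  end_eq := by rw [h.end_eq, mul_zero]

theorem sum {ι : Type*} (s : Finset ι) {g g' : ι → ℝ → ℂ} (h : ∀ i ∈ s, IsPrimitive (g i) (g' i)) :
    IsPrimitive (fun t => ∑ i ∈ s, g i t) (fun t => ∑ i ∈ s, g' i t) where
  memLp := memLp_finsetSum _ fun i hi => (h i hi).memLp
  eq t ht := by
    rw [intervalIntegral.integral_finsetSum fun i hi =>
      intervalIntegrable_of_unit ((h i hi).memLp.integrable one_le_two) ht]
    exact Finset.sum_congr rfl fun i hi => (h i hi).eq t ht
  end_eq := Finset.sum_eq_zero fun i hi => (h i hi).end_eq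

end IsPrimitive

theorem hasDerivAt_cexp_mul (s t : ℝ) : HasDerivAt (fun t : ℝ => Complex.exp (Complex.I * s * t))
    (Complex.I * s * Complex.exp (Complex.I * s * t)) t := by
  have h1 : HasDerivAt (fun t : ℝ => Complex.I * s * (t : ℂ)) (Complex.I * s) t := by
    simpa using (Complex.ofRealCLM.hasDerivAt (x := t)).const_mul (Complex.I * s)
  convert! h1.cexp using 1
  ring

theorem norm_cexp_I (s t : ℝ) : ‖Complex.exp (Complex.I * s * t)‖ = 1 := by
  rw [Complex.norm_exp]; simp

/-- A function in `L²(0,1)` that is orthogonal to all exponentials vanishes; the frequencies in `2πℤ`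
would suffice. -/
theorem ae_eq_zero_of_forall_cexp {q : ℝ → ℂ} (hq : MemLp q 2 unitMeasure)
    (h : ∀ s : ℝ, ∫ t in (0 : ℝ)..1, q t * Complex.exp (Complex.I * s * t) = 0) :
    q =ᵐ[unitMeasure] 0 := by
  have hq' : MemLp q 2 (volume.restrict (Ioc (0 : ℝ) 1)) := by rwa [← unitMeasure_eq]
  have h1 := hasSum_sq_fourierCoeffOn (f := q) zero_lt_one hq'
  have h2 : ∀ i, fourierCoeffOn zero_lt_one q i = 0 := by
    intro i
    rw [fourierCoeffOn_eq_integral, ← h (-2 * Real.pi * i)]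
    simp only [sub_zero, div_one, one_smul, smul_eq_mul]
    refine intervalIntegral.integral_congr fun t _ => ?_
    simp only [fourier_coe_apply]
    rw [mul_comm]
    congr 2
    push_cast
    simp only [sub_zero, div_one]
    ring
  simp only [h2] at h1
  have h3 := h1.unique (by simp : HasSum (fun _ : ℤ => ‖(0 : ℂ)‖ ^ 2) (0 : ℝ))
  have h4 : ∫ t, ‖q t‖ ^ 2 ∂unitMeasure = 0 := by
    rw [unitMeasure_eq, ← intervalIntegral.integral_of_le zero_le_one]
    simpa using h3
  rw [integral_eq_zero_iff_of_nonneg (fun _ => by positivity)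
    ((memLp_two_iff_integrable_sq_norm hq.1).1 hq)] at h4
  filter_upwards [h4] with t ht
  simpa using ht

theorem continuous_integral_cexp {q : ℝ → ℂ} (hq : Integrable q unitMeasure) :
    Continuous fun s : ℝ => ∫ t in (0 : ℝ)..1, q t * Complex.exp (Complex.I * s * t) := by
  simp only [intervalIntegral_eq_unit]
  refine continuous_of_dominated (bound := fun t => ‖q t‖) (fun s => ?_) (fun s => ?_) hq.norm ?_
  · exact hq.1.mul (by fun_prop : Continuous fun t : ℝ =>
      Complex.exp (Complex.I * s * t)).aestronglyMeasurable
  · exact Filter.Eventually.of_forall fun t => by rw [norm_mul, norm_cexp_I, mul_one]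
  · exact Filter.Eventually.of_forall fun t => by fun_prop

theorem intervalIntegrable_mul_cexp {q : ℝ → ℂ} (hq : MemLp q 2 unitMeasure) (s : ℝ) :
    IntervalIntegrable (fun t => q t * Complex.exp (Complex.I * s * t)) volume 0 1 :=
  (intervalIntegrable_of_unit (hq.integrable one_le_two)
    (right_mem_Icc.2 zero_le_one)).mul_continuousOn (by fun_prop)

/-- If the polynomial `∑ s^j q_j` in `s` is orthogonal to `e^{-ist}` for all frequencies `s`, then it
has the form `(∂_t + i s) ∑ s^j g_j` with `g_j ∈ H¹₀(0,1)`. -/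
theorem exists_primitives (M : ℕ) (q : ℕ → ℝ → ℂ) (hq : ∀ j, MemLp (q j) 2 unitMeasure)
    (h : ∀ s : ℝ, ∑ j ∈ Finset.range (M + 1),
      (s : ℂ) ^ j * ∫ t in (0 : ℝ)..1, q j t * Complex.exp (Complex.I * s * t) = 0) :
    ∃ g g' : ℕ → ℝ → ℂ, (∀ j, IsPrimitive (g j) (g' j)) ∧ (∀ j, M ≤ j → g j = 0 ∧ g' j = 0) ∧
      q 0 =ᵐ[unitMeasure] g' 0 ∧
      ∀ j, j + 1 ≤ M → q (j + 1) =ᵐ[unitMeasure] fun t => g' (j + 1) t + Complex.I * g j t := by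
  induction M generalizing q with
  | zero =>
    refine ⟨0, 0, fun _ => IsPrimitive.zero, fun _ _ => ⟨rfl, rfl⟩, ?_, fun j hj => by omega⟩
    refine ae_eq_zero_of_forall_cexp (hq 0) fun s => ?_
    simpa using h s
  | succ M ih =>
    -- At `s = 0` only `q 0` is left, so it has mean zero and a primitive `g0` in `H¹₀(0,1)`. Integrating
    -- by parts moves `q 0` to the coefficient of `s`, and the sum may be divided by `s`.
    have hq0 : ∫ t in (0 : ℝ)..1, q 0 t = 0 := by
      have := h 0
      rw [Finset.sum_range_succ'] at this
      simpa using this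
    have hg0 : IsPrimitive (fun t => ∫ s in (0 : ℝ)..t, q 0 s) (q 0) := ⟨hq 0, fun _ _ => rfl, hq0⟩
    set g0 : ℝ → ℂ := fun t => ∫ s in (0 : ℝ)..t, q 0 s
    set r : ℕ → ℝ → ℂ := fun j => if j = 0 then fun t => q 1 t - Complex.I * g0 t else q (j + 1) with hr
    have hrm : ∀ j, MemLp (r j) 2 unitMeasure := by
      intro j
      simp only [hr]
      split_ifs
      · exact (hq 1).sub (hg0.memLp_self.const_mul _)
      · exact hq _
    have key : ∀ s : ℝ, s ≠ 0 → ∑ j ∈ Finset.range (M + 1),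
        (s : ℂ) ^ j * ∫ t in (0 : ℝ)..1, r j t * Complex.exp (Complex.I * s * t) = 0 := by
      intro s hs
      have h1 := h s
      rw [Finset.sum_range_succ', pow_zero, one_mul, Finset.sum_range_succ'] at h1
      have h2 := hg0.integral_mul_deriv (hasDerivAt_cexp_mul s) (by fun_prop)
      have h3 : ∫ t in (0 : ℝ)..1, r 0 t * Complex.exp (Complex.I * s * t) =
          (∫ t in (0 : ℝ)..1, q 1 t * Complex.exp (Complex.I * s * t)) -
            Complex.I * ∫ t in (0 : ℝ)..1, g0 t * Complex.exp (Complex.I * s * t) := by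
        rw [← intervalIntegral.integral_const_mul, ← intervalIntegral.integral_sub
          (intervalIntegrable_mul_cexp (hq 1) s)
          ((intervalIntegrable_mul_cexp hg0.memLp_self s).const_mul _)]
        refine intervalIntegral.integral_congr fun t _ => ?_
        simp only [hr, if_true]
        ring
      have h4 : ∫ t in (0 : ℝ)..1, g0 t * (Complex.I * s * Complex.exp (Complex.I * s * t)) =
          s * (Complex.I * ∫ t in (0 : ℝ)..1, g0 t * Complex.exp (Complex.I * s * t)) := by
        rw [← intervalIntegral.integral_const_mul, ← intervalIntegral.integral_const_mul]
        refine intervalIntegral.integral_congr fun t _ => ?_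
        ring
      rw [h4] at h2
      have h5 : (s : ℂ) * ∑ j ∈ Finset.range (M + 1),
          (s : ℂ) ^ j * ∫ t in (0 : ℝ)..1, r j t * Complex.exp (Complex.I * s * t) = 0 := by
        rw [Finset.sum_range_succ', h3, pow_zero, one_mul, mul_add, Finset.mul_sum]
        simp only [hr, Nat.add_eq_zero_iff, one_ne_zero, and_false, if_false]
        have h6 : ∀ j ∈ Finset.range M, (s : ℂ) * ((s : ℂ) ^ (j + 1) *
            ∫ t in (0 : ℝ)..1, q (j + 1 + 1) t * Complex.exp (Complex.I * s * t)) =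
            (s : ℂ) ^ (j + 1 + 1) *
            ∫ t in (0 : ℝ)..1, q (j + 1 + 1) t * Complex.exp (Complex.I * s * t) :=
          fun j _ => by ring
        rw [Finset.sum_congr rfl h6]
        linear_combination h1 - h2
      exact (mul_eq_zero.1 h5).resolve_left (by exact_mod_cast hs)
    -- The case `s = 0` is recovered by continuity.
    have key' : ∀ s : ℝ, ∑ j ∈ Finset.range (M + 1),
        (s : ℂ) ^ j * ∫ t in (0 : ℝ)..1, r j t * Complex.exp (Complex.I * s * t) = 0 := by
      have hc : Continuous fun s : ℝ => ∑ j ∈ Finset.range (M + 1),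
          (s : ℂ) ^ j * ∫ t in (0 : ℝ)..1, r j t * Complex.exp (Complex.I * s * t) :=
        continuous_finsetSum _ fun j _ => (by fun_prop : Continuous fun s : ℝ => (s : ℂ) ^ j).mul
          (continuous_integral_cexp ((hrm j).integrable one_le_two))
      exact fun s => congrFun (Continuous.ext_on (dense_compl_singleton (0 : ℝ)) hc continuous_const
        fun s hs => key s hs) s
    obtain ⟨g, g', hgg, hv, h0, hs⟩ := ih r hrm key'
    refine ⟨fun j => j.casesOn g0 g, fun j => j.casesOn (q 0) g', ?_, ?_, ?_, ?_⟩
    · rintro (_ | j)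
      · exact hg0
      · exact hgg j
    · rintro (_ | j) hj
      · omega
      · exact hv j (by omega)
    · exact Filter.EventuallyEq.rfl
    · rintro (_ | j) hj
      · filter_upwards [h0] with t ht
        simp only [hr, if_true] at ht
        change q 1 t = g' 0 t + Complex.I * g0 t
        rw [← ht]
        ring
      · filter_upwards [hs j (by omega)] with t ht
        simpa [hr] using ht

end

/-! ### The transport equation on one Fourier mode -/

section

variable {n : ℕ}

theorem memLp_coef {X : Type*} [MeasurableSpace X] {μ : Measure X} {r : ENNReal} (k : ℤ)
    {F : X → Vec n → ℂ} (hF : ∀ u, MemLp (fun x => F x u) r μ) (α : Fin (n + 1) → ℕ) :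
    MemLp (fun x => coef k α (F x)) r μ :=
  memLp_finsetSum _ fun s _ => (hF s).const_mul _

/-- The multi-index `α` with the entries at `0` and `J` erased. -/
def eraseTwo (J : Fin (n + 1)) (α : Fin (n + 1) → ℕ) : Fin (n + 1) → ℕ :=
  fun i => if i = 0 ∨ i = J then 0 else α i

theorem monom_eq_eraseTwo {J : Fin (n + 1)} (hJ : J ≠ 0) (α : Fin (n + 1) → ℕ) (u : Vec n) :
    monom α u = ((u 0 : ℝ) : ℂ) ^ α 0 * ((u J : ℝ) : ℂ) ^ α J * monom (eraseTwo J α) u := by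
  have h : ∀ f : Fin (n + 1) → ℂ, ∏ i, f i = f 0 * (f J * ∏ i ∈ (Finset.univ.erase 0).erase J, f i) := by
    intro f
    rw [Finset.mul_prod_erase _ _ (Finset.mem_erase.2 ⟨hJ, Finset.mem_univ _⟩),
      Finset.mul_prod_erase _ _ (Finset.mem_univ _)]
  unfold monom
  rw [h, h]
  have h1 : ∏ i ∈ (Finset.univ.erase 0).erase J, ((u i : ℝ) : ℂ) ^ eraseTwo J α i =
      ∏ i ∈ (Finset.univ.erase 0).erase J, ((u i : ℝ) : ℂ) ^ α i := by
    refine Finset.prod_congr rfl fun i hi => ?_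
    rw [Finset.mem_erase, Finset.mem_erase] at hi
    simp [eraseTwo, hi.1, hi.2.1]
  rw [h1]
  simp only [eraseTwo, true_or, or_true, if_true, pow_zero, one_mul]
  ring

/-- The multi-index with entries `a` at `0`, `j` at `J`, and those of `γ` elsewhere. -/
def fillTwo (J : Fin (n + 1)) (γ : Fin (n + 1) → ℕ) (a j : ℕ) : Fin (n + 1) → ℕ :=
  fun i => if i = 0 then a else if i = J then j else γ i

theorem sum_fillTwo {J : Fin (n + 1)} (hJ : J ≠ 0) (α : Fin (n + 1) → ℕ) (a j : ℕ) :
    ∑ i, fillTwo J (eraseTwo J α) a j i = a + j + ∑ i, eraseTwo J α i := by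
  have h : ∀ f : Fin (n + 1) → ℕ, ∑ i, f i = f 0 + (f J + ∑ i ∈ (Finset.univ.erase 0).erase J, f i) := by
    intro f
    rw [Finset.add_sum_erase _ _ (Finset.mem_erase.2 ⟨hJ, Finset.mem_univ _⟩),
      Finset.add_sum_erase _ _ (Finset.mem_univ _)]
  rw [h, h (eraseTwo J α)]
  have h1 : ∑ i ∈ (Finset.univ.erase 0).erase J, fillTwo J (eraseTwo J α) a j i =
      ∑ i ∈ (Finset.univ.erase 0).erase J, eraseTwo J α i := by
    refine Finset.sum_congr rfl fun i hi => ?_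
    rw [Finset.mem_erase, Finset.mem_erase] at hi
    simp [fillTwo, hi.1, hi.2.1]
  rw [h1]
  simp [fillTwo, eraseTwo, hJ]
  ring

theorem fillTwo_eraseTwo (J : Fin (n + 1)) (α : Fin (n + 1) → ℕ) :
    fillTwo J (eraseTwo J α) (α 0) (α J) = α := by
  funext i
  unfold fillTwo eraseTwo
  split_ifs <;> simp_all

theorem eraseTwo_fillTwo (J : Fin (n + 1)) (α : Fin (n + 1) → ℕ) (a j : ℕ) :
    eraseTwo J (fillTwo J (eraseTwo J α) a j) = eraseTwo J α := by
  funext i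
  unfold fillTwo eraseTwo
  split_ifs <;> simp_all

theorem eraseTwo_low_zero (J : Fin (n + 1)) (α : Fin (n + 1) → ℕ) :
    eraseTwo J (low α 0) = eraseTwo J α := by
  funext i
  unfold eraseTwo
  split_ifs with h
  · rfl
  · exact low_apply_of_ne α (by tauto)

theorem eraseTwo_low_self (J : Fin (n + 1)) (α : Fin (n + 1) → ℕ) :
    eraseTwo J (low α J) = eraseTwo J α := by
  funext i
  unfold eraseTwo
  split_ifs with h
  · rfl
  · exact low_apply_of_ne α (by tauto)

/-- The solution `G` of `(u_0 ∂_t + i u_J) G = q` in `H¹₀(0,1)`, for `q` orthogonal to the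
exponentials `e^{-i u_J t}` at `u_0 = 1`. -/
theorem exists_mode_coord {J : Fin (n + 1)} (hJ : J ≠ 0) (m : ℕ) (c : (Fin (n + 1) → ℕ) → ℝ → ℂ)
    (hc : ∀ α, MemLp (c α) 2 unitMeasure)
    (h : ∀ u : Vec n, u 0 = 1 → ∫ t in (0 : ℝ)..1, (∑ α ∈ idx n m, c α t * monom α u) *
      Complex.exp (Complex.I * u J * t) = 0) :
    ∃ G G' : (Fin (n + 1) → ℕ) → ℝ → ℂ, (∀ β, IsPrimitive (G β) (G' β)) ∧
      ∀ᵐ t ∂unitMeasure, ∀ u : Vec n, ∑ α ∈ idx n m, c α t * monom α u =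
        u 0 * (∑ β ∈ idx n (m - 1), G' β t * monom β u) +
          Complex.I * u J * ∑ β ∈ idx n (m - 1), G β t * monom β u := by
  classical
  -- The coefficient of each monomial in the remaining variables vanishes separately.
  have h1 : ∀ α₀ ∈ idx n m, ∀ s : ℝ, ∑ j ∈ Finset.range (m - (∑ i, eraseTwo J α₀ i) + 1),
      (s : ℂ) ^ j * ∫ t in (0 : ℝ)..1,
        c (fillTwo J (eraseTwo J α₀) (m - (∑ i, eraseTwo J α₀ i) - j) j) t *
          Complex.exp (Complex.I * s * t) = 0 := by
    intro α₀ hα₀ s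
    set Φ : (Fin (n + 1) → ℕ) → ℂ := fun α =>
      (s : ℂ) ^ α J * ∫ t in (0 : ℝ)..1, c α t * Complex.exp (Complex.I * s * t) with hΦ
    have h2 : ∀ u : Vec n, ∑ γ ∈ (idx n m).image (eraseTwo J),
        (∑ α ∈ idx n m with eraseTwo J α = γ, Φ α) * monom γ u = 0 := by
      intro u
      -- The vector with entries `1` at `0` and `s` at `J`, the remaining ones being free.
      have h3 := h (WithLp.toLp 2 fun i => if i = 0 then 1 else if i = J then s else u i) (by simp)
      have h4 : ∀ α, monom α (WithLp.toLp 2 fun i => if i = 0 then 1 else if i = J then s else u i) =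
          (s : ℂ) ^ α J * monom (eraseTwo J α) u := by
        intro α
        rw [monom_eq_eraseTwo hJ]
        simp only [if_true, if_neg hJ, Complex.ofReal_one, one_pow, one_mul]
        congr 1
        refine Finset.prod_congr rfl fun i _ => ?_
        unfold eraseTwo
        by_cases hi : i = 0
        · simp [hi]
        · by_cases hi' : i = J
          · simp [hi']
          · simp [hi, hi']
      simp only [h4, if_neg hJ, if_true, Finset.sum_mul] at h3
      rw [intervalIntegral.integral_finsetSum] at h3
      · have h5 : ∀ γ ∈ (idx n m).image (eraseTwo J),
            (∑ α ∈ idx n m with eraseTwo J α = γ, Φ α) * monom γ u =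
            ∑ α ∈ idx n m with eraseTwo J α = γ, Φ α * monom (eraseTwo J α) u := by
          intro γ _
          rw [Finset.sum_mul]
          refine Finset.sum_congr rfl fun α hα => ?_
          rw [(Finset.mem_filter.1 hα).2]
        rw [Finset.sum_congr rfl h5,
          Finset.sum_fiberwise_of_maps_to fun α hα => Finset.mem_image_of_mem _ hα, ← h3]
        refine Finset.sum_congr rfl fun α _ => ?_
        simp only [hΦ]
        rw [mul_right_comm, ← intervalIntegral.integral_const_mul]
        refine intervalIntegral.integral_congr fun t _ => ?_
        ring
      · intro α _
        have := (intervalIntegrable_mul_cexp (hc α) s).const_mul ((s : ℂ) ^ α J * monom (eraseTwo J α) u)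
        refine this.congr (fun t _ => ?_)
        ring
    have h6 := coeff_eq_zero_of_forall _ _ h2 (Finset.mem_image_of_mem (eraseTwo J) hα₀)
    rw [← h6]
    have hsum : ∀ α ∈ idx n m, α 0 + α J + ∑ i, eraseTwo J α i = m := by
      intro α hα
      rw [← sum_fillTwo hJ, fillTwo_eraseTwo]
      exact_mod_cast mem_idx.1 hα
    have hα₀' := hsum α₀ hα₀
    refine Finset.sum_nbij' (fun j => fillTwo J (eraseTwo J α₀) (m - (∑ i, eraseTwo J α₀ i) - j) j)
      (fun α => α J) ?_ ?_ ?_ ?_ ?_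
    · intro j hj
      rw [Finset.mem_range] at hj
      rw [Finset.mem_filter, eraseTwo_fillTwo, mem_idx, sum_fillTwo hJ]
      refine ⟨?_, rfl⟩
      have : m - (∑ i, eraseTwo J α₀ i) - j + j + ∑ i, eraseTwo J α₀ i = m := by omega
      exact_mod_cast this
    · intro α hα
      rw [Finset.mem_filter] at hα
      have := hsum α hα.1
      rw [Finset.mem_range, ← hα.2]
      omega
    · intro j _
      simp [fillTwo, hJ]
    · intro α hα
      rw [Finset.mem_filter] at hα
      have h7 := hsum α hα.1
      rw [← hα.2]
      have : m - (∑ i, eraseTwo J α i) - α J = α 0 := by omega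
      rw [this, fillTwo_eraseTwo]
    · intro j _
      simp only [hΦ]
      congr 1
      simp [fillTwo, hJ]
  have h2 : ∀ γ : Fin (n + 1) → ℕ, ∃ g g' : ℕ → ℝ → ℂ, (∀ j, IsPrimitive (g j) (g' j)) ∧
      (γ ∈ (idx n m).image (eraseTwo J) →
        (∀ j, m - (∑ i, γ i) ≤ j → g j = 0 ∧ g' j = 0) ∧
        (c (fillTwo J γ (m - (∑ i, γ i)) 0) =ᵐ[unitMeasure] g' 0) ∧
        ∀ j, j + 1 ≤ m - (∑ i, γ i) → c (fillTwo J γ (m - (∑ i, γ i) - (j + 1)) (j + 1)) =ᵐ[unitMeasure]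
          fun t => g' (j + 1) t + Complex.I * g j t) := by
    intro γ
    by_cases hγ : γ ∈ (idx n m).image (eraseTwo J)
    · obtain ⟨α₀, hα₀, rfl⟩ := Finset.mem_image.1 hγ
      obtain ⟨g, g', hg, hv, h0, hs⟩ := exists_primitives _ _ (fun j => hc _) (h1 α₀ hα₀)
      exact ⟨g, g', hg, fun _ => ⟨hv, h0, hs⟩⟩
    · exact ⟨0, 0, fun _ => IsPrimitive.zero, fun h => absurd h hγ⟩
  choose g g' hg hγ using h2
  refine ⟨fun β => g (eraseTwo J β) (β J), fun β => g' (eraseTwo J β) (β J), fun β => hg _ _, ?_⟩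
  have h3 : ∀ α ∈ idx n m, ∀ᵐ t ∂unitMeasure, c α t =
      (if 0 < α 0 then g' (eraseTwo J α) (α J) t else 0) +
        (if 0 < α J then Complex.I * g (eraseTwo J α) (α J - 1) t else 0) := by
    intro α hα
    obtain ⟨hv, h0, hs⟩ := hγ _ (Finset.mem_image_of_mem (eraseTwo J) hα)
    have hsum : α 0 + α J + ∑ i, eraseTwo J α i = m := by
      rw [← sum_fillTwo hJ, fillTwo_eraseTwo]
      exact_mod_cast mem_idx.1 hα
    have hfill := fillTwo_eraseTwo J α
    -- If `α 0 = 0`, then the power `α J` of `s` is beyond the range of the nonzero primitives.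
    have hg0 : ∀ t, (if 0 < α 0 then g' (eraseTwo J α) (α J) t else 0) = g' (eraseTwo J α) (α J) t := by
      intro t
      split_ifs with h
      · rfl
      · rw [(hv (α J) (by omega)).2]; rfl
    simp only [hg0]
    rcases hj : α J with _ | j
    · have : m - (∑ i, eraseTwo J α i) = α 0 := by omega
      rw [this] at h0
      rw [hj] at hfill
      rw [hfill] at h0
      filter_upwards [h0] with t ht
      simp [ht]
    · have h4 := hs j (by omega)
      have : m - (∑ i, eraseTwo J α i) - (j + 1) = α 0 := by omega
      rw [this] at h4
      rw [hj] at hfill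
      rw [hfill] at h4
      filter_upwards [h4] with t ht
      simp [ht]
  have h4 := (ae_ball_iff (Finset.countable_toSet (idx n m))).2 h3
  filter_upwards [h4] with t ht u
  -- The full derivative of `G` has only the components `0` and `J`.
  set D : Fin (n + 1) → (Fin (n + 1) → ℕ) → ℂ := fun j β =>
    if j = 0 then g' (eraseTwo J β) (β J) t else
      if j = J then Complex.I * g (eraseTwo J β) (β J) t else 0 with hD
  have h5 : ∀ α ∈ idx n m, c α t = symCoef D α := by
    intro α hα
    rw [ht α hα, symCoef, Fintype.sum_eq_add 0 J hJ.symm]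
    · simp only [hD, if_true, if_neg hJ, eraseTwo_low_zero, eraseTwo_low_self, low_apply,
        low_apply_of_ne α hJ]
    · rintro j ⟨hj0, hjJ⟩
      simp [hD, hj0, hjJ]
  rw [Finset.sum_congr rfl fun α hα => by rw [h5 α hα], sum_symCoef, Fintype.sum_eq_add 0 J hJ.symm]
  · simp only [hD, if_true, if_neg hJ]
    congr 1
    simp only [Finset.mul_sum]
    exact Finset.sum_congr rfl fun β _ => by ring
  · rintro j ⟨hj0, hjJ⟩
    simp [hD, hj0, hjJ]

/-- The solution `G` of `(u_0 ∂_t + i κ·w) G = q`, `u = (u_0, w)`, in `H¹₀(0,1)`, for `q` orthogonal to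
the exponentials `e^{-i κ·b t}` at `u = (1, b)`. -/
theorem exists_mode {κ : Fin n → ℝ} (hκ : κ ≠ 0) (m : ℕ) (q : ℝ → Vec n → ℂ)
    (hq : ∀ t, IsHomPoly m (q t)) (hq2 : ∀ u, MemLp (fun t => q t u) 2 unitMeasure)
    (h : ∀ b : EuclideanSpace ℝ (Fin n), ∫ t in (0 : ℝ)..1, q t (vec 1 b) *
      Complex.exp (Complex.I * (∑ i, κ i * b i : ℝ) * t) = 0) :
    ∃ G G' : (Fin (n + 1) → ℕ) → ℝ → ℂ, (∀ β, IsPrimitive (G β) (G' β)) ∧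
      ∀ᵐ t ∂unitMeasure, ∀ u : Vec n, q t u =
        u 0 * (∑ β ∈ idx n (m - 1), G' β t * monom β u) +
          Complex.I * (∑ i : Fin n, κ i * u i.succ : ℝ) *
            ∑ β ∈ idx n (m - 1), G β t * monom β u := by
  classical
  obtain ⟨j, hj⟩ := Function.ne_iff.1 hκ
  have hj' : κ j ≠ 0 := hj
  -- The change of variables replacing `w_j` by `κ·w`, and its inverse.
  let A : Vec n →ₗ[ℝ] Vec n :=
    { toFun := fun u => WithLp.toLp 2 (Function.update u j.succ (∑ i : Fin n, κ i * u i.succ))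
      map_add' := fun u v => by
        ext i
        rcases eq_or_ne i j.succ with rfl | hi
        · simp [mul_add, Finset.sum_add_distrib]
        · simp [hi]
      map_smul' := fun a u => by
        ext i
        rcases eq_or_ne i j.succ with rfl | hi
        · simp only [PiLp.smul_apply, smul_eq_mul, Function.update_self, RingHom.id_apply,
            Finset.mul_sum]
          exact Finset.sum_congr rfl fun i _ => by ring
        · simp [hi] }
  let B : Vec n →ₗ[ℝ] Vec n :=
    { toFun := fun u => WithLp.toLp 2 (Function.update u j.succ
        (u j.succ + (κ j)⁻¹ * (u j.succ - ∑ i : Fin n, κ i * u i.succ)))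
      map_add' := fun u v => by
        ext i
        rcases eq_or_ne i j.succ with rfl | hi
        · simp [mul_add, Finset.sum_add_distrib]; ring
        · simp [hi]
      map_smul' := fun a u => by
        ext i
        rcases eq_or_ne i j.succ with rfl | hi
        · simp only [PiLp.smul_apply, smul_eq_mul, Function.update_self, RingHom.id_apply]
          have : ∑ i : Fin n, κ i * (a * u i.succ) = a * ∑ i : Fin n, κ i * u i.succ := by
            rw [Finset.mul_sum]
            exact Finset.sum_congr rfl fun i _ => by ring
          rw [this]; ring
        · simp [hi] }
  have hA : ∀ u, A u j.succ = ∑ i : Fin n, κ i * u i.succ := fun u => by simp [A]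
  have hA' : ∀ u i, i ≠ j.succ → A u i = u i := fun u i hi => by simp [A, hi]
  have hB' : ∀ u i, i ≠ j.succ → B u i = u i := fun u i hi => by simp [B, hi]
  have hBs : ∀ u, ∑ i : Fin n, κ i * B u i.succ = u j.succ := by
    intro u
    rw [← Finset.add_sum_erase _ _ (Finset.mem_univ j)]
    have h1 : ∑ i ∈ Finset.univ.erase j, κ i * B u i.succ = ∑ i ∈ Finset.univ.erase j, κ i * u i.succ :=
      Finset.sum_congr rfl fun i hi => by
        rw [hB' u _ fun h => Finset.ne_of_mem_erase hi (Fin.succ_injective n h)]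
    have h2 : B u j.succ = u j.succ + (κ j)⁻¹ * (u j.succ - ∑ i : Fin n, κ i * u i.succ) := by simp [B]
    rw [h1, h2, ← Finset.add_sum_erase _ _ (Finset.mem_univ j)]
    field_simp
    ring
  have hBA : ∀ u, B (A u) = u := by
    intro u
    ext i
    rcases eq_or_ne i j.succ with rfl | hi
    · have h1 := hBs (A u)
      rw [hA, ← Finset.add_sum_erase _ _ (Finset.mem_univ j),
        ← Finset.add_sum_erase _ (fun i => κ i * u i.succ) (Finset.mem_univ j)] at h1
      have h2 : ∑ i ∈ Finset.univ.erase j, κ i * B (A u) i.succ =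
          ∑ i ∈ Finset.univ.erase j, κ i * u i.succ :=
        Finset.sum_congr rfl fun i hi => by
          have : i.succ ≠ j.succ := fun h => Finset.ne_of_mem_erase hi (Fin.succ_injective n h)
          rw [hB' _ _ this, hA' _ _ this]
      rw [h2] at h1
      exact mul_left_cancel₀ hj' (add_right_cancel h1)
    · rw [hB' _ _ hi, hA' _ _ hi]
  have hp : ∀ t, IsHomPoly m fun u => q t (B u) := fun t => (hq t).comp_linear B
  obtain ⟨G, G', hG, hGq⟩ := exists_mode_coord (Fin.succ_ne_zero j) m
    (fun α t => coef m α fun u => q t (B u)) (fun α => memLp_coef m (fun u => hq2 (B u)) α) (by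
      intro u hu
      rw [← h (tailCLM n (B u))]
      refine intervalIntegral.integral_congr fun t _ => ?_
      simp only
      rw [← (hp t).eq_sum u]
      have h1 : vec 1 (tailCLM n (B u)) = B u := by
        ext i
        refine Fin.cases ?_ (fun i => ?_) i
        · rw [hB' u 0 (Fin.succ_ne_zero j).symm, hu]; rfl
        · rfl
      rw [h1]
      simp only [tailCLM_apply, hBs])
  have hcomp : ∀ g : (Fin (n + 1) → ℕ) → ℂ, ∀ u, ∑ β ∈ idx n (m - 1), g β * monom β (A u) =
      ∑ γ ∈ idx n (m - 1), (∑ β ∈ idx n (m - 1), g β * coef (m - 1) γ fun u => monom β (A u)) *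
        monom γ u := by
    intro g u
    simp only [Finset.sum_mul]
    rw [Finset.sum_comm]
    refine Finset.sum_congr rfl fun β hβ => ?_
    have h1 : IsHomPoly (m - 1 : ℤ) fun u : Vec n => monom β u := by
      refine isHomPoly_iff.2 ⟨fun γ => if γ = β then 1 else 0, fun u => ?_⟩
      simp [hβ]
    rw [(h1.comp_linear A).eq_sum u, Finset.mul_sum]
    exact Finset.sum_congr rfl fun γ _ => by ring
  refine ⟨fun γ t => ∑ β ∈ idx n (m - 1), G β t * coef (m - 1) γ fun u => monom β (A u),
    fun γ t => ∑ β ∈ idx n (m - 1), G' β t * coef (m - 1) γ fun u => monom β (A u), fun γ => ?_, ?_⟩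
  · refine IsPrimitive.sum _ fun β _ => ?_
    simpa only [mul_comm] using (hG β).const_mul (coef (m - 1) γ fun u => monom β (A u))
  · filter_upwards [hGq] with t ht u
    rw [← hcomp, ← hcomp]
    have h1 := ht (A u)
    rw [← (hp t).eq_sum (A u), hBA, hA, hA' u 0 (Fin.succ_ne_zero j).symm] at h1
    exact h1

end

/-! ### Fourier series in `y` of functions in `L²(M)` -/

section

variable {n : ℕ}

theorem integral_cell_expo {k : Fin n → ℤ} (hk : k ≠ 0) : ∫ y in cell n, expo k y = 0 := by
  obtain ⟨i, hi⟩ := Function.ne_iff.1 hk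
  -- A translation by half a period changes the sign of the exponential.
  have h1 := setIntegral_cell_add (Q := expo k) (fun l y => expo_add_intVec k l y)
    (EuclideanSpace.single i (1 / (2 * (k i : ℝ))))
  have hi' : (k i : ℝ) ≠ 0 := by exact_mod_cast hi
  have h2 : expo k (EuclideanSpace.single i (1 / (2 * (k i : ℝ)))) = -1 := by
    have : ∑ j, (k j : ℝ) * EuclideanSpace.single i (1 / (2 * (k i : ℝ))) j = 1 / 2 := by
      simp
      field_simp
    rw [expo, this, ← Complex.exp_pi_mul_I]
    congr 1
    push_cast
    ring
  simp only [expo_add, h2] at h1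
  rw [integral_mul_const] at h1
  linear_combination (-1 / 2 : ℂ) * h1

theorem measurePreserving_apply_zero :
    MeasurePreserving (fun z : Vec n => z 0) (volume.restrict (box n)) unitMeasure := by
  have h := (measurePreserving_fst (μ := unitMeasure) (ν := volume.restrict (cell n))).comp
    (measurePreserving_vecEquiv_box (n := n)).symm
  convert! h using 1

/-- The function `q(x) e^{2πi k·y}`. -/
def modeFun (k : Fin n → ℤ) (q : ℝ → ℂ) (z : Vec n) : ℂ := q (z 0) * expo k (tailCLM n z)

theorem memLp_modeFun (k : Fin n → ℤ) {q : ℝ → ℂ} (hq : MemLp q 2 unitMeasure) :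
    MemLp (modeFun k q) 2 (volume.restrict (box n)) :=
  memLp_mul_of_norm_one (hq.comp_measurePreserving measurePreserving_apply_zero)
    ((continuous_expo k).comp (tailCLM n).continuous) fun _ => norm_expo _ _

/-- The Fourier coefficient `∫ P(x, y) e^{-2πi k·y} dy` as a function of `x`. -/
def hat (k : Fin n → ℤ) (P : Vec n → ℂ) (t : ℝ) : ℂ := ∫ y in cell n, P (vec t y) * expo (-k) y

theorem memLp_vec {P : Vec n → ℂ} (hP : MemLp P 2 (volume.restrict (box n))) :
    MemLp (fun q : ℝ × EuclideanSpace ℝ (Fin n) => P (vec q.1 q.2)) 2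
      (unitMeasure.prod (volume.restrict (cell n))) := by
  simpa only [Function.comp_def, vecEquiv_apply] using
    hP.comp_measurePreserving measurePreserving_vecEquiv_box

theorem ae_memLp_slice {P : Vec n → ℂ} (hP : MemLp P 2 (volume.restrict (box n))) :
    ∀ᵐ t ∂unitMeasure, MemLp (fun y => P (vec t y)) 2 (volume.restrict (cell n)) := by
  have h := memLp_vec hP
  filter_upwards [h.1.prodMk_left, ((memLp_two_iff_integrable_sq_norm h.1).1 h).prod_right_ae] with t h1 h2
  exact (memLp_two_iff_integrable_sq_norm h1).2 h2

theorem memLp_hat (k : Fin n → ℤ) {P : Vec n → ℂ} (hP : MemLp P 2 (volume.restrict (box n))) :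
    MemLp (hat k P) 2 unitMeasure := by
  have h1 : MemLp (fun q : ℝ × EuclideanSpace ℝ (Fin n) => P (vec q.1 q.2) * expo (-k) q.2) 2
      (unitMeasure.prod (volume.restrict (cell n))) :=
    memLp_mul_of_norm_one (memLp_vec hP) ((continuous_expo (-k)).comp continuous_snd)
      fun _ => norm_expo _ _
  have h2 : AEStronglyMeasurable (hat k P) unitMeasure := h1.1.integral_prod_right'
  rw [memLp_two_iff_integrable_sq_norm h2]
  have h3 := (memLp_two_iff_integrable_sq_norm h1.1).1 h1
  refine h3.integral_prod_left.mono' (h2.norm.pow 2) ?_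
  filter_upwards [h3.prod_right_ae, h1.1.prodMk_left] with t ht ht2
  rw [Real.norm_of_nonneg (by positivity)]
  exact norm_integral_sq_le ((memLp_two_iff_integrable_sq_norm ht2).2 ht)

/-- Integration against `r(x) e^{-2πi k·y}`. -/
theorem integral_mul_modeFun (k : Fin n → ℤ) {P : Vec n → ℂ} (hP : MemLp P 2 (volume.restrict (box n)))
    {r : ℝ → ℂ} (hr : MemLp r 2 unitMeasure) :
    ∫ z in box n, P z * modeFun (-k) r z = ∫ t in (0 : ℝ)..1, hat k P t * r t := by
  have h : IntegrableOn (fun z => P z * modeFun (-k) r z) (box n) :=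
    hP.integrable_mul (memLp_modeFun (-k) hr)
  rw [integral_box _ h]
  refine intervalIntegral.integral_congr fun t _ => ?_
  simp only [hat]
  rw [← integral_mul_const]
  refine integral_congr_ae (Filter.Eventually.of_forall fun y => ?_)
  simp only [modeFun, tailCLM_vec]
  have : vec t y 0 = t := rfl
  rw [this]
  ring

theorem hat_congr (k : Fin n → ℤ) {P Q : Vec n → ℂ} (h : P =ᵐ[volume.restrict (box n)] Q) :
    hat k P =ᵐ[unitMeasure] hat k Q := by
  have h1 := measurePreserving_vecEquiv_box.quasiMeasurePreserving.ae h
  filter_upwards [Measure.ae_ae_of_ae_prod h1] with t ht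
  refine integral_congr_ae ?_
  filter_upwards [ht] with y hy
  rw [vecEquiv_apply] at hy
  rw [hy]

/-- A function in `L²` of the box vanishes if its Fourier coefficients do. -/
theorem ae_eq_zero_of_hat {P : Vec n → ℂ} (hP : MemLp P 2 (volume.restrict (box n)))
    (h : ∀ k, hat k P =ᵐ[unitMeasure] 0) : P =ᵐ[volume.restrict (box n)] 0 := by
  have h1 : ∀ᵐ q ∂(unitMeasure.prod (volume.restrict (cell n))),
      P (vec q.1 q.2) = 0 := by
    have hm := (memLp_vec hP).1
    have h2 : ∀ᵐ t ∂unitMeasure, ∀ᵐ y ∂(volume.restrict (cell n)), P (vec t y) = 0 := by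
      filter_upwards [ae_memLp_slice hP, ae_all_iff.2 h] with t ht ht'
      refine ae_eq_zero_of_forall_expo ht fun k => ?_
      have := ht' (-k)
      simpa [hat] using this
    have h3 : ∫⁻ q, ‖P (vec q.1 q.2)‖ₑ ∂(unitMeasure.prod (volume.restrict (cell n))) = 0 := by
      rw [lintegral_prod _ hm.enorm, lintegral_eq_zero_iff' hm.enorm.lintegral_prod_right']
      filter_upwards [h2] with t ht
      refine (lintegral_congr_ae (g := 0) ?_).trans lintegral_zero
      filter_upwards [ht] with y hy
      simp [hy]
    rw [lintegral_eq_zero_iff' hm.enorm] at h3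
    filter_upwards [h3] with q hq
    simpa using hq
  rw [← measurePreserving_vecEquiv_box.map_eq]
  refine ((vecEquiv n).measurableEmbedding.ae_map_iff).2 ?_
  filter_upwards [h1] with q hq
  rwa [vecEquiv_apply]

/-- `L²(0,1)` -/
abbrev L2Unit : Type := Lp ℂ 2 unitMeasure

/-- `L²` of the box, i.e. `L²(M)`. -/
abbrev L2Box (n : ℕ) : Type := Lp ℂ 2 (volume.restrict (box n))

theorem Lp_inner_toLp {X : Type*} [MeasurableSpace X] {μ : Measure X} {f g : X → ℂ} (hf : MemLp f 2 μ)
    (hg : MemLp g 2 μ) : inner ℂ (hf.toLp f) (hg.toLp g) = ∫ x, starRingEnd ℂ (f x) * g x ∂μ := by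
  rw [L2.inner_def]
  refine integral_congr_ae ?_
  filter_upwards [hf.coeFn_toLp, hg.coeFn_toLp] with x h1 h2
  rw [h1, h2, RCLike.inner_apply']

/-- The isometric embedding of `L²(0,1)` into `L²(M)` as the functions `q(x) e^{2πi k·y}`. -/
def modeMap (k : Fin n → ℤ) : L2Unit →ₗᵢ[ℂ] L2Box n where
  toFun q := (memLp_modeFun k (Lp.memLp q)).toLp _
  map_add' q r := by
    rw [← MemLp.toLp_add]
    refine MemLp.toLp_congr _ _ ?_
    filter_upwards [measurePreserving_apply_zero.quasiMeasurePreserving.ae (Lp.coeFn_add q r)] with z hz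
    simp only [modeFun, hz, Pi.add_apply]
    ring
  map_smul' c q := by
    rw [RingHom.id_apply, ← MemLp.toLp_const_smul]
    refine MemLp.toLp_congr _ _ ?_
    filter_upwards [measurePreserving_apply_zero.quasiMeasurePreserving.ae (Lp.coeFn_smul c q)] with z hz
    simp only [modeFun, hz, Pi.smul_apply, smul_eq_mul]
    ring
  norm_map' q := by
    refine (sq_eq_sq₀ (norm_nonneg _) (norm_nonneg _)).1 ?_
    change ‖(memLp_modeFun k (Lp.memLp q)).toLp _‖ ^ 2 = _
    have h := integral_map (μ := volume.restrict (box n)) (φ := fun z : Vec n => z 0)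
      (f := fun t => ‖q t‖ ^ 2) measurePreserving_apply_zero.measurable.aemeasurable (by
        rw [measurePreserving_apply_zero.map_eq]
        exact (Lp.aestronglyMeasurable q).norm.pow 2)
    rw [measurePreserving_apply_zero.map_eq] at h
    rw [Lp_norm_sq_toLp, Lp_norm_sq, h]
    simp only [modeFun, norm_mul, norm_expo, mul_one]

theorem modeMap_coeFn (k : Fin n → ℤ) (q : L2Unit) :
    modeMap k q =ᵐ[volume.restrict (box n)] modeFun k q :=
  (memLp_modeFun k (Lp.memLp q)).coeFn_toLp

theorem conj_modeFun (k : Fin n → ℤ) (q : ℝ → ℂ) (z : Vec n) :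
    starRingEnd ℂ (modeFun k q z) = modeFun (-k) (fun t => starRingEnd ℂ (q t)) z := by
  rw [modeFun, modeFun, map_mul, expo_neg]

theorem Lp_inner_eq {X : Type*} [MeasurableSpace X] {μ : Measure X} (f g : Lp ℂ 2 μ) :
    inner ℂ f g = ∫ x, starRingEnd ℂ (f x) * g x ∂μ := by
  rw [L2.inner_def]
  exact integral_congr_ae (Filter.Eventually.of_forall fun x => RCLike.inner_apply' _ _)

/-- The Fourier coefficient of order `k`, as an element of `L²(0,1)`. -/
def hatLp (k : Fin n → ℤ) (P : L2Box n) : L2Unit := (memLp_hat k (Lp.memLp P)).toLp _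

theorem hatLp_coeFn (k : Fin n → ℤ) (P : L2Box n) : hatLp k P =ᵐ[unitMeasure] hat k P :=
  (memLp_hat k (Lp.memLp P)).coeFn_toLp

theorem inner_modeMap (k : Fin n → ℤ) (q : L2Unit) (P : L2Box n) :
    inner ℂ (modeMap k q) P = inner ℂ q (hatLp k P) := by
  rw [Lp_inner_eq, Lp_inner_eq]
  have h := integral_mul_modeFun k (Lp.memLp P) (Lp.memLp q).star
  have h1 : ∫ z in box n, starRingEnd ℂ (modeMap k q z) * P z =
      ∫ z in box n, P z * modeFun (-k) (star (q : ℝ → ℂ)) z := by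
    refine integral_congr_ae ?_
    filter_upwards [modeMap_coeFn k q] with z hz
    rw [hz, conj_modeFun, mul_comm]
    rfl
  rw [h1, h, intervalIntegral_eq_unit]
  refine integral_congr_ae ?_
  filter_upwards [hatLp_coeFn k P] with t ht
  rw [ht, mul_comm]
  rfl

/-- Orthogonality of the exponentials. -/
theorem hat_modeFun (k l : Fin n → ℤ) (q : ℝ → ℂ) (t : ℝ) :
    hat k (modeFun l q) t = if k = l then q t else 0 := by
  have h1 : hat k (modeFun l q) t = q t * ∫ y in cell n, expo (l - k) y := by
    rw [hat, ← integral_const_mul]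
    refine integral_congr_ae (Filter.Eventually.of_forall fun y => ?_)
    simp only [modeFun, tailCLM_vec]
    have : vec t y 0 = t := rfl
    rw [this, mul_assoc]
    congr 1
    rw [expo, expo, expo, ← Complex.exp_add]
    congr 1
    simp only [Pi.neg_apply, Pi.sub_apply]
    push_cast
    simp only [sub_mul, Finset.sum_sub_distrib, neg_mul, Finset.sum_neg_distrib]
    ring
  rw [h1]
  split_ifs with h
  · subst h
    simp [expo_zero_left]
  · rw [integral_cell_expo (sub_ne_zero.2 (Ne.symm h)), mul_zero]

theorem orthogonalFamily_modeMap : OrthogonalFamily ℂ (fun _ : Fin n → ℤ => L2Unit) modeMap := by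
  intro k l hkl q r
  rw [inner_modeMap]
  have : hatLp k (modeMap l r) = 0 := by
    refine Lp.eq_zero_iff_ae_eq_zero.2 ((hatLp_coeFn _ _).trans
      ((hat_congr k (modeMap_coeFn l r)).trans (Filter.Eventually.of_forall fun t => ?_)))
    rw [hat_modeFun, if_neg hkl]; rfl
  rw [this, inner_zero_right]

/-- The Fourier modes exhaust `L²(M)`: a function orthogonal to all of them has vanishing coefficients. -/
theorem isHilbertSum_modeMap : IsHilbertSum ℂ (fun _ : Fin n → ℤ => L2Unit) modeMap := by
  refine IsHilbertSum.mk orthogonalFamily_modeMap ?_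
  rw [top_le_iff, Submodule.topologicalClosure_eq_top_iff, Submodule.eq_bot_iff]
  intro P hP
  rw [Submodule.mem_orthogonal] at hP
  have h1 : ∀ k, hat k P =ᵐ[unitMeasure] 0 := by
    intro k
    have h2 := hP (modeMap k (hatLp k P))
      (Submodule.mem_iSup_of_mem k (LinearMap.mem_range_self _ _))
    rw [inner_modeMap, inner_self_eq_zero] at h2
    have h5 := hatLp_coeFn k P
    rw [h2] at h5
    exact h5.symm.trans (Lp.coeFn_zero _ _ _)
  exact Lp.eq_zero_iff_ae_eq_zero.2 (ae_eq_zero_of_hat (Lp.memLp P) h1)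

/-- Fourier series in `y`: the isometry of `L²(M)` with the square summable families in `L²(0,1)`. -/
def modeEquiv (n : ℕ) : L2Box n ≃ₗᵢ[ℂ] lp (fun _ : Fin n → ℤ => L2Unit) 2 :=
  isHilbertSum_modeMap.linearIsometryEquiv

theorem modeEquiv_symm_single [DecidableEq (Fin n → ℤ)] (k : Fin n → ℤ) (q : L2Unit) :
    (modeEquiv n).symm (lp.single 2 k q) = modeMap k q :=
  isHilbertSum_modeMap.linearIsometryEquiv_symm_apply_single q

theorem hasSum_modeEquiv_symm (w : lp (fun _ : Fin n → ℤ => L2Unit) 2) :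
    HasSum (fun k => modeMap k (w k)) ((modeEquiv n).symm w) :=
  isHilbertSum_modeMap.hasSum_linearIsometryEquiv_symm w

theorem modeEquiv_apply (P : L2Box n) (k : Fin n → ℤ) : modeEquiv n P k = hatLp k P := by
  classical
  refine ext_inner_left ℂ fun q => ?_
  refine (lp.inner_single_left (𝕜 := ℂ) (G := fun _ : Fin n → ℤ => L2Unit) k q
    (modeEquiv n P)).symm.trans ?_
  rw [← (modeEquiv n).symm.inner_map_map, (modeEquiv n).symm_apply_apply, modeEquiv_symm_single,
    inner_modeMap]

end

/-! ### Green's formula for one Fourier mode -/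

section

variable {n : ℕ}

theorem lp_hasSum_norm_sq {ι E : Type*} [NormedAddCommGroup E] (w : lp (fun _ : ι => E) 2) :
    HasSum (fun k => ‖w k‖ ^ 2) (‖w‖ ^ 2) := by
  have h := lp.hasSum_norm (p := 2) (by norm_num) w
  simpa using h

theorem memℓp_two_of_summable {ι E : Type*} [NormedAddCommGroup E] {w : ι → E}
    (h : Summable fun k => ‖w k‖ ^ 2) : Memℓp w 2 :=
  memℓp_gen (by simpa using h)

theorem exists_isCompact_cell (n : ℕ) : ∃ K : Set (EuclideanSpace ℝ (Fin n)), IsCompact K ∧ cell n ⊆ K := by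
  refine ⟨Metric.closedBall 0 (√n), isCompact_closedBall _ _, fun y hy => ?_⟩
  rw [mem_closedBall_zero_iff, EuclideanSpace.norm_eq]
  refine Real.sqrt_le_sqrt ?_
  have h1 : ∀ i, ‖y i‖ ^ 2 ≤ 1 := fun i => by
    rw [Real.norm_eq_abs, abs_of_nonneg (hy i).1]
    exact pow_le_one₀ (hy i).1 (hy i).2.le
  calc ∑ i, ‖y i‖ ^ 2 ≤ ∑ _i : Fin n, (1 : ℝ) := Finset.sum_le_sum fun i _ => h1 i
    _ = n := by simp

theorem memLp_box_of_continuous {ψ : Vec n → ℂ} (hψ : Continuous ψ) :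
    MemLp ψ 2 (volume.restrict (box n)) := by
  obtain ⟨C, hC⟩ := (isCompact_closedBall (0 : Vec n) (√(n + 1))).exists_bound_of_continuousOn
    hψ.continuousOn
  refine MemLp.of_bound hψ.aestronglyMeasurable C ?_
  filter_upwards [ae_restrict_mem measurableSet_box] with z hz
  exact hC z (mem_closedBall_zero_iff.2 (norm_le_of_mem_box hz))

theorem integrable_cell_of_continuous {ψ : EuclideanSpace ℝ (Fin n) → ℂ} (hψ : Continuous ψ) :
    IntegrableOn ψ (cell n) := by
  obtain ⟨K, hK, hcK⟩ := exists_isCompact_cell n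
  exact (hψ.continuousOn.integrableOn_compact hK).mono_set hcK

/-- The integral of a derivative of a periodic function over the cell vanishes. -/
theorem integral_cell_fderiv {Ψ : EuclideanSpace ℝ (Fin n) → ℂ} (hΨ : ContDiff ℝ 1 Ψ)
    (hper : IsPeriodic Ψ) (v : EuclideanSpace ℝ (Fin n)) : ∫ y in cell n, fderiv ℝ Ψ y v = 0 := by
  have hc : Continuous fun y => fderiv ℝ Ψ y v :=
    (hΨ.continuous_fderiv one_ne_zero).clm_apply continuous_const
  have hper' : IsPeriodic fun y => fderiv ℝ Ψ y v := by
    intro l y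
    have : Ψ = fun y => Ψ (y + intVec l) := funext fun y => (hper l y).symm
    simp only
    conv_rhs => rw [this]
    rw [fderiv_comp_add_right]
  -- Averaging the fundamental theorem of calculus along `v` over the cell: both sides are invariant
  -- under translations.
  have h1 : ∀ y, Ψ (y + v) - Ψ y = ∫ s in (0 : ℝ)..1, fderiv ℝ Ψ (y + s • v) v := by
    intro y
    have h2 : ∀ s : ℝ, HasDerivAt (fun s : ℝ => Ψ (y + s • v)) (fderiv ℝ Ψ (y + s • v) v) s := by
      intro s
      have h3 : HasDerivAt (fun s : ℝ => y + s • v) v s := by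
        simpa using ((hasDerivAt_id s).smul_const v).const_add y
      exact ((hΨ.differentiable one_ne_zero).differentiableAt.hasFDerivAt).comp_hasDerivAt s h3
    rw [intervalIntegral.integral_eq_sub_of_hasDerivAt (fun s _ => h2 s)
      ((hc.comp (by fun_prop)).intervalIntegrable _ _)]
    simp
  have h4 : ∫ y in cell n, (Ψ (y + v) - Ψ y) = 0 := by
    have hi : IntegrableOn (fun y => Ψ (y + v)) (cell n) :=
      integrable_cell_of_continuous (hΨ.continuous.comp (continuous_id.add continuous_const))
    rw [integral_sub hi
      (integrable_cell_of_continuous hΨ.continuous), setIntegral_cell_add hper, sub_self]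
  simp only [h1] at h4
  have hint : Integrable (fun q : EuclideanSpace ℝ (Fin n) × ℝ => fderiv ℝ Ψ (q.1 + q.2 • v) v)
      ((volume.restrict (cell n)).prod unitMeasure) := by
    obtain ⟨K, hK, hcK⟩ := exists_isCompact_cell n
    rw [Measure.prod_restrict]
    refine IntegrableOn.mono_set (t := K ×ˢ Icc (0 : ℝ) 1) ?_ (prod_mono hcK Subset.rfl)
    exact (hc.comp (by fun_prop : Continuous fun q : EuclideanSpace ℝ (Fin n) × ℝ =>
      q.1 + q.2 • v)).continuousOn.integrableOn_compact (hK.prod isCompact_Icc)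
  simp only [intervalIntegral_eq_unit] at h4
  rw [integral_integral_swap hint] at h4
  simp only [setIntegral_cell_add hper'] at h4
  simpa using h4

/-- The `j`-th partial derivative of `g(x) e^{2πi k·y}` is the function with `x`-part `modeDeriv k g g' j`. -/
def modeDeriv (k : Fin n → ℤ) (g g' : ℝ → ℂ) (j : Fin (n + 1)) : ℝ → ℂ :=
  Fin.cases g' (fun i t => 2 * Real.pi * Complex.I * k i * g t) j

theorem IsPrimitive.memLp_modeDeriv {g g' : ℝ → ℂ} (h : IsPrimitive g g') (k : Fin n → ℤ)
    (j : Fin (n + 1)) : MemLp (modeDeriv k g g' j) 2 unitMeasure := by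
  refine Fin.cases h.memLp (fun i => ?_) j
  exact h.memLp_self.const_mul _

theorem vec_add_single (t : ℝ) (y : EuclideanSpace ℝ (Fin n)) (i : Fin n) :
    vec t (y + EuclideanSpace.single i (1 : ℝ)) = vec t y + EuclideanSpace.single i.succ (1 : ℝ) := by
  ext j
  refine Fin.cases ?_ (fun j => ?_) j
  · simp [vec]
  · simp [vec]

theorem isPeriodic_of_single {X : Type*} {Q : EuclideanSpace ℝ (Fin n) → X}
    (h : ∀ y i, Q (y + EuclideanSpace.single i (1 : ℝ)) = Q y) : IsPeriodic Q := by
  have h1 : ∀ i (a : ℤ) y, Q (y + a • EuclideanSpace.single i (1 : ℝ)) = Q y := by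
    intro i a
    induction a using Int.induction_on with
    | zero => intro y; simp
    | succ a ih => intro y; rw [add_smul, one_smul, ← add_assoc, h, ih]
    | pred a ih =>
      intro y
      rw [← h, sub_smul, one_smul, add_assoc, sub_add_cancel, ih]
  have h2 : ∀ (s : Finset (Fin n)) (l : Fin n → ℤ) y,
      Q (y + ∑ i ∈ s, l i • EuclideanSpace.single i (1 : ℝ)) = Q y := by
    intro s l
    induction s using Finset.induction_on with
    | empty => intro y; simp
    | insert i s hi ih => intro y; rw [Finset.sum_insert hi, ← add_assoc, ih, h1]
  intro l y
  rw [← h2 Finset.univ l y]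
  congr 2
  ext j
  simp [intVec_apply, Pi.single_apply]

theorem vec_add_smul_zero (t : ℝ) (y : EuclideanSpace ℝ (Fin n)) :
    vec t y = vec 0 y + t • EuclideanSpace.single 0 (1 : ℝ) := by
  ext j
  refine Fin.cases ?_ (fun j => ?_) j
  · simp [vec]
  · simp [vec]

/-- The linear embedding `y ↦ (0, y)`. -/
def inclCLM (n : ℕ) : EuclideanSpace ℝ (Fin n) →L[ℝ] Vec n :=
  LinearMap.toContinuousLinearMap
    { toFun := fun y => vec 0 y
      map_add' := fun _ _ => by
        ext j; refine Fin.cases ?_ (fun j => ?_) j <;> simp [vec]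
      map_smul' := fun _ _ => by
        ext j; refine Fin.cases ?_ (fun j => ?_) j <;> simp [vec] }

theorem inclCLM_apply (y : EuclideanSpace ℝ (Fin n)) : inclCLM n y = vec 0 y := rfl

theorem inclCLM_single (i : Fin n) :
    inclCLM n (EuclideanSpace.single i (1 : ℝ)) = EuclideanSpace.single i.succ (1 : ℝ) := by
  rw [inclCLM_apply]
  have := vec_add_single (n := n) 0 0 i
  rw [zero_add] at this
  rw [this]
  have h : vec (0 : ℝ) (0 : EuclideanSpace ℝ (Fin n)) = 0 := by
    ext j; refine Fin.cases ?_ (fun j => ?_) j <;> simp [vec]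
  rw [h, zero_add]

theorem hasFDerivAt_expo (k : Fin n → ℤ) (y : EuclideanSpace ℝ (Fin n)) :
    HasFDerivAt (expo k) ((2 * Real.pi * Complex.I * expo k y) • Complex.ofRealCLM.comp (dotCLM k)) y := by
  have h := hasFDerivAt_cexp (dotCLM k) y
  rw [← expo_eq] at h
  rw [show expo k y = Complex.exp (2 * Real.pi * Complex.I * (dotCLM k y : ℝ)) from
    congrFun (expo_eq k) y]
  exact h

theorem contDiff_expo (k : Fin n → ℤ) : ContDiff ℝ ∞ (expo k) := by
  rw [expo_eq]; exact contDiff_cexp _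

/-- Green's formula for `g(x) e^{2πi k·y}` with `g ∈ H¹₀(0,1)`. -/
theorem IsPrimitive.green {g g' : ℝ → ℂ} (h : IsPrimitive g g') (k : Fin n → ℤ) {φ : Vec n → ℂ}
    (hφ : ContDiff ℝ ∞ φ)
    (hper : ∀ (z : Vec n) (i : Fin n), φ (z + EuclideanSpace.single i.succ (1 : ℝ)) = φ z)
    (j : Fin (n + 1)) :
    ∫ z in box n, modeFun k g z * fderiv ℝ φ z (EuclideanSpace.single j (1 : ℝ)) =
      - ∫ z in box n, modeFun k (modeDeriv k g g' j) z * φ z := by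
  have hd : Differentiable ℝ φ := hφ.differentiable (by simp)
  have hcd : Continuous fun z => fderiv ℝ φ z (EuclideanSpace.single j (1 : ℝ)) :=
    (hφ.continuous_fderiv (by simp)).clm_apply continuous_const
  have hint1 : IntegrableOn (fun z => modeFun k g z * fderiv ℝ φ z (EuclideanSpace.single j (1 : ℝ)))
      (box n) := (memLp_modeFun k h.memLp_self).integrable_mul (memLp_box_of_continuous hcd)
  have hint2 : IntegrableOn (fun z => modeFun k (modeDeriv k g g' j) z * φ z) (box n) :=
    (memLp_modeFun k (h.memLp_modeDeriv k j)).integrable_mul (memLp_box_of_continuous hφ.continuous)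
  have hvec : Continuous fun q : ℝ × EuclideanSpace ℝ (Fin n) => vec q.1 q.2 := by
    have : (fun q : ℝ × EuclideanSpace ℝ (Fin n) => vec q.1 q.2) =
        fun q => inclCLM n q.2 + q.1 • EuclideanSpace.single 0 (1 : ℝ) :=
      funext fun q => vec_add_smul_zero _ _
    rw [this]
    fun_prop
  refine Fin.cases (motive := fun j => IntegrableOn (fun z => modeFun k g z *
      fderiv ℝ φ z (EuclideanSpace.single j (1 : ℝ))) (box n) →
      IntegrableOn (fun z => modeFun k (modeDeriv k g g' j) z * φ z) (box n) →
      (Continuous fun z => fderiv ℝ φ z (EuclideanSpace.single j (1 : ℝ))) →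
      ∫ z in box n, modeFun k g z * fderiv ℝ φ z (EuclideanSpace.single j (1 : ℝ)) =
      - ∫ z in box n, modeFun k (modeDeriv k g g' j) z * φ z) ?_ (fun i => ?_) j hint1 hint2 hcd
  · intro hint1 hint2 hcd
    have hswap : ∀ P : Vec n → ℂ, IntegrableOn P (box n) → ∫ z in box n, P z =
        ∫ y in cell n, ∫ t in (0 : ℝ)..1, P (vec t y) := by
      intro P hP
      have h1 := (measurePreserving_vecEquiv_box.integrable_comp_emb
        (vecEquiv n).measurableEmbedding).2 hP
      have h2 := integral_prod_symm _ h1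
      rw [← measurePreserving_vecEquiv_box.integral_comp']
      refine h2.trans ?_
      simp only [intervalIntegral_eq_unit, Function.comp_apply, vecEquiv_apply]
    rw [hswap _ hint1, hswap _ hint2, ← integral_neg]
    refine integral_congr_ae (Filter.Eventually.of_forall fun y => ?_)
    have h3 : ∀ t, HasDerivAt (fun t : ℝ => φ (vec t y))
        (fderiv ℝ φ (vec t y) (EuclideanSpace.single 0 (1 : ℝ))) t := by
      intro t
      have h4 : HasDerivAt (fun t : ℝ => vec t y) (EuclideanSpace.single 0 (1 : ℝ)) t := by
        rw [show (fun t : ℝ => vec t y) = fun t => vec 0 y + t • EuclideanSpace.single 0 (1 : ℝ) from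
          funext fun t => vec_add_smul_zero t y]
        simpa using ((hasDerivAt_id t).smul_const (EuclideanSpace.single 0 (1 : ℝ))).const_add (vec 0 y)
      exact (hd _).hasFDerivAt.comp_hasDerivAt t h4
    have h5 := h.integral_mul_deriv h3 (hcd.comp (hvec.comp (by fun_prop : Continuous fun t : ℝ => (t, y))))
    have h6 : ∀ (a : ℝ → ℂ) (b : Vec n → ℂ), ∫ t in (0 : ℝ)..1, modeFun k a (vec t y) * b (vec t y) =
        expo k y * ∫ t in (0 : ℝ)..1, a t * b (vec t y) := by
      intro a b
      rw [← intervalIntegral.integral_const_mul]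
      refine intervalIntegral.integral_congr fun t _ => ?_
      simp only [modeFun, tailCLM_vec]
      have : vec t y 0 = t := rfl
      rw [this]; ring
    simp only
    refine (h6 g fun z => fderiv ℝ φ z (EuclideanSpace.single 0 (1 : ℝ))).trans ?_
    rw [h6 _ φ, h5, mul_neg]
    rfl
  · intro hint1 hint2 hcd
    rw [integral_box _ hint1, integral_box _ hint2, ← intervalIntegral.integral_neg]
    refine intervalIntegral.integral_congr fun t _ => ?_
    have h0 : ∀ y : EuclideanSpace ℝ (Fin n), vec t y 0 = t := fun _ => rfl
    simp only [modeFun, tailCLM_vec, h0]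
    have hφt : ∀ y, HasFDerivAt (fun y => φ (vec t y)) ((fderiv ℝ φ (vec t y)).comp (inclCLM n)) y := by
      intro y
      have h4 : HasFDerivAt (fun y => vec t y) (inclCLM n) y := by
        have : (fun y => vec t y) = fun y => inclCLM n y + t • EuclideanSpace.single 0 (1 : ℝ) :=
          funext fun y => vec_add_smul_zero _ _
        rw [this]
        exact (inclCLM n).hasFDerivAt.add_const _
      exact (hd _).hasFDerivAt.comp y h4
    have hcφ : ContDiff ℝ 1 fun y => φ (vec t y) := by
      have : (fun y => φ (vec t y)) = φ ∘ fun y => inclCLM n y + t • EuclideanSpace.single 0 (1 : ℝ) :=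
        funext fun y => congrArg φ (vec_add_smul_zero t y)
      rw [this]
      exact (hφ.of_le (by simp)).comp ((inclCLM n).contDiff.add contDiff_const)
    have hperΨ : IsPeriodic fun y => expo k y * φ (vec t y) := by
      have h1 : IsPeriodic fun y => φ (vec t y) := isPeriodic_of_single fun y i => by
        rw [vec_add_single, hper]
      intro l y
      have := h1 l y
      simp only at this
      simp only [expo_add_intVec, this]
    have hcΨ : ContDiff ℝ 1 fun y => expo k y * φ (vec t y) :=
      ((contDiff_expo k).of_le (by simp)).mul hcφ
    have h7 := integral_cell_fderiv hcΨ hperΨ (EuclideanSpace.single i 1)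
    have h8 : ∀ y, fderiv ℝ (fun y => expo k y * φ (vec t y)) y (EuclideanSpace.single i (1 : ℝ)) =
        expo k y * fderiv ℝ φ (vec t y) (EuclideanSpace.single i.succ (1 : ℝ)) +
          2 * Real.pi * Complex.I * k i * (expo k y * φ (vec t y)) := by
      intro y
      have h10 : HasFDerivAt (fun y => expo k y * φ (vec t y)) _ y := (hasFDerivAt_expo k y).mul (hφt y)
      rw [h10.fderiv]
      simp only [add_apply, smul_apply, ContinuousLinearMap.comp_apply,
        inclCLM_single, smul_eq_mul, Complex.ofRealCLM_apply, dotCLM_apply]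
      have : ∑ j, (k j : ℝ) * EuclideanSpace.single i (1 : ℝ) j = k i := by simp
      rw [this]
      push_cast
      ring
    simp only [h8] at h7
    rw [integral_add, integral_const_mul] at h7
    · simp only [modeDeriv, Fin.cases_succ]
      have h9 : ∀ (a : ℂ) (b : EuclideanSpace ℝ (Fin n) → ℂ), ∫ y in cell n, a * expo k y * b y =
          a * ∫ y in cell n, expo k y * b y := by
        intro a b
        rw [← integral_const_mul]
        simp only [mul_assoc]
      rw [h9, h9]
      linear_combination g t * h7
    · refine integrable_cell_of_continuous ((continuous_expo k).mul (hcd.comp ?_))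
      exact hvec.comp (by fun_prop : Continuous fun y : EuclideanSpace ℝ (Fin n) => (t, y))
    · exact (integrable_cell_of_continuous ((continuous_expo k).mul hcφ.continuous)).const_mul _

end

/-! ### Weak derivatives by Fourier modes -/

section

variable {n : ℕ}

/-- The integral against a continuous function, as a continuous linear functional on `L²(M)`. -/
theorem exists_integral_functional {ψ : Vec n → ℂ} (hψ : MemLp ψ 2 (volume.restrict (box n))) :
    ∃ L : L2Box n →L[ℂ] ℂ, ∀ P : L2Box n, L P = ∫ z in box n, P z * ψ z := by
  refine ⟨innerSL ℂ (hψ.star.toLp (star ψ)), fun P => ?_⟩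
  rw [innerSL_apply_apply, Lp_inner_eq]
  refine integral_congr_ae ?_
  filter_upwards [hψ.star.coeFn_toLp] with z hz
  rw [hz, Pi.star_apply, Complex.star_def, Complex.conj_conj, mul_comm]

/-- Green's formula on `M` for an `L²` function `G` with the weak derivatives `D 0, …, D n`. -/
def Green (G : Vec n → ℂ) (D : Fin (n + 1) → Vec n → ℂ) : Prop :=
  ∀ φ : Vec n → ℂ, ContDiff ℝ ∞ φ →
    (∀ (z : Vec n) (i : Fin n), φ (z + EuclideanSpace.single i.succ (1 : ℝ)) = φ z) →
    ∀ j : Fin (n + 1), ∫ z in box n, G z * fderiv ℝ φ z (EuclideanSpace.single j (1 : ℝ)) =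
      - ∫ z in box n, D j z * φ z

theorem Green.congr {G G₁ : Vec n → ℂ} {D D₁ : Fin (n + 1) → Vec n → ℂ} (h : Green G D)
    (hG : G₁ =ᵐ[volume.restrict (box n)] G) (hD : ∀ j, D₁ j =ᵐ[volume.restrict (box n)] D j) :
    Green G₁ D₁ := by
  intro φ hφ hper j
  have h1 := h φ hφ hper j
  have h2 : ∫ z in box n, G₁ z * fderiv ℝ φ z (EuclideanSpace.single j (1 : ℝ)) =
      ∫ z in box n, G z * fderiv ℝ φ z (EuclideanSpace.single j (1 : ℝ)) := by
    refine integral_congr_ae ?_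
    filter_upwards [hG] with z hz
    rw [hz]
  have h3 : ∫ z in box n, D₁ j z * φ z = ∫ z in box n, D j z * φ z := by
    refine integral_congr_ae ?_
    filter_upwards [hD j] with z hz
    rw [hz]
  rw [h2, h3, h1]

/-- Green's formula may be checked on each Fourier mode. -/
theorem green_of_modes (w : lp (fun _ : Fin n → ℤ => L2Unit) 2)
    (v : Fin (n + 1) → lp (fun _ : Fin n → ℤ => L2Unit) 2)
    (h : ∀ k, Green (modeMap k (w k)) fun j => modeMap k (v j k)) :
    Green ((modeEquiv n).symm w) fun j => (modeEquiv n).symm (v j) := by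
  intro φ hφ hper j
  have hcd : Continuous fun z => fderiv ℝ φ z (EuclideanSpace.single j (1 : ℝ)) :=
    (hφ.continuous_fderiv (by simp)).clm_apply continuous_const
  obtain ⟨L, hL⟩ := exists_integral_functional (memLp_box_of_continuous hcd)
  obtain ⟨L', hL'⟩ := exists_integral_functional (memLp_box_of_continuous hφ.continuous)
  rw [← hL, ← hL']
  have h1 := (hasSum_modeEquiv_symm w).mapL L
  have h2 := ((hasSum_modeEquiv_symm (v j)).mapL L').neg
  have h3 : (fun k => L (modeMap k (w k))) = fun k => -L' (modeMap k (v j k)) := by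
    funext k
    rw [hL, hL']
    exact h k φ hφ hper j
  rw [h3] at h1
  exact h1.unique h2

/-- The partial derivatives of one mode, for several functions with `H¹₀` primitives, have the symmetry
`⟨∂_j G, ∂_l H⟩ = ⟨∂_l G, ∂_j H⟩`. -/
theorem IsPrimitive.inner_modeDeriv_comm {g g' r r' : ℝ → ℂ} (hg : IsPrimitive g g')
    (hr : IsPrimitive r r') (k : Fin n → ℤ) (j l : Fin (n + 1)) :
    ∫ t, starRingEnd ℂ (modeDeriv k g g' j t) * modeDeriv k r r' l t ∂unitMeasure =
      ∫ t, starRingEnd ℂ (modeDeriv k g g' l t) * modeDeriv k r r' j t ∂unitMeasure := by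
  -- For `j = 0`, integration by parts changes the sign, and so does the conjugation of `2πi k_i`.
  have key : ∀ {g g' r r' : ℝ → ℂ} (hg : IsPrimitive g g') (hr : IsPrimitive r r') (i : Fin n),
      ∫ t, starRingEnd ℂ (modeDeriv k g g' 0 t) * modeDeriv k r r' i.succ t ∂unitMeasure =
      ∫ t, starRingEnd ℂ (modeDeriv k g g' i.succ t) * modeDeriv k r r' 0 t ∂unitMeasure := by
    intro g g' r r' hg hr i
    have h := hg.conj.integral_mul_primitive hr
    rw [intervalIntegral_eq_unit, intervalIntegral_eq_unit] at h
    simp only [modeDeriv, Fin.cases_zero, Fin.cases_succ]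
    calc ∫ t, starRingEnd ℂ (g' t) * (2 * Real.pi * Complex.I * k i * r t) ∂unitMeasure
        = 2 * Real.pi * Complex.I * k i * ∫ t, starRingEnd ℂ (g' t) * r t ∂unitMeasure := by
          rw [← integral_const_mul]
          refine integral_congr_ae (Filter.Eventually.of_forall fun t => ?_)
          simp only; ring
      _ = -(2 * Real.pi * Complex.I * k i) * ∫ t, starRingEnd ℂ (g t) * r' t ∂unitMeasure := by
          rw [h]; ring
      _ = _ := by
          rw [← integral_const_mul]
          refine integral_congr_ae (Filter.Eventually.of_forall fun t => ?_)
          simp only [map_mul, Complex.conj_I, Complex.conj_ofReal, map_intCast, map_ofNat]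
          ring
  refine Fin.cases (Fin.cases rfl (fun i => key hg hr i) l) (fun i => ?_) j
  refine Fin.cases (key hg hr i).symm (fun i' => ?_) l
  refine integral_congr_ae (Filter.Eventually.of_forall fun t => ?_)
  simp only [modeDeriv, Fin.cases_succ, map_mul, Complex.conj_I, Complex.conj_ofReal, map_intCast,
    map_ofNat]
  ring

/-- `g β(x) e^{2πi k·y}`, for each multi-index `β`, has vanishing boundary trace and partial derivatives
`D j β(x) e^{2πi k·y}`; the symmetry and the Poincaré inequality recorded here follow from this. -/
structure IsModeSolution (k : Fin n → ℤ) (g : (Fin (n + 1) → ℕ) → L2Unit)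
    (D : Fin (n + 1) → (Fin (n + 1) → ℕ) → L2Unit) : Prop where
  green : ∀ β, Green (modeMap k (g β)) fun j => modeMap k (D j β)
  inner_comm : ∀ j l β β', inner ℂ (D j β) (D l β') = inner ℂ (D l β) (D j β')
  norm_le : ∀ β, ‖g β‖ ^ 2 ≤ ∑ j, ‖D j β‖ ^ 2

theorem isModeSolution_zero (k : Fin n → ℤ) :
    IsModeSolution k (fun _ => 0) fun _ _ => 0 where
  green β := by
    intro φ _ _ j
    have h : (modeMap k (0 : L2Unit) : Vec n → ℂ) =ᵐ[volume.restrict (box n)] 0 := by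
      rw [map_zero]; exact Lp.coeFn_zero _ _ _
    have h1 : ∀ ψ : Vec n → ℂ, ∫ z in box n, modeMap k (0 : L2Unit) z * ψ z = 0 := by
      intro ψ
      rw [← integral_zero (Vec n) ℂ (μ := volume.restrict (box n))]
      refine integral_congr_ae ?_
      filter_upwards [h] with z hz
      rw [hz, Pi.zero_apply, zero_mul]
    simp only [h1, neg_zero]
  inner_comm _ _ _ _ := rfl
  norm_le _ := by simp

theorem isModeSolution_of_isPrimitive {k : Fin n → ℤ} (hk : k ≠ 0)
    {G G' : (Fin (n + 1) → ℕ) → ℝ → ℂ} (h : ∀ β, IsPrimitive (G β) (G' β)) :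
    IsModeSolution k (fun β => (h β).memLp_self.toLp _)
      fun j β => ((h β).memLp_modeDeriv k j).toLp _ where
  green β := by
    have hm : ∀ {q : ℝ → ℂ} (hq : MemLp q 2 unitMeasure),
        modeMap k (hq.toLp q) =ᵐ[volume.restrict (box n)] modeFun k q := by
      intro q hq
      refine (modeMap_coeFn k _).trans ?_
      filter_upwards [measurePreserving_apply_zero.quasiMeasurePreserving.ae hq.coeFn_toLp] with z hz
      rw [modeFun, modeFun, hz]
    have h1 : Green (modeFun k (G β)) fun j => modeFun k (modeDeriv k (G β) (G' β) j) :=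
      fun φ hφ hper j => (h β).green k hφ hper j
    exact h1.congr (hm _) fun j => hm _
  inner_comm j l β β' := by
    rw [Lp_inner_toLp, Lp_inner_toLp]
    exact (h β).inner_modeDeriv_comm (h β') k j l
  norm_le β := by
    obtain ⟨i, hi⟩ : ∃ i, k i ≠ 0 := by
      by_contra! hc
      exact hk (funext hc)
    refine le_trans ?_ (Finset.single_le_sum (f := fun j => ‖((h β).memLp_modeDeriv k j).toLp _‖ ^ 2)
      (fun j _ => sq_nonneg _) (Finset.mem_univ i.succ))
    have h1 : ((h β).memLp_modeDeriv k i.succ).toLp _ =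
        (2 * Real.pi * Complex.I * k i : ℂ) • (h β).memLp_self.toLp _ := by
      rw [← MemLp.toLp_const_smul]
      rfl
    simp only [h1, norm_smul]
    refine pow_le_pow_left₀ (norm_nonneg _) (le_mul_of_one_le_left (norm_nonneg _) ?_) 2
    simp only [norm_mul, Complex.norm_I, mul_one, Complex.norm_real, Complex.norm_intCast,
      Complex.norm_ofNat, Real.norm_eq_abs, abs_of_pos Real.pi_pos]
    have h2 : (1 : ℝ) ≤ |(k i : ℝ)| := by exact_mod_cast Int.one_le_abs hi
    nlinarith [Real.pi_gt_three]

end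

/-! ### The decomposition of one Fourier mode -/

section

variable {n : ℕ}

theorem rayExpo_neg_eq (k : Fin n → ℤ) (b : EuclideanSpace ℝ (Fin n)) (z : Vec n) :
    rayExpo (-k) b z = modeFun (-k) (fun t => Complex.exp (Complex.I *
      (∑ i, (2 * Real.pi * k i) * b i : ℝ) * t)) z := by
  rw [rayExpo, modeFun, sub_eq_add_neg, expo_add, mul_comm]
  congr 1
  rw [expo]
  congr 1
  have : ∑ i, ((-k) i : ℝ) * (-(z 0 • b)) i = z 0 * ∑ i, (k i : ℝ) * b i := by
    rw [Finset.mul_sum]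
    refine Finset.sum_congr rfl fun i _ => ?_
    simp; ring
  rw [this]
  have h2 : ∑ i, (2 * Real.pi * k i) * b i = 2 * Real.pi * ∑ i, (k i : ℝ) * b i := by
    rw [Finset.mul_sum]
    exact Finset.sum_congr rfl fun i _ => by ring
  rw [h2]
  push_cast
  ring

/-- The vanishing of the ray transform on the `k`-th Fourier mode. -/
theorem integral_hatLp_eq_zero {m : ℕ} {F : (Fin (n + 1) → ℕ) → L2Box n}
    {b : EuclideanSpace ℝ (Fin n)} {k : Fin n → ℤ}
    (hW : ∫ z in box n, (∑ α ∈ idx n m, F α z * monom α (vec 1 b)) * rayExpo (-k) b z = 0) :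
    ∫ t in (0 : ℝ)..1, (∑ α ∈ idx n m, hatLp k (F α) t * monom α (vec 1 b)) *
      Complex.exp (Complex.I * (∑ i, (2 * Real.pi * k i) * b i : ℝ) * t) = 0 := by
  set r : ℝ → ℂ := fun t => Complex.exp (Complex.I * (∑ i, (2 * Real.pi * k i) * b i : ℝ) * t) with hr
  have hr2 : MemLp r 2 unitMeasure := by
    refine MemLp.of_bound (by fun_prop : Continuous r).aestronglyMeasurable 1
      (Filter.Eventually.of_forall fun t => ?_)
    rw [hr, Complex.norm_exp]
    simp
  have h1 : ∀ α, ∫ z in box n, F α z * rayExpo (-k) b z =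
      ∫ t in (0 : ℝ)..1, hatLp k (F α) t * r t := by
    intro α
    simp only [rayExpo_neg_eq]
    rw [integral_mul_modeFun k (Lp.memLp _) hr2, intervalIntegral_eq_unit, intervalIntegral_eq_unit]
    refine integral_congr_ae ?_
    filter_upwards [hatLp_coeFn k (F α)] with t ht
    rw [ht]
  have h2 : ∀ α, IntegrableOn (fun z => F α z * rayExpo (-k) b z) (box n) := by
    intro α
    simp only [rayExpo_neg_eq]
    exact (Lp.memLp (F α)).integrable_mul (memLp_modeFun (-k) hr2)
  have h3 : ∀ α, Integrable (fun t => hatLp k (F α) t * r t) unitMeasure := fun α =>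
    (Lp.memLp _).integrable_mul hr2
  have h4 : ∫ z in box n, (∑ α ∈ idx n m, F α z * monom α (vec 1 b)) * rayExpo (-k) b z =
      ∑ α ∈ idx n m, monom α (vec 1 b) * ∫ z in box n, F α z * rayExpo (-k) b z := by
    simp only [← integral_const_mul]
    rw [← integral_finsetSum _ fun α _ => (h2 α).const_mul _]
    refine integral_congr_ae (Filter.Eventually.of_forall fun z => ?_)
    simp only
    rw [Finset.sum_mul]
    exact Finset.sum_congr rfl fun α _ => by ring
  rw [h4] at hW
  rw [← hW, intervalIntegral_eq_unit]
  simp only [h1, intervalIntegral_eq_unit, ← integral_const_mul]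
  rw [← integral_finsetSum _ fun α _ => (h3 α).const_mul _]
  refine integral_congr_ae (Filter.Eventually.of_forall fun z => ?_)
  simp only
  rw [Finset.sum_mul]
  exact Finset.sum_congr rfl fun α _ => by ring

theorem symCoef_coeFn {X : Type*} [MeasurableSpace X] {μ : Measure X}
    (D : Fin (n + 1) → (Fin (n + 1) → ℕ) → Lp ℂ 2 μ) (α : Fin (n + 1) → ℕ) :
    ((symCoef D α : Lp ℂ 2 μ) : X → ℂ) =ᵐ[μ] fun x => symCoef (fun j β => D j β x) α := by
  have h := Lp.coeFn_finsetSum (p := 2) (μ := μ) Finset.univ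
    (fun j => if 0 < α j then D j (low α j) else 0)
  have h0 := Lp.coeFn_zero ℂ 2 μ
  refine h.trans ?_
  filter_upwards [h0] with x hx
  rw [Finset.sum_apply, symCoef]
  refine Finset.sum_congr rfl fun j _ => ?_
  split_ifs
  · rfl
  · exact hx

theorem toLp_eq_zero_of_eq {X : Type*} [MeasurableSpace X] {μ : Measure X} {f : X → ℂ}
    (hf : MemLp f 2 μ) (h : f = 0) : hf.toLp f = 0 := by
  subst h
  exact MemLp.toLp_zero hf

theorem modeDeriv_zero (k : Fin n → ℤ) (j : Fin (n + 1)) : modeDeriv k 0 0 j = 0 := by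
  refine Fin.cases rfl (fun i => ?_) j
  funext t
  simp [modeDeriv]

/-- If the ray transform of the tensor field with coefficients `F` vanishes, then its Fourier mode of
order `k ≠ 0` is the symmetrized derivative of a tensor field with vanishing boundary trace. -/
theorem exists_modeSolution (m : ℕ) (F : (Fin (n + 1) → ℕ) → L2Box n)
    (hW : ∀ b k, ∫ z in box n, (∑ α ∈ idx n m, F α z * monom α (vec 1 b)) * rayExpo k b z = 0)
    {k : Fin n → ℤ} (hk : k ≠ 0) :
    ∃ g D, IsModeSolution k g D ∧ (∀ β ∉ idx n (m - 1), g β = 0 ∧ ∀ j, D j β = 0) ∧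
      ∀ α ∈ idx n m, hatLp k (F α) = symCoef D α := by
  classical
  have hκ : (fun i => 2 * Real.pi * (k i : ℝ)) ≠ 0 := by
    obtain ⟨i, hi⟩ := Function.ne_iff.1 hk
    refine fun h => hi ?_
    have := congrFun h i
    simpa [Real.pi_ne_zero] using this
  obtain ⟨G, G', hG, hq⟩ := exists_mode hκ m
    (fun t u => ∑ α ∈ idx n m, hatLp k (F α) t * monom α u)
    (fun t => isHomPoly_sum_monom _ _)
    (fun u => memLp_finsetSum _ fun α _ => (Lp.memLp (hatLp k (F α))).mul_const _)
    (fun b => integral_hatLp_eq_zero (hW b (-k)))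
  -- Coefficients outside the relevant range of multi-indices are set to zero.
  set G₁ : (Fin (n + 1) → ℕ) → ℝ → ℂ := fun β => if β ∈ idx n (m - 1) then G β else 0 with hG₁
  set G₁' : (Fin (n + 1) → ℕ) → ℝ → ℂ := fun β => if β ∈ idx n (m - 1) then G' β else 0 with hG₁'
  have hp : ∀ β, IsPrimitive (G₁ β) (G₁' β) := by
    intro β
    simp only [hG₁, hG₁']
    split_ifs
    · exact hG β
    · exact IsPrimitive.zero
  refine ⟨_, _, isModeSolution_of_isPrimitive hk hp, fun β hβ => ?_, fun α hα => ?_⟩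
  · have h1 : G₁ β = 0 := if_neg hβ
    have h2 : G₁' β = 0 := if_neg hβ
    exact ⟨toLp_eq_zero_of_eq _ h1, fun j => toLp_eq_zero_of_eq _ (by rw [h1, h2, modeDeriv_zero])⟩
  · refine Lp.ext ?_
    refine Filter.EventuallyEq.trans ?_ (symCoef_coeFn _ α).symm
    have hcoe : ∀ᵐ t ∂unitMeasure, ∀ j, ∀ β ∈ idx n (m - 1),
        ((hp β).memLp_modeDeriv k j).toLp _ t = modeDeriv k (G β) (G' β) j t := by
      rw [ae_all_iff]
      intro j
      rw [Finset.eventually_all]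
      intro β hβ
      filter_upwards [((hp β).memLp_modeDeriv k j).coeFn_toLp] with t ht
      rw [ht]
      simp only [hG₁, hG₁', if_pos hβ]
    filter_upwards [hq, hcoe] with t ht hc
    refine eq_of_sub_eq_zero (coeff_eq_zero_of_forall (idx n m)
      (fun α => hatLp k (F α) t - symCoef (fun j β => ((hp β).memLp_modeDeriv k j).toLp _ t) α)
      (fun u => ?_) hα)
    simp only [sub_mul, Finset.sum_sub_distrib]
    rw [ht u, sum_symCoef, sub_eq_zero, Fin.sum_univ_succ]
    congr 1
    · congr 1
      refine Finset.sum_congr rfl fun β hβ => ?_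
      rw [hc 0 β hβ]
      rfl
    · have h5 : ∀ i : Fin n, ∑ β ∈ idx n (m - 1), ((hp β).memLp_modeDeriv k i.succ).toLp _ t * monom β u =
          2 * Real.pi * Complex.I * k i * ∑ β ∈ idx n (m - 1), G β t * monom β u := by
        intro i
        rw [Finset.mul_sum]
        refine Finset.sum_congr rfl fun β hβ => ?_
        rw [hc i.succ β hβ]
        simp only [modeDeriv, Fin.cases_succ]
        ring
      simp only [h5]
      generalize ∑ β ∈ idx n (m - 1), G β t * monom β u = S
      push_cast
      rw [Finset.mul_sum, Finset.sum_mul]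
      refine Finset.sum_congr rfl fun i _ => ?_
      ring

end

/-! ### The decomposition on the slab -/

section

variable {n : ℕ}

/-- A homogeneous polynomial that vanishes on `{1} × ℝⁿ` vanishes. -/
theorem IsHomPoly.eq_zero_of_vec_one {k : ℤ} {F : Vec n → ℂ} (hF : IsHomPoly k F)
    (h : ∀ b : EuclideanSpace ℝ (Fin n), F (vec 1 b) = 0) (u : Vec n) : F u = 0 := by
  have h1 : ∀ u : Vec n, u 0 ≠ 0 → F u = 0 := by
    intro u hu
    have h2 : u = u 0 • vec 1 ((u 0)⁻¹ • tailCLM n u) := by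
      ext j
      refine Fin.cases ?_ (fun j => ?_) j
      · simp [vec]
      · simp [vec, tailCLM_apply, hu]
    rw [h2, hF.smul_apply, h, mul_zero]
  have hc : Continuous fun s : ℝ => F (u + s • EuclideanSpace.single 0 (1 : ℝ)) :=
    hF.continuous.comp (by fun_prop)
  -- By homogeneity the polynomial vanishes where `u 0 ≠ 0`; the rest follows by continuity.
  have hd : Dense {s : ℝ | s ≠ -u 0} := dense_compl_singleton _
  have h3 := hc.ext_on hd continuous_const (g := fun _ => (0 : ℂ)) fun s hs => by
    refine h1 _ ?_
    simp only [PiLp.add_apply, PiLp.smul_apply, PiLp.single_apply, if_true, smul_eq_mul, mul_one]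
    intro h0
    exact hs (by linarith)
  simpa using congrFun h3 0

theorem multiFact_nonneg (α : Fin (n + 1) → ℕ) : 0 ≤ multiFact α := zero_le_one.trans (one_le_multiFact α)

theorem norm_sq_le_multiFact_mul {E : Type*} [NormedAddCommGroup E] (α : Fin (n + 1) → ℕ) (x : E) :
    ‖x‖ ^ 2 ≤ multiFact α * ‖x‖ ^ 2 :=
  le_mul_of_one_le_left (sq_nonneg _) (one_le_multiFact α)

theorem symCoef_map {M M' : Type*} [AddCommMonoid M] [AddCommMonoid M'] (φ : M →+ M')
    (D : Fin (n + 1) → (Fin (n + 1) → ℕ) → M) (α : Fin (n + 1) → ℕ) :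
    φ (symCoef D α) = symCoef (fun j β => φ (D j β)) α := by
  rw [symCoef, symCoef, map_sum]
  refine Finset.sum_congr rfl fun j _ => ?_
  split_ifs
  · rfl
  · exact map_zero φ

theorem hasSum_norm_hatLp (P : L2Box n) : HasSum (fun k => ‖hatLp k P‖ ^ 2) (‖P‖ ^ 2) := by
  have h := lp_hasSum_norm_sq (modeEquiv n P)
  simp only [modeEquiv_apply, LinearIsometryEquiv.norm_map] at h
  exact h

/-- **The decomposition on the slab `M`**, for coefficients `F α`, `|α| = m`, of a tensor field whose
ray transform vanishes. -/
theorem exists_slab_decomposition (m : ℕ) (F : (Fin (n + 1) → ℕ) → L2Box n)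
    (hW : ∀ b k, ∫ z in box n, (∑ α ∈ idx n m, F α z * monom α (vec 1 b)) * rayExpo k b z = 0) :
    ∃ (G : (Fin (n + 1) → ℕ) → L2Box n) (D : Fin (n + 1) → (Fin (n + 1) → ℕ) → L2Box n),
      (∀ u, ∫ t in (0 : ℝ)..1, ∑ α ∈ idx n m, hatLp 0 (F α) t * monom α u = 0) ∧
      (∀ β, Green (G β) fun j => D j β) ∧
      (∀ α ∈ idx n m, F α = modeMap 0 (hatLp 0 (F α)) + symCoef D α) ∧
      ∑ β ∈ idx n (m - 1), (‖G β‖ ^ 2 + ∑ j, ‖D j β‖ ^ 2) ≤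
        2 * ∑ α ∈ idx n m, multiFact α * ‖F α‖ ^ 2 := by
  classical
  have hex : ∀ k : Fin n → ℤ, ∃ (g : (Fin (n + 1) → ℕ) → L2Unit)
      (D : Fin (n + 1) → (Fin (n + 1) → ℕ) → L2Unit), IsModeSolution k g D ∧
      (∀ β ∉ idx n (m - 1), g β = 0 ∧ ∀ j, D j β = 0) ∧
      ∀ α ∈ idx n m, (if k = 0 then 0 else hatLp k (F α)) = symCoef D α := by
    intro k
    by_cases hk : k = 0
    · refine ⟨_, _, isModeSolution_zero k, fun β _ => ⟨rfl, fun _ => rfl⟩, fun α _ => ?_⟩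
      rw [if_pos hk, symCoef]
      simp
    · obtain ⟨g, D, h1, h2, h3⟩ := exists_modeSolution m F hW hk
      exact ⟨g, D, h1, h2, fun α hα => by rw [if_neg hk, h3 α hα]⟩
  choose g D hsol hzero hsym using hex
  -- The bound for one mode is summable in the mode.
  set S : (Fin n → ℤ) → ℝ := fun k => ∑ α ∈ idx n m, multiFact α * ‖hatLp k (F α)‖ ^ 2 with hS
  have hSsum : HasSum S (∑ α ∈ idx n m, multiFact α * ‖F α‖ ^ 2) :=
    hasSum_sum fun α _ => (hasSum_norm_hatLp (F α)).mul_left _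
  have hkorn : ∀ k, ∑ j, ∑ β ∈ idx n (m - 1), ‖D k j β‖ ^ 2 ≤ S k := by
    intro k
    -- Korn's inequality has a constant that does not depend on the mode.
    calc ∑ j, ∑ β ∈ idx n (m - 1), ‖D k j β‖ ^ 2
        ≤ ∑ j, ∑ β ∈ idx n (m - 1), multiFact β * ‖D k j β‖ ^ 2 :=
          Finset.sum_le_sum fun j _ => Finset.sum_le_sum fun β _ => norm_sq_le_multiFact_mul _ _
      _ ≤ ∑ α ∈ idx n m, multiFact α * ‖symCoef (D k) α‖ ^ 2 := korn (D k) (hsol k).inner_comm m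
      _ ≤ S k := by
          refine Finset.sum_le_sum fun α hα => mul_le_mul_of_nonneg_left ?_ (multiFact_nonneg α)
          rw [← hsym k α hα]
          split_ifs
          · rw [norm_zero, zero_pow two_ne_zero]; exact sq_nonneg _
          · exact le_rfl
  have hD : ∀ k j β, ‖D k j β‖ ^ 2 ≤ S k := by
    intro k j β
    by_cases hβ : β ∈ idx n (m - 1)
    · exact ((Finset.single_le_sum (f := fun β => ‖D k j β‖ ^ 2) (fun _ _ => sq_nonneg _) hβ).trans
        (Finset.single_le_sum (f := fun j => ∑ β ∈ idx n (m - 1), ‖D k j β‖ ^ 2)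
          (fun _ _ => Finset.sum_nonneg fun _ _ => sq_nonneg _) (Finset.mem_univ j))).trans (hkorn k)
    · rw [((hzero k β hβ).2 j), norm_zero]
      simp only [ne_eq, OfNat.ofNat_ne_zero, not_false_eq_true, zero_pow]
      exact Finset.sum_nonneg fun α _ => mul_nonneg (multiFact_nonneg α) (sq_nonneg _)
  have hDsum : ∀ j β, Summable fun k => ‖D k j β‖ ^ 2 := fun j β =>
    Summable.of_nonneg_of_le (fun _ => sq_nonneg _) (fun k => hD k j β) hSsum.summable
  have hgsum : ∀ β, Summable fun k => ‖g k β‖ ^ 2 := fun β =>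
    Summable.of_nonneg_of_le (fun _ => sq_nonneg _) (fun k => (hsol k).norm_le β)
      (summable_sum fun j _ => hDsum j β)
  let w : (Fin (n + 1) → ℕ) → lp (fun _ : Fin n → ℤ => L2Unit) 2 := fun β =>
    ⟨fun k => g k β, memℓp_two_of_summable (hgsum β)⟩
  let v : Fin (n + 1) → (Fin (n + 1) → ℕ) → lp (fun _ : Fin n → ℤ => L2Unit) 2 := fun j β =>
    ⟨fun k => D k j β, memℓp_two_of_summable (hDsum j β)⟩
  refine ⟨fun β => (modeEquiv n).symm (w β), fun j β => (modeEquiv n).symm (v j β), ?_, ?_, ?_, ?_⟩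
  · -- The zeroth mode has mean zero on the rays `u = (1, b)`, hence for all `u`.
    have hint : ∀ α, Integrable (hatLp 0 (F α)) unitMeasure := fun α =>
      (Lp.memLp _).integrable one_le_two
    have h1 : ∀ u : Vec n, ∫ t in (0 : ℝ)..1, ∑ α ∈ idx n m, hatLp 0 (F α) t * monom α u =
        ∑ α ∈ idx n m, (∫ t in (0 : ℝ)..1, hatLp 0 (F α) t) * monom α u := by
      intro u
      simp only [intervalIntegral_eq_unit]
      rw [integral_finsetSum _ fun α _ => (hint α).mul_const _]
      exact Finset.sum_congr rfl fun α _ => integral_mul_const _ _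
    simp only [h1]
    refine (isHomPoly_sum_monom (m : ℤ) fun α => ∫ t in (0 : ℝ)..1, hatLp 0 (F α) t).eq_zero_of_vec_one
      fun b => ?_
    have h2 := integral_hatLp_eq_zero (hW b (-0))
    rw [← h1, ← h2]
    simp
  · exact fun β => green_of_modes (w β) (fun j => v j β) fun k => (hsol k).green β
  · intro α hα
    refine (modeEquiv n).injective ?_
    rw [map_add, ← modeEquiv_symm_single, LinearIsometryEquiv.apply_symm_apply]
    have h1 : modeEquiv n (symCoef (fun j β => (modeEquiv n).symm (v j β)) α) = symCoef v α := by
      have := symCoef_map ((modeEquiv n : L2Box n →ₗ[ℂ] lp (fun _ : Fin n → ℤ => L2Unit) 2).toAddMonoidHom)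
        (fun j β => (modeEquiv n).symm (v j β)) α
      refine this.trans ?_
      congr 1
      funext j β
      exact (modeEquiv n).apply_symm_apply _
    rw [h1]
    ext1
    funext k
    have h2 : (symCoef v α : lp (fun _ : Fin n → ℤ => L2Unit) 2) k = symCoef (D k) α := by
      rw [symCoef, symCoef, lp.coeFn_sum, Finset.sum_apply]
      refine Finset.sum_congr rfl fun j _ => ?_
      split_ifs <;> rfl
    rw [lp.coeFn_add, Pi.add_apply, h2, ← hsym k α hα, modeEquiv_apply]
    by_cases hk : k = 0
    · subst hk
      rw [if_pos rfl, add_zero, lp.single_apply_self]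
    · rw [if_neg hk, lp.single_apply_ne _ _ _ hk, zero_add]
  · have hv : ∀ j β, HasSum (fun k => ‖D k j β‖ ^ 2) (‖(modeEquiv n).symm (v j β)‖ ^ 2) := by
      intro j β
      rw [LinearIsometryEquiv.norm_map]
      exact lp_hasSum_norm_sq (v j β)
    have hw : ∀ β, HasSum (fun k => ‖g k β‖ ^ 2) (‖(modeEquiv n).symm (w β)‖ ^ 2) := by
      intro β
      rw [LinearIsometryEquiv.norm_map]
      exact lp_hasSum_norm_sq (w β)
    have hall := hasSum_sum (s := idx n (m - 1)) fun β _ =>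
      (hw β).add (hasSum_sum (s := Finset.univ) fun j _ => hv j β)
    refine hasSum_le (fun k => ?_) hall (hSsum.mul_left 2)
    calc ∑ β ∈ idx n (m - 1), (‖g k β‖ ^ 2 + ∑ j, ‖D k j β‖ ^ 2)
        ≤ ∑ β ∈ idx n (m - 1), (2 * ∑ j, ‖D k j β‖ ^ 2) :=
          Finset.sum_le_sum fun β _ => by linarith [(hsol k).norm_le β]
      _ = 2 * ∑ j, ∑ β ∈ idx n (m - 1), ‖D k j β‖ ^ 2 := by
          rw [← Finset.mul_sum, Finset.sum_comm]
      _ ≤ 2 * S k := by linarith [hkorn k]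

end

/-! ### Averages over the deck transformations -/

section

variable {n : ℕ}

theorem measurePreserving_affineIsometryEquiv (γ : Vec n ≃ᵃⁱ[ℝ] Vec n) :
    MeasurePreserving γ volume volume := by
  have h : (γ : Vec n → Vec n) = (fun z => γ 0 + z) ∘ γ.linearIsometryEquiv := by
    funext z
    rw [apply_eq_add γ z 0, sub_zero]; rfl
  rw [h]
  exact (measurePreserving_add_left volume (γ 0)).comp γ.linearIsometryEquiv.measurePreserving

theorem measurableSet_preimage_box (γ : Vec n ≃ᵃⁱ[ℝ] Vec n) : MeasurableSet {z | γ z ∈ box n} :=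
  γ.continuous.measurable measurableSet_box

open Classical in
/-- Transport of mass by a Euclidean isometry between the parts of the box that it exchanges. -/
theorem integral_box_transport {E : Type*} [NormedAddCommGroup E] [NormedSpace ℝ E]
    (γ : Vec n ≃ᵃⁱ[ℝ] Vec n) (f : Vec n → E) :
    ∫ z in box n, (if γ z ∈ box n then f z else 0) =
      ∫ w in box n, if γ⁻¹ w ∈ box n then f (γ⁻¹ w) else 0 := by
  rw [← integral_indicator measurableSet_box, ← integral_indicator measurableSet_box]
  conv_rhs =>
    rw [← (measurePreserving_affineIsometryEquiv γ).integral_comp γ.toHomeomorph.measurableEmbedding]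
  refine integral_congr_ae (Filter.Eventually.of_forall fun z => ?_)
  have h : γ⁻¹ (γ z) = z := γ.symm_apply_apply z
  simp only [indicator, h]
  split_ifs <;> rfl

theorem linearIsometryEquiv_inv (γ : Vec n ≃ᵃⁱ[ℝ] Vec n) :
    γ⁻¹.linearIsometryEquiv = γ.linearIsometryEquiv.symm := rfl

theorem linearIsometryEquiv_mul_apply (γ δ : Vec n ≃ᵃⁱ[ℝ] Vec n) (v : Vec n) :
    (γ * δ).linearIsometryEquiv v = γ.linearIsometryEquiv (δ.linearIsometryEquiv v) := rfl

theorem linearIsometryEquiv_transl_mul (l : Fin n → ℤ) (γ : Vec n ≃ᵃⁱ[ℝ] Vec n) :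
    (transl l * γ).linearIsometryEquiv = γ.linearIsometryEquiv := by
  ext1 v
  rw [linearIsometryEquiv_mul_apply, transl_linear]

theorem transl_add (l l' : Fin n → ℤ) : transl (l + l') = transl l * transl l' := by
  ext1 z
  ext i
  change transl (l + l') z i = transl l (transl l' z) i
  refine Fin.cases ?_ (fun i => ?_) i
  · simp only [transl_zero]
  · simp only [transl_succ, Pi.add_apply]; push_cast; ring

theorem mul_transl_linear (l : Fin n → ℤ) (γ : Vec n ≃ᵃⁱ[ℝ] Vec n) :
    (γ * transl l).linearIsometryEquiv = γ.linearIsometryEquiv := by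
  ext1 v
  rw [linearIsometryEquiv_mul_apply, transl_linear]

variable {N : Type u} [TopologicalSpace N] {p : Slab n → N}

omit [TopologicalSpace N] in
/-- The deck transformations with `γ a` in the box represent the deck transformations modulo
translations, whichever the point `a`. -/
theorem finsum_deck_eq {M : Type*} [AddCommMonoid M] {f : (Vec n ≃ᵃⁱ[ℝ] Vec n) → M}
    (hf : ∀ l, ∀ γ ∈ deck p, f (transl l * γ) = f γ) {a b : Vec n} (ha : a ∈ strip n) (hb : b ∈ strip n) :
    ∑ᶠ γ ∈ {γ | γ ∈ deck p ∧ γ a ∈ box n}, f γ = ∑ᶠ γ ∈ {γ | γ ∈ deck p ∧ γ b ∈ box n}, f γ := by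
  -- A class modulo translations has exactly one member that takes a given point to the box.
  have hcancel : ∀ {γ δ : Vec n ≃ᵃⁱ[ℝ] Vec n} {l : Fin n → ℤ} {c : Vec n}, γ c ∈ box n → δ c ∈ box n →
      δ = transl l * γ → δ = γ := by
    intro γ δ l c hγ hδ h
    rw [h] at hδ
    rw [h, eq_zero_of_transl_mem_box hγ hδ, transl_zero_eq, one_mul]
  refine finsum_mem_eq_of_bijOn (fun γ => transl (floorNeg (γ b)) * γ) ⟨?_, ?_, ?_⟩ ?_
  · exact fun γ hγ => ⟨mul_mem (transl_mem_deck _) hγ.1,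
      transl_floorNeg_mem_box (mem_strip_of_mem_deck hγ.1 hb)⟩
  · intro γ hγ δ hδ h
    refine hcancel (l := -floorNeg (γ b) + floorNeg (δ b)) hδ.2 hγ.2 ?_
    have h' : transl (floorNeg (γ b)) * γ = transl (floorNeg (δ b)) * δ := h
    rw [transl_add, mul_assoc, ← h', ← mul_assoc, ← transl_add, neg_add_cancel, transl_zero_eq, one_mul]
  · intro δ hδ
    refine ⟨transl (floorNeg (δ a)) * δ, ⟨mul_mem (transl_mem_deck _) hδ.1,
      transl_floorNeg_mem_box (mem_strip_of_mem_deck hδ.1 ha)⟩, ?_⟩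
    simp only
    rw [← mul_assoc, ← transl_add]
    refine hcancel (c := b) hδ.2 ?_ rfl
    rw [transl_add, mul_assoc]
    exact transl_floorNeg_mem_box (mem_strip_of_mem_deck (mul_mem (transl_mem_deck _) hδ.1) hb)
  · exact fun γ hγ => (hf _ γ hγ.1).symm

theorem zero_mem_box : (0 : Vec n) ∈ box n := ⟨by simp, fun i => by simp⟩

open Classical in
/-- Representatives of the deck transformations modulo translations. -/
def deckReps (p : Slab n → N) : Finset (Vec n ≃ᵃⁱ[ℝ] Vec n) := (deckFinset p).filter fun γ => γ 0 ∈ box n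

open Classical in
/-- The average `(1/d) ∑ F_γ(γ z)` over the deck transformations modulo translations, where `F_γ` only
depends on the linear part of `γ`. -/
def deckAvg (p : Slab n → N) (F : (Vec n ≃ₗᵢ[ℝ] Vec n) → Vec n → ℂ) (z : Vec n) : ℂ :=
  ((sheets p : ℂ))⁻¹ *
    ∑ γ ∈ deckFinset p, if γ z ∈ box n then F γ.linearIsometryEquiv (γ z) else 0

open Classical in
theorem memLp_comp_affineIsometryEquiv {f : Vec n → ℂ} (hf : MemLp f 2 (volume.restrict (box n)))
    (γ : Vec n ≃ᵃⁱ[ℝ] Vec n) :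
    MemLp (fun z => if γ z ∈ box n then f (γ z) else 0) 2 (volume.restrict (box n)) := by
  have h1 : MemLp ((box n).indicator f) 2 volume := (memLp_indicator_iff_restrict measurableSet_box).2 hf
  refine ((h1.comp_measurePreserving (measurePreserving_affineIsometryEquiv γ)).restrict (box n)).ae_eq
    (Filter.Eventually.of_forall fun z => ?_)
  simp only [Function.comp_apply, indicator]

omit [TopologicalSpace N] in
theorem memLp_deckAvg {F : (Vec n ≃ₗᵢ[ℝ] Vec n) → Vec n → ℂ}
    (hF : ∀ R, MemLp (F R) 2 (volume.restrict (box n))) :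
    MemLp (deckAvg p F) 2 (volume.restrict (box n)) := by
  classical
  have h := (memLp_finsetSum (deckFinset p) fun γ _ =>
    memLp_comp_affineIsometryEquiv (hF γ.linearIsometryEquiv) γ).const_mul ((sheets p : ℂ))⁻¹
  exact h

namespace IsTwistedSlab

variable [ChartedSpace (EuclideanHalfSpace (n + 1)) N]
  [IsManifold (𝓡∂ (n + 1)) ∞ N] {g : SmoothMetric n N} (H : IsTwistedSlab g p) [T2Space N]
include H

theorem mem_deck_of_mem_deckReps {γ : Vec n ≃ᵃⁱ[ℝ] Vec n} (hγ : γ ∈ deckReps p) : γ ∈ deck p := by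
  classical
  unfold deckReps at hγ
  exact (H.mem_deckFinset.1 (Finset.mem_filter.1 hγ).1).1

open Classical in
theorem sum_deckFinset_eq {M : Type*} [AddCommMonoid M] {f : (Vec n ≃ᵃⁱ[ℝ] Vec n) → M}
    (hf : ∀ l, ∀ γ ∈ deck p, f (transl l * γ) = f γ) {z : Vec n} (hz : z ∈ box n) :
    ∑ γ ∈ deckFinset p, (if γ z ∈ box n then f γ else 0) = ∑ γ ∈ deckReps p, f γ := by
  rw [← Finset.sum_filter, deckReps, ← finsum_mem_coe_finset, ← finsum_mem_coe_finset,
    H.coe_filter_deckFinset hz, H.coe_filter_deckFinset zero_mem_box]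
  exact finsum_deck_eq hf hz.1 zero_mem_box.1

open Classical in
/-- A sum over the deck transformations modulo translations with a given linear part is periodic. -/
theorem sum_deckReps_add_intVec {M : Type*} [AddCommMonoid M] {φ : Vec n → M}
    (hφ : ∀ l z, φ (transl l z) = φ z) (S : Vec n ≃ₗᵢ[ℝ] Vec n) (l : Fin n → ℤ) (z : Vec n) :
    ∑ δ ∈ (deckReps p).filter (fun δ => δ.linearIsometryEquiv = S), φ (δ (transl l z)) =
      ∑ δ ∈ (deckReps p).filter (fun δ => δ.linearIsometryEquiv = S), φ (δ z) := by
  have h0 : ∀ w : Vec n, ∑ δ ∈ (deckReps p).filter (fun δ => δ.linearIsometryEquiv = S), φ (δ w) =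
      ∑ᶠ δ ∈ {δ | δ ∈ deck p ∧ δ 0 ∈ box n}, if δ.linearIsometryEquiv = S then φ (δ w) else 0 := by
    intro w
    rw [Finset.sum_filter, deckReps, ← H.coe_filter_deckFinset zero_mem_box, finsum_mem_coe_finset]
  rw [h0, h0]
  -- Composition with `transl l` on the right keeps linear parts; the new representatives take
  -- `transl (-l) 0` instead of `0` to the box, which makes no difference to the sum.
  have h1 : ∑ᶠ δ ∈ {δ | δ ∈ deck p ∧ δ 0 ∈ box n},
      (if δ.linearIsometryEquiv = S then φ (δ (transl l z)) else 0) =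
      ∑ᶠ δ ∈ {δ | δ ∈ deck p ∧ δ (transl (-l) 0) ∈ box n},
        if δ.linearIsometryEquiv = S then φ (δ z) else 0 := by
    refine finsum_mem_eq_of_bijOn (fun δ => δ * transl l) ⟨?_, ?_, ?_⟩ ?_
    · intro δ hδ
      refine ⟨mul_mem hδ.1 (transl_mem_deck _), ?_⟩
      change (δ * transl l * transl (-l)) 0 ∈ box n
      rw [mul_assoc, ← transl_add, add_neg_cancel, transl_zero_eq, mul_one]
      exact hδ.2
    · exact fun δ _ δ' _ h => mul_right_cancel h
    · intro δ hδ
      refine ⟨δ * transl (-l), ⟨mul_mem hδ.1 (transl_mem_deck _), hδ.2⟩, ?_⟩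
      simp only
      rw [mul_assoc, ← transl_add, neg_add_cancel, transl_zero_eq, mul_one]
    · intro δ _
      rw [mul_transl_linear]
      rfl
  rw [h1]
  refine finsum_deck_eq (fun k δ _ => ?_) ((transl_mem_strip _ _).2 zero_mem_box.1) zero_mem_box.1
  rw [linearIsometryEquiv_transl_mul]
  have : (transl k * δ) z = transl k (δ z) := rfl
  rw [this, hφ]

/-- The pairing of an average with a periodic function. -/
theorem integral_deckAvg_mul {F : (Vec n ≃ₗᵢ[ℝ] Vec n) → Vec n → ℂ}
    (hF : ∀ R, MemLp (F R) 2 (volume.restrict (box n))) {ψ : Vec n → ℂ} (hψ : Continuous ψ)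
    (hper : ∀ l z, ψ (transl l z) = ψ z) :
    ∫ z in box n, deckAvg p F z * ψ z = ((sheets p : ℂ))⁻¹ *
      ∑ δ ∈ deckReps p, ∫ w in box n, F δ.linearIsometryEquiv.symm w * ψ (δ w) := by
  classical
  have hint : ∀ δ : Vec n ≃ᵃⁱ[ℝ] Vec n,
      IntegrableOn (fun w => F δ.linearIsometryEquiv.symm w * ψ (δ w)) (box n) := fun δ =>
    (hF _).integrable_mul (memLp_box_of_continuous (hψ.comp δ.continuous))
  have hint' : ∀ δ : Vec n ≃ᵃⁱ[ℝ] Vec n, IntegrableOn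
      (fun w => if δ w ∈ box n then F δ.linearIsometryEquiv.symm w * ψ (δ w) else 0) (box n) := fun δ =>
    (hint δ).indicator (measurableSet_preimage_box δ)
  have hint2 : ∀ γ : Vec n ≃ᵃⁱ[ℝ] Vec n, IntegrableOn
      (fun z => if γ z ∈ box n then F γ.linearIsometryEquiv (γ z) * ψ z else 0) (box n) := by
    intro γ
    have h3 := (memLp_comp_affineIsometryEquiv (hF γ.linearIsometryEquiv) γ).integrable_mul
      (memLp_box_of_continuous hψ)
    refine h3.congr (Filter.Eventually.of_forall fun z => ?_)
    simp only [ite_mul, zero_mul, Pi.mul_apply]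
  have h1 : ∀ z, deckAvg p F z * ψ z = ((sheets p : ℂ))⁻¹ * ∑ γ ∈ deckFinset p,
      if γ z ∈ box n then F γ.linearIsometryEquiv (γ z) * ψ z else 0 := by
    intro z
    rw [deckAvg, mul_assoc, Finset.sum_mul]
    simp only [ite_mul, zero_mul]
  simp only [h1]
  rw [integral_const_mul, integral_finsetSum _ fun γ _ => hint2 γ]
  congr 1
  -- Each term is transported by `γ`, the sum reindexed by `γ ↦ γ⁻¹`, and the pieces of the box
  -- reassembled.
  have h2 : ∀ γ : Vec n ≃ᵃⁱ[ℝ] Vec n,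
      ∫ z in box n, (if γ z ∈ box n then F γ.linearIsometryEquiv (γ z) * ψ z else 0) =
      ∫ w in box n, if γ⁻¹ w ∈ box n then F γ⁻¹.linearIsometryEquiv.symm w * ψ (γ⁻¹ w) else 0 := by
    intro γ
    rw [integral_box_transport γ fun z => F γ.linearIsometryEquiv (γ z) * ψ z]
    refine integral_congr_ae (Filter.Eventually.of_forall fun w => ?_)
    have : γ (γ⁻¹ w) = w := γ.apply_symm_apply w
    simp only [this, linearIsometryEquiv_inv, LinearIsometryEquiv.symm_symm]
  simp only [h2]
  rw [Finset.sum_nbij' (t := deckFinset p) (g := fun δ => ∫ w in box n,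
    if δ w ∈ box n then F δ.linearIsometryEquiv.symm w * ψ (δ w) else 0) (fun γ => γ⁻¹) (fun γ => γ⁻¹)
    (fun γ hγ => H.inv_mem_deckFinset hγ) (fun γ hγ => H.inv_mem_deckFinset hγ)
    (fun γ _ => inv_inv γ) (fun γ _ => inv_inv γ) (fun γ _ => rfl)]
  rw [← integral_finsetSum _ fun δ _ => hint' δ, ← integral_finsetSum _ fun δ _ => hint δ]
  refine setIntegral_congr_fun measurableSet_box fun w hw => ?_
  refine H.sum_deckFinset_eq (f := fun δ => F δ.linearIsometryEquiv.symm w * ψ (δ w))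
    (fun l δ _ => ?_) hw
  simp only [linearIsometryEquiv_transl_mul]
  have : (transl l * δ) w = transl l (δ w) := rfl
  rw [this, hper]

end IsTwistedSlab

end

/-! ### Green's formula for averages -/

section

variable {n : ℕ} {N : Type u} [TopologicalSpace N] {p : Slab n → N}

theorem vec_eq_sum_single (v : Vec n) : v = ∑ k, v k • EuclideanSpace.single k (1 : ℝ) := by
  ext i
  simp [Finset.sum_apply, Pi.single_apply]

theorem map_vec_eq_sum (L : Vec n →L[ℝ] ℂ) (v : Vec n) :
    L v = ∑ k, ((v k : ℝ) : ℂ) * L (EuclideanSpace.single k (1 : ℝ)) := by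
  conv_lhs => rw [vec_eq_sum_single v]
  rw [map_sum]
  exact Finset.sum_congr rfl fun k _ => by rw [map_smul, Complex.real_smul]

theorem apply_transl_of_periodic {X : Type*} {φ : Vec n → X}
    (hper : ∀ (z : Vec n) (i : Fin n), φ (z + EuclideanSpace.single i.succ (1 : ℝ)) = φ z)
    (l : Fin n → ℤ) (z : Vec n) : φ (transl l z) = φ z := by
  have h : z = vec (z 0) (tailCLM n z) := by
    ext j
    refine Fin.cases rfl (fun j => rfl) j
  have h1 : IsPeriodic fun y => φ (vec (z 0) y) := isPeriodic_of_single fun y i => by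
    rw [vec_add_single, hper]
  rw [h, transl_vec]
  exact h1 l _

theorem fderiv_periodic {φ : Vec n → ℂ}
    (hper : ∀ (z : Vec n) (i : Fin n), φ (z + EuclideanSpace.single i.succ (1 : ℝ)) = φ z)
    (z : Vec n) (i : Fin n) : fderiv ℝ φ (z + EuclideanSpace.single i.succ (1 : ℝ)) = fderiv ℝ φ z := by
  conv_rhs => rw [show φ = fun z => φ (z + EuclideanSpace.single i.succ (1 : ℝ)) from
    funext fun z => (hper z i).symm]
  rw [fderiv_comp_add_right]

theorem integrable_mul_of_continuous {f ψ : Vec n → ℂ} (hf : MemLp f 2 (volume.restrict (box n)))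
    (hψ : Continuous ψ) : IntegrableOn (fun z => f z * ψ z) (box n) :=
  hf.integrable_mul (memLp_box_of_continuous hψ)

/-- The pullback of the first derivatives of a tensor field by an isometry with linear part `R`. -/
def rotGrad (D : Fin (n + 1) → Vec n → Vec n → ℂ) (j : Fin (n + 1)) (u : Vec n)
    (R : Vec n ≃ₗᵢ[ℝ] Vec n) (w : Vec n) : ℂ :=
  ∑ k, ((R (EuclideanSpace.single j (1 : ℝ)) k : ℝ) : ℂ) * D k w (R u)

theorem memLp_rotGrad {D : Fin (n + 1) → Vec n → Vec n → ℂ} (hD : ∀ j, L2Coeff (D j)) (j : Fin (n + 1))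
    (u : Vec n) (R : Vec n ≃ₗᵢ[ℝ] Vec n) : MemLp (rotGrad D j u R) 2 (volume.restrict (box n)) :=
  memLp_finsetSum _ fun k _ => (hD k _).const_mul _

namespace IsTwistedSlab

variable [ChartedSpace (EuclideanHalfSpace (n + 1)) N]
  [IsManifold (𝓡∂ (n + 1)) ∞ N] {g : SmoothMetric n N} (H : IsTwistedSlab g p) [T2Space N]
include H

/-- Green's formula passes to averages. A single deck transformation need not normalize the lattice of
translations, so the test function transported by it need not be periodic; the sum over those with a
given linear part is. -/
theorem green_deckAvg {G : Vec n → Vec n → ℂ} {D : Fin (n + 1) → Vec n → Vec n → ℂ} (hG : L2Coeff G)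
    (hD : ∀ j, L2Coeff (D j)) (h : ∀ u, Green (fun z => G z u) fun j z => D j z u) (u : Vec n) :
    Green (deckAvg p fun R w => G w (R u)) fun j => deckAvg p (rotGrad D j u) := by
  classical
  intro φ hφ hper j
  have hcd : Continuous fun z => fderiv ℝ φ z (EuclideanSpace.single j (1 : ℝ)) :=
    (hφ.continuous_fderiv (by simp)).clm_apply continuous_const
  rw [H.integral_deckAvg_mul (fun R => hG (R u)) hcd fun l z => apply_transl_of_periodic
      (φ := fun z => fderiv ℝ φ z (EuclideanSpace.single j (1 : ℝ)))
      (fun z i => by simp only [fderiv_periodic hper]) l z,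
    H.integral_deckAvg_mul (fun R => memLp_rotGrad hD j u R) hφ.continuous
      (apply_transl_of_periodic hper), ← mul_neg, ← Finset.sum_neg_distrib]
  congr 1
  have hmaps : ∀ δ ∈ deckReps p, δ.linearIsometryEquiv ∈
      (deckReps p).image fun δ : Vec n ≃ᵃⁱ[ℝ] Vec n => δ.linearIsometryEquiv :=
    fun δ hδ => Finset.mem_image_of_mem _ hδ
  rw [← Finset.sum_fiberwise_of_maps_to hmaps, ← Finset.sum_fiberwise_of_maps_to hmaps]
  refine Finset.sum_congr rfl fun S _ => ?_
  set T := (deckReps p).filter fun δ => δ.linearIsometryEquiv = S with hT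
  -- The periodic test function built from the deck transformations with linear part `S`.
  set Φ : Vec n → ℂ := fun z => ∑ δ ∈ T, φ (δ z) with hΦ
  have hδ : ∀ δ : Vec n ≃ᵃⁱ[ℝ] Vec n, ContDiff ℝ ∞ fun z => φ (δ z) := fun δ =>
    hφ.comp δ.toAffineIsometry.toContinuousAffineMap.contDiff
  have hΦc : ContDiff ℝ ∞ Φ := ContDiff.sum fun δ _ => hδ δ
  have hΦp : ∀ (z : Vec n) (i : Fin n), Φ (z + EuclideanSpace.single i.succ (1 : ℝ)) = Φ z := by
    intro z i
    have h1 := H.sum_deckReps_add_intVec (apply_transl_of_periodic hper) S (Pi.single i 1) z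
    have h2 : transl (Pi.single i 1) z = z + EuclideanSpace.single i.succ (1 : ℝ) := by
      ext j
      refine Fin.cases ?_ (fun j => ?_) j
      · rw [transl_zero]; simp
      · rw [transl_succ]; simp [Pi.single_apply]
    rw [h2] at h1
    exact h1
  have hfd : ∀ z k, fderiv ℝ Φ z (EuclideanSpace.single k (1 : ℝ)) =
      ∑ δ ∈ T, fderiv ℝ φ (δ z) (S (EuclideanSpace.single k (1 : ℝ))) := by
    intro z k
    have h1 : HasFDerivAt Φ (∑ δ ∈ T, (fderiv ℝ φ (δ z)).comp
        (δ.linearIsometryEquiv.toContinuousLinearEquiv : Vec n →L[ℝ] Vec n)) z :=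
      HasFDerivAt.fun_sum fun δ _ => ((hφ.differentiable (by simp)).differentiableAt.hasFDerivAt).comp z
        (hasFDerivAt_affineIsometryEquiv δ z)
    rw [h1.fderiv, _root_.sum_apply]
    refine Finset.sum_congr rfl fun δ hδ => ?_
    rw [← (Finset.mem_filter.1 hδ).2]
    rfl
  set e := S.symm (EuclideanSpace.single j (1 : ℝ)) with he
  have hcont : ∀ δ : Vec n ≃ᵃⁱ[ℝ] Vec n, Continuous fun z => φ (δ z) := fun δ => (hδ δ).continuous
  have hcontD : ∀ δ : Vec n ≃ᵃⁱ[ℝ] Vec n, Continuous fun z =>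
      fderiv ℝ φ (δ z) (EuclideanSpace.single j (1 : ℝ)) := fun δ => hcd.comp δ.continuous
  calc ∑ δ ∈ T, ∫ w in box n, G w (δ.linearIsometryEquiv.symm u) *
        fderiv ℝ φ (δ w) (EuclideanSpace.single j (1 : ℝ))
      = ∑ δ ∈ T, ∫ w in box n, G w (S.symm u) * fderiv ℝ φ (δ w) (EuclideanSpace.single j (1 : ℝ)) :=
        Finset.sum_congr rfl fun δ hδ => by rw [(Finset.mem_filter.1 hδ).2]
    _ = ∫ w in box n, ∑ k, ((e k : ℝ) : ℂ) *
          (G w (S.symm u) * fderiv ℝ Φ w (EuclideanSpace.single k (1 : ℝ))) := by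
        rw [← integral_finsetSum _ fun δ _ =>
          integrable_mul_of_continuous (hG (S.symm u)) (hcontD δ)]
        refine integral_congr_ae (Filter.Eventually.of_forall fun w => ?_)
        simp only
        have h1 : ∀ k, ((e k : ℝ) : ℂ) *
            (G w (S.symm u) * fderiv ℝ Φ w (EuclideanSpace.single k (1 : ℝ))) = G w (S.symm u) *
            (((e k : ℝ) : ℂ) * fderiv ℝ Φ w (EuclideanSpace.single k (1 : ℝ))) := fun k => by ring
        simp only [h1]
        rw [← Finset.mul_sum, ← Finset.mul_sum, ← map_vec_eq_sum]
        congr 1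
        rw [vec_eq_sum_single e, map_sum]
        simp only [map_smul, hfd, Finset.smul_sum]
        rw [Finset.sum_comm]
        refine Finset.sum_congr rfl fun δ _ => ?_
        rw [← S.apply_symm_apply (EuclideanSpace.single j (1 : ℝ)), ← he]
        conv_lhs => rw [vec_eq_sum_single e, map_sum, map_sum]
        simp only [map_smul]
    _ = ∑ k, ((e k : ℝ) : ℂ) * ∫ w in box n,
          G w (S.symm u) * fderiv ℝ Φ w (EuclideanSpace.single k (1 : ℝ)) := by
        simp only [← integral_const_mul]
        refine integral_finsetSum _ fun k _ => Integrable.const_mul ?_ _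
        exact integrable_mul_of_continuous (hG (S.symm u))
          ((hΦc.continuous_fderiv (by simp)).clm_apply continuous_const)
    _ = ∑ k, ((e k : ℝ) : ℂ) * -∫ w in box n, D k w (S.symm u) * Φ w :=
        Finset.sum_congr rfl fun k _ => by rw [h (S.symm u) Φ hΦc hΦp k]
    _ = -∫ w in box n, rotGrad D j u S.symm w * Φ w := by
        simp only [mul_neg, Finset.sum_neg_distrib, ← integral_const_mul]
        rw [← integral_finsetSum _ fun k _ => Integrable.const_mul
          (integrable_mul_of_continuous (hD k (S.symm u)) hΦc.continuous) _]
        congr 1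
        refine integral_congr_ae (Filter.Eventually.of_forall fun w => ?_)
        simp only [rotGrad, Finset.sum_mul, mul_assoc]
        rfl
    _ = -∑ δ ∈ T, ∫ w in box n, rotGrad D j u S.symm w * φ (δ w) := by
        simp only [hΦ, Finset.mul_sum]
        rw [integral_finsetSum _ fun δ _ =>
          integrable_mul_of_continuous (memLp_rotGrad hD j u S.symm) (hcont δ)]
    _ = ∑ δ ∈ T, -∫ w in box n, rotGrad D j u δ.linearIsometryEquiv.symm w * φ (δ w) := by
        rw [Finset.sum_neg_distrib]
        congr 1
        exact Finset.sum_congr rfl fun δ hδ => by rw [(Finset.mem_filter.1 hδ).2]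

end IsTwistedSlab

end

/-! ### Ray transform and norm of averages -/

section

variable {n : ℕ} {N : Type u} [TopologicalSpace N] {p : Slab n → N}

/-- A function of `x` alone, with mean zero, is orthogonal to the exponentials that are constant along
the rays of direction `(1, b)`. -/
theorem integral_mul_rayExpo_eq_zero {q : ℝ → ℂ} (hq : MemLp q 2 unitMeasure)
    (h : ∫ t in (0 : ℝ)..1, q t = 0) (k : Fin n → ℤ) (b : EuclideanSpace ℝ (Fin n)) :
    ∫ z in box n, q (z 0) * rayExpo k b z = 0 := by
  have h1 : IntegrableOn (fun z : Vec n => q (z 0) * rayExpo k b z) (box n) :=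
    integrable_mul_of_continuous (hq.comp_measurePreserving measurePreserving_apply_zero)
      (continuous_rayExpo k b)
  rw [integral_box _ h1]
  have h2 : ∀ t : ℝ, ∫ y in cell n, q (vec t y 0) * rayExpo k b (vec t y) =
      q t * (expo k (-(t • b)) * ∫ y in cell n, expo k y) := by
    intro t
    rw [← integral_const_mul, ← integral_const_mul]
    refine integral_congr_ae (Filter.Eventually.of_forall fun y => ?_)
    have h3 : vec t y 0 = t := rfl
    simp only [h3, rayExpo, tailCLM_vec, sub_eq_add_neg, expo_add]
    ring
  simp only [h2]
  by_cases hk : k = 0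
  · subst hk
    simpa [expo_zero_left] using h
  · simp [integral_cell_expo hk]

theorem measurePreserving_one_sub_unit :
    MeasurePreserving (fun t : ℝ => 1 - t) unitMeasure unitMeasure := by
  have h := (Measure.measurePreserving_sub_left volume (1 : ℝ)).restrict_preimage
    (measurableSet_Icc (a := (0 : ℝ)) (b := 1))
  have h2 : (fun t : ℝ => 1 - t) ⁻¹' Icc 0 1 = Icc 0 1 := by
    ext t
    simp only [mem_preimage, mem_Icc]
    constructor <;> rintro ⟨h1, h2⟩ <;> constructor <;> linarith
  rwa [h2] at h

namespace IsTwistedSlab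

variable [ChartedSpace (EuclideanHalfSpace (n + 1)) N]
  [IsManifold (𝓡∂ (n + 1)) ∞ N] {g : SmoothMetric n N} (H : IsTwistedSlab g p) [T2Space N]
include H

/-- The averages of a tensor field that depends on `x` alone, with mean zero, have vanishing ray
transform: a deck transformation acts on `x` by the identity or by `x ↦ 1 - x`. -/
theorem integral_deckAvg_mul_rayExpo {h : ℝ → Vec n → ℂ} (hL : ∀ u, MemLp (fun x => h x u) 2 unitMeasure)
    (hm : ∀ u, ∫ x in (0 : ℝ)..1, h x u = 0) (u : Vec n) (k : Fin n → ℤ) (b : EuclideanSpace ℝ (Fin n)) :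
    ∫ z in box n, deckAvg p (fun R w => h (w 0) (R u)) z * rayExpo k b z = 0 := by
  classical
  have h1 : ∀ δ ∈ deckReps p, ∃ q : ℝ → ℂ, MemLp q 2 unitMeasure ∧ ∫ t in (0 : ℝ)..1, q t = 0 ∧
      ∀ z, h (δ z 0) (δ.linearIsometryEquiv u) = q (z 0) := by
    intro δ hδ
    rcases apply_zero_of_mem_deck (H.mem_deck_of_mem_deckReps hδ) with ⟨h0, _⟩ | ⟨h0, _⟩
    · exact ⟨fun t => h t (δ.linearIsometryEquiv u), hL _, hm _, fun z => by rw [h0]⟩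
    · refine ⟨fun t => h (1 - t) (δ.linearIsometryEquiv u),
        (hL _).comp_measurePreserving measurePreserving_one_sub_unit, ?_, fun z => by rw [h0]⟩
      have := intervalIntegral.integral_comp_sub_left (a := 0) (b := 1)
        (fun t => h t (δ.linearIsometryEquiv u)) (1 : ℝ)
      rw [this]
      simpa using hm _
  choose! q hq hq0 hqz using h1
  have h2 : ∫ z in box n, deckAvg p (fun R w => h (w 0) (R u)) z * rayExpo k b z =
      ∫ z in box n, ((sheets p : ℂ))⁻¹ * ∑ δ ∈ deckReps p, q δ (z 0) * rayExpo k b z := by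
    refine setIntegral_congr_fun measurableSet_box fun z hz => ?_
    simp only [deckAvg]
    rw [mul_assoc, ← Finset.sum_mul]
    congr 2
    rw [H.sum_deckFinset_eq (f := fun δ => h (δ z 0) (δ.linearIsometryEquiv u)) (fun l δ _ => ?_) hz]
    · exact Finset.sum_congr rfl fun δ hδ => hqz δ hδ z
    · simp only [linearIsometryEquiv_transl_mul]
      have : (transl l * δ) z = transl l (δ z) := rfl
      rw [this, transl_zero]
  have h3 : ∀ δ ∈ deckReps p, IntegrableOn (fun z : Vec n => q δ (z 0) * rayExpo k b z) (box n) :=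
    fun δ hδ => integrable_mul_of_continuous
      ((hq δ hδ).comp_measurePreserving measurePreserving_apply_zero) (continuous_rayExpo k b)
  rw [h2, integral_const_mul, integral_finsetSum _ h3]
  rw [Finset.sum_eq_zero fun δ hδ => integral_mul_rayExpo_eq_zero (hq δ hδ) (hq0 δ hδ) k b, mul_zero]

/-- A decomposition of the pullback of a tensor field on `N` may be averaged. -/
theorem pullback_eq_deckAvg {f : (x : N) → TangentSpace (𝓡∂ (n + 1)) x → ℂ} {A : Vec n → Vec n → ℂ}
    {D : Fin (n + 1) → Vec n → Vec n → ℂ}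
    (hE : ∀ᵐ z ∂(volume.restrict (box n)), ∀ u : Vec n,
      pullback p f z u = A z u + ∑ j, ((u j : ℝ) : ℂ) * D j z u) :
    ∀ᵐ z ∂(volume.restrict (box n)), ∀ u : Vec n, pullback p f z u =
      deckAvg p (fun R w => A w (R u)) z + ∑ j, ((u j : ℝ) : ℂ) * deckAvg p (rotGrad D j u) z := by
  classical
  rw [ae_restrict_iff' measurableSet_box] at hE ⊢
  -- As isometries preserve null sets, the decomposition holds at all points `γ z`; the field itself is
  -- invariant under the deck group, so it equals its average.
  have hE' : ∀ᵐ z : Vec n, ∀ γ ∈ deckFinset p, γ z ∈ box n → ∀ u : Vec n,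
      pullback p f (γ z) u = A (γ z) u + ∑ j, ((u j : ℝ) : ℂ) * D j (γ z) u := by
    rw [Finset.eventually_all]
    exact fun γ _ => (measurePreserving_affineIsometryEquiv γ).quasiMeasurePreserving.ae hE
  filter_upwards [hE'] with z hz hzb u
  have hd : ((sheets p : ℕ) : ℂ) ≠ 0 := Nat.cast_ne_zero.2 H.sheets_pos.ne'
  have h1 : pullback p f z u = ((sheets p : ℂ))⁻¹ * ∑ γ ∈ deckFinset p,
      if γ z ∈ box n then pullback p f (γ z) (γ.linearIsometryEquiv u) else 0 := by
    rw [← Finset.sum_filter, Finset.sum_congr rfl (g := fun _ => pullback p f z u) fun γ hγ => ?_,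
      Finset.sum_const, H.card_filter_deckFinset hzb, nsmul_eq_mul, inv_mul_cancel_left₀ hd]
    exact H.pullback_deck f (H.mem_deckFinset.1 (Finset.mem_filter.1 hγ).1).1 hzb.1 u
  rw [h1]
  simp only [deckAvg]
  have h2 : ∀ j, ((u j : ℝ) : ℂ) * (((sheets p : ℂ))⁻¹ * ∑ γ ∈ deckFinset p,
      if γ z ∈ box n then rotGrad D j u γ.linearIsometryEquiv (γ z) else 0) =
      ((sheets p : ℂ))⁻¹ * ∑ γ ∈ deckFinset p,
        if γ z ∈ box n then ((u j : ℝ) : ℂ) * rotGrad D j u γ.linearIsometryEquiv (γ z) else 0 := by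
    intro j
    rw [mul_left_comm, Finset.mul_sum]
    simp only [mul_ite, mul_zero]
  simp only [h2]
  rw [← Finset.mul_sum, ← mul_add, Finset.sum_comm, ← Finset.sum_add_distrib]
  congr 1
  refine Finset.sum_congr rfl fun γ hγ => ?_
  by_cases hb : γ z ∈ box n
  · simp only [if_pos hb]
    rw [hz γ hγ hb]
    congr 1
    simp only [rotGrad, Finset.mul_sum]
    rw [Finset.sum_comm]
    refine Finset.sum_congr rfl fun k _ => ?_
    simp only [← mul_assoc]
    rw [← Finset.sum_mul]
    congr 1
    have h3 : γ.linearIsometryEquiv u k = ∑ j, u j * γ.linearIsometryEquiv (EuclideanSpace.single j 1) k := by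
      conv_lhs => rw [vec_eq_sum_single u, map_sum]
      simp [Finset.sum_apply]
    rw [h3]
    push_cast
    rfl
  · simp [if_neg hb]

/-- Averages over the deck transformations do not increase the `L²` norm, up to the area of the
sphere. -/
theorem slabNormSq_deckAvg_le {F : (Vec n ≃ₗᵢ[ℝ] Vec n) → Vec n → Vec n → ℂ} {Q : Vec n → ℝ}
    (hQ : IntegrableOn Q (box n))
    (hF : ∀ R w u, ‖u‖ = 1 → ‖F R w u‖ ^ 2 ≤ Q w) :
    slabNormSq (fun z u => deckAvg p (fun R w => F R w u) z) ≤
      ((volume : Measure (Vec n)).toSphere).real univ * ∫ z in box n, Q z := by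
  classical
  have hd : (0 : ℝ) < sheets p := Nat.cast_pos.2 H.sheets_pos
  set σ := ((volume : Measure (Vec n)).toSphere).real univ with hσ
  -- The average of `Q` over the fibre.
  set M : Vec n → ℝ := fun z => (sheets p : ℝ)⁻¹ * ∑ γ ∈ deckFinset p, if γ z ∈ box n then Q (γ z) else 0
    with hM
  have hpt : ∀ z ∈ box n, ∀ u, ‖u‖ = 1 → ‖deckAvg p (fun R w => F R w u) z‖ ^ 2 ≤ M z := by
    intro z hz u hu
    rw [deckAvg, ← Finset.sum_filter, hM]
    simp only
    rw [← Finset.sum_filter]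
    set T := (deckFinset p).filter fun γ => γ z ∈ box n with hT
    have hc : (T.card : ℝ) = sheets p := by rw [hT, H.card_filter_deckFinset hz]
    -- The Cauchy–Schwarz inequality over the `d` terms costs a factor `d`, which one of the two factors
    -- `1/d` absorbs.
    calc ‖((sheets p : ℂ))⁻¹ * ∑ γ ∈ T, F γ.linearIsometryEquiv (γ z) u‖ ^ 2
        = ((sheets p : ℝ)⁻¹) ^ 2 * ‖∑ γ ∈ T, F γ.linearIsometryEquiv (γ z) u‖ ^ 2 := by
          rw [norm_mul, mul_pow, norm_inv, Complex.norm_natCast]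
      _ ≤ ((sheets p : ℝ)⁻¹) ^ 2 * (T.card * ∑ γ ∈ T, Q (γ z)) := by
          gcongr
          calc ‖∑ γ ∈ T, F γ.linearIsometryEquiv (γ z) u‖ ^ 2
              ≤ (∑ γ ∈ T, ‖F γ.linearIsometryEquiv (γ z) u‖) ^ 2 := by
                gcongr; exact norm_sum_le _ _
            _ ≤ T.card * ∑ γ ∈ T, ‖F γ.linearIsometryEquiv (γ z) u‖ ^ 2 := sq_sum_le_card_mul_sum_sq
            _ ≤ T.card * ∑ γ ∈ T, Q (γ z) := by
                gcongr with γ _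
                exact hF _ _ _ hu
      _ = (sheets p : ℝ)⁻¹ * ∑ γ ∈ T, Q (γ z) := by
          rw [hc]; field_simp
  have hint : ∀ γ : Vec n ≃ᵃⁱ[ℝ] Vec n, IntegrableOn (fun z => if γ z ∈ box n then Q (γ z) else 0) (box n) := by
    intro γ
    have h1 : Integrable ((box n).indicator Q) volume := (integrable_indicator_iff measurableSet_box).2 hQ
    refine (((measurePreserving_affineIsometryEquiv γ).integrable_comp_of_integrable h1).integrableOn).congr
      (Filter.Eventually.of_forall fun z => ?_)
    simp only [Function.comp_apply, indicator]
  have hMint : IntegrableOn M (box n) := (integrable_finsetSum _ fun γ _ => hint γ).const_mul _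
  have hsum : ∫ z in box n, M z = ∫ z in box n, Q z := by
    rw [hM, integral_const_mul, integral_finsetSum _ fun γ _ => hint γ]
    have h2 : ∀ γ : Vec n ≃ᵃⁱ[ℝ] Vec n, ∫ z in box n, (if γ z ∈ box n then Q (γ z) else 0) =
        ∫ w in box n, if γ⁻¹ w ∈ box n then Q w else 0 := by
      intro γ
      rw [integral_box_transport γ fun z => Q (γ z)]
      refine integral_congr_ae (Filter.Eventually.of_forall fun w => ?_)
      have : γ (γ⁻¹ w) = w := γ.apply_symm_apply w
      simp only [this]
    simp only [h2]
    have h3 : ∀ δ : Vec n ≃ᵃⁱ[ℝ] Vec n, IntegrableOn (fun w => if δ w ∈ box n then Q w else 0) (box n) :=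
      fun δ => hQ.indicator (measurableSet_preimage_box δ)
    rw [Finset.sum_nbij' (t := deckFinset p) (g := fun δ => ∫ w in box n, if δ w ∈ box n then Q w else 0)
      (fun γ => γ⁻¹) (fun γ => γ⁻¹) (fun γ hγ => H.inv_mem_deckFinset hγ)
      (fun γ hγ => H.inv_mem_deckFinset hγ) (fun γ _ => inv_inv γ) (fun γ _ => inv_inv γ) (fun γ _ => rfl),
      ← integral_finsetSum _ fun δ _ => h3 δ, ← integral_const_mul]
    refine setIntegral_congr_fun measurableSet_box fun w hw => ?_
    rw [← Finset.sum_filter, Finset.sum_const, H.card_filter_deckFinset hw, nsmul_eq_mul,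
      inv_mul_cancel_left₀ hd.ne']
  rw [← hsum, ← integral_const_mul, slabNormSq]
  refine integral_mono_of_nonneg (Filter.Eventually.of_forall fun z => polyNormSq_nonneg _)
    (hMint.const_mul σ) ?_
  filter_upwards [ae_restrict_mem measurableSet_box] with z hz
  calc polyNormSq (fun u => deckAvg p (fun R w => F R w u) z)
      ≤ ∫ _u : Metric.sphere (0 : Vec n) 1, M z ∂((volume : Measure (Vec n)).toSphere) := by
        refine integral_mono_of_nonneg (Filter.Eventually.of_forall fun u => sq_nonneg _)
          (integrable_const _) (Filter.Eventually.of_forall fun u => ?_)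
        exact hpt z hz u (mem_sphere_zero_iff_norm.1 u.2)
    _ = σ * M z := by rw [integral_const, smul_eq_mul]

end IsTwistedSlab

end

/-! ### Decomposable tensor fields have vanishing X-ray transform -/

section

variable {n : ℕ} {N : Type u} [TopologicalSpace N] {p : Slab n → N}

theorem contDiff_rayExpo (k : Fin n → ℤ) (b : EuclideanSpace ℝ (Fin n)) : ContDiff ℝ ∞ (rayExpo k b) :=
  (contDiff_expo k).comp ((tailCLM n).contDiff.sub
    ((EuclideanSpace.proj (0 : Fin (n + 1)) : Vec n →L[ℝ] ℝ).contDiff.smul contDiff_const))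

theorem fderiv_rayExpo (k : Fin n → ℤ) (b : EuclideanSpace ℝ (Fin n)) (z : Vec n) :
    fderiv ℝ (rayExpo k b) z (vec 1 b) = 0 := by
  have hd := ((contDiff_rayExpo k b).differentiable (by simp) z).hasFDerivAt
  have h1 : HasDerivAt (fun s : ℝ => z + s • vec 1 b) (vec 1 b) 0 := by
    simpa using ((hasDerivAt_id (0 : ℝ)).smul_const (vec 1 b)).const_add z
  have h2 : HasDerivAt (fun s : ℝ => rayExpo k b (z + s • vec 1 b)) (fderiv ℝ (rayExpo k b) z (vec 1 b)) 0 := by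
    have hd' : HasFDerivAt (rayExpo k b) (fderiv ℝ (rayExpo k b) z) (z + (0 : ℝ) • vec 1 b) := by
      rwa [zero_smul, add_zero]
    exact hd'.comp_hasDerivAt (0 : ℝ) h1
  have h3 : (fun s : ℝ => rayExpo k b (z + s • vec 1 b)) = fun _ => rayExpo k b z := by
    funext s
    unfold rayExpo
    congr 1
    rw [map_add, map_smul, tailCLM_vec]
    have : (vec 1 b) 0 = 1 := rfl
    simp only [PiLp.add_apply, PiLp.smul_apply, this, smul_eq_mul, mul_one, add_smul]
    abel
  rw [h3] at h2
  exact h2.unique (hasDerivAt_const _ _)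

theorem rayExpo_add_single (k : Fin n → ℤ) (b : EuclideanSpace ℝ (Fin n)) (z : Vec n) (i : Fin n) :
    rayExpo k b (z + EuclideanSpace.single i.succ (1 : ℝ)) = rayExpo k b z := by
  have h1 : tailCLM n (z + EuclideanSpace.single i.succ (1 : ℝ)) = tailCLM n z + intVec (Pi.single i 1) := by
    ext j
    simp [tailCLM_apply, intVec_apply, Pi.single_apply]
  have h2 : (z + EuclideanSpace.single i.succ (1 : ℝ)) 0 = z 0 := by simp
  rw [rayExpo, rayExpo, h1, h2, add_sub_right_comm, expo_add_intVec]

/-- An exact tensor field with potential in `H¹₀` is orthogonal to the exponentials that are constant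
along the rays. -/
theorem Green.integral_sum_mul_rayExpo {G : Vec n → ℂ} {D : Fin (n + 1) → Vec n → ℂ} (h : Green G D)
    (hG : MemLp G 2 (volume.restrict (box n))) (hD : ∀ j, MemLp (D j) 2 (volume.restrict (box n)))
    (k : Fin n → ℤ) (b : EuclideanSpace ℝ (Fin n)) :
    ∫ z in box n, (∑ j, ((vec 1 b j : ℝ) : ℂ) * D j z) * rayExpo k b z = 0 := by
  have hc := contDiff_rayExpo k b
  have h1 : ∀ j, IntegrableOn (fun z => D j z * rayExpo k b z) (box n) := fun j =>
    integrable_mul_of_continuous (hD j) hc.continuous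
  have h2 : ∀ j, IntegrableOn (fun z => G z *
      fderiv ℝ (rayExpo k b) z (EuclideanSpace.single j (1 : ℝ))) (box n) := fun j =>
    integrable_mul_of_continuous hG ((hc.continuous_fderiv (by simp)).clm_apply continuous_const)
  simp only [Finset.sum_mul, mul_assoc]
  rw [integral_finsetSum _ fun j _ => (h1 j).const_mul _]
  simp only [integral_const_mul]
  have h3 : ∀ j, ∫ z in box n, D j z * rayExpo k b z = -∫ z in box n, G z *
      fderiv ℝ (rayExpo k b) z (EuclideanSpace.single j (1 : ℝ)) := fun j => by
    rw [h _ hc (rayExpo_add_single k b) j, neg_neg]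
  simp only [h3, mul_neg, Finset.sum_neg_distrib, ← integral_const_mul]
  rw [← integral_finsetSum _ fun j _ => (h2 j).const_mul _, neg_eq_zero]
  refine integral_eq_zero_of_ae (Filter.Eventually.of_forall fun z => ?_)
  have h4 := map_vec_eq_sum (fderiv ℝ (rayExpo k b) z) (vec 1 b)
  rw [fderiv_rayExpo] at h4
  calc ∑ j, ((vec 1 b j : ℝ) : ℂ) * (G z * fderiv ℝ (rayExpo k b) z (EuclideanSpace.single j (1 : ℝ)))
      = G z * ∑ j, ((vec 1 b j : ℝ) : ℂ) * fderiv ℝ (rayExpo k b) z (EuclideanSpace.single j (1 : ℝ)) := by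
        rw [Finset.mul_sum]
        exact Finset.sum_congr rfl fun j _ => by ring
    _ = 0 := by rw [← h4, mul_zero]

namespace IsTwistedSlab

variable [ChartedSpace (EuclideanHalfSpace (n + 1)) N]
  [IsManifold (𝓡∂ (n + 1)) ∞ N] {g : SmoothMetric n N} (H : IsTwistedSlab g p)
include H

/-- In a fixed direction, the pullback of a tensor field is periodic: translations are deck
transformations with trivial linear part. -/
theorem stripPeriodic_pullback (f : (x : N) → TangentSpace (𝓡∂ (n + 1)) x → ℂ) (u : Vec n) :
    StripPeriodic fun z => pullback p f z u := by
  intro z hz l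
  have := H.pullback_deck f (transl_mem_deck l) hz u
  rwa [transl_linear] at this

/-- The vanishing of the X-ray transform in terms of Fourier coefficients of the pullback. -/
theorem xrayVanishes_iff_integral {f : (x : N) → TangentSpace (𝓡∂ (n + 1)) x → ℂ}
    (hf : L2Coeff (pullback p f)) :
    XrayVanishes g p f ↔ ∀ b k, ∫ z in box n, pullback p f z (vec 1 b) * rayExpo k b z = 0 :=
  (H.xrayVanishes_iff f).trans (forall_congr' fun b =>
    (H.stripPeriodic_pullback f _).ae_line_integral_eq_zero_iff (hf _) b)

theorem pullback_pushforward_eq_deckAvg [T2Space N] (F : Vec n → Vec n → ℂ) {z : Vec n} (hz : z ∈ box n)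
    (u : Vec n) : pullback p (pushforward p F) z u = deckAvg p (fun R w => F w (R u)) z :=
  H.pullback_pushforward F hz u

/-- Both parts of a decomposable tensor field are orthogonal to the exponentials that are constant along
the rays. -/
theorem xrayVanishes_of_isKernelDecomp [T2Space N] {m : ℕ} {f φ : (x : N) → TangentSpace (𝓡∂ (n + 1)) x → ℂ}
    (hf : L2Coeff (pullback p f)) {h : ℝ → Vec n → ℂ} {Dφ : Fin (n + 1) → Vec n → Vec n → ℂ}
    (hd : IsKernelDecomp p m f h φ Dφ) : XrayVanishes g p f := by
  rw [H.xrayVanishes_iff_integral hf]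
  intro b k
  have h1 : ∀ u, MemLp (deckAvg p fun R w => h (w 0) (R u)) 2 (volume.restrict (box n)) := fun u =>
    memLp_deckAvg fun R => (hd.h_memL2 (R u)).comp_measurePreserving measurePreserving_apply_zero
  have hE : ∫ z in box n, pullback p f z (vec 1 b) * rayExpo k b z = ∫ z in box n,
      (deckAvg p (fun R w => h (w 0) (R (vec 1 b))) z * rayExpo k b z +
        (∑ j, ((vec 1 b j : ℝ) : ℂ) * Dφ j z (vec 1 b)) * rayExpo k b z) := by
    refine integral_congr_ae ?_
    filter_upwards [hd.eq, ae_restrict_mem measurableSet_box] with z hz hzb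
    rw [hz, H.pullback_pushforward_eq_deckAvg _ hzb, add_mul]
  have hgreen : Green (fun z => pullback p φ z (vec 1 b)) fun j z => Dφ j z (vec 1 b) :=
    fun ψ hψ hper j => hd.φ_grad.green ψ hψ hper _ j
  rw [hE, integral_add, H.integral_deckAvg_mul_rayExpo hd.h_memL2 hd.h_mean, zero_add,
    hgreen.integral_sum_mul_rayExpo (hd.φ_grad.memL2 _) fun j => hd.φ_grad.grad_memL2 j _]
  · exact integrable_mul_of_continuous (h1 _) (continuous_rayExpo k b)
  · exact integrable_mul_of_continuous (memLp_finsetSum _ fun j _ => (hd.φ_grad.grad_memL2 j _).const_mul _)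
      (continuous_rayExpo k b)

end IsTwistedSlab

end

/-! ### Norms of tensor fields -/

section

variable {n : ℕ}

theorem continuous_polyNormSq_sum (k : ℤ) : Continuous fun c : (Fin (n + 1) → ℕ) → ℂ =>
    polyNormSq (n := n) fun u => ∑ α ∈ idx n k, c α * monom α u := by
  have h : ∀ e : idx n k → ℂ, polyNormSq (n := n) (fun u => ∑ α : idx n k, e α * monom (α : Fin (n + 1) → ℕ) u) =
      ∫ u : Metric.sphere (0 : Vec n) 1 in univ,
        ‖∑ α : idx n k, e α * monom (α : Fin (n + 1) → ℕ) (u : Vec n)‖ ^ 2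
          ∂((volume : Measure (Vec n)).toSphere) := fun e => by
    rw [Measure.restrict_univ]; rfl
  have hc : Continuous fun e : idx n k → ℂ =>
      polyNormSq (n := n) fun u => ∑ α : idx n k, e α * monom (α : Fin (n + 1) → ℕ) u := by
    simp only [h]
    refine continuous_parametric_integral_of_continuous (f := fun (e : idx n k → ℂ)
      (u : Metric.sphere (0 : Vec n) 1) => ‖∑ α : idx n k, e α * monom (α : Fin (n + 1) → ℕ) (u : Vec n)‖ ^ 2)
      ?_ isCompact_univ
    have : ∀ α : Fin (n + 1) → ℕ, Continuous fun q : (idx n k → ℂ) × Metric.sphere (0 : Vec n) 1 =>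
        monom α (q.2 : Vec n) := fun α =>
      (continuous_monom α).comp (continuous_subtype_val.comp continuous_snd)
    refine (Continuous.norm (continuous_finsetSum _ fun α _ => ?_)).pow 2
    exact ((continuous_apply α).comp continuous_fst).mul (this _)
  have h2 : (fun c : (Fin (n + 1) → ℕ) → ℂ =>
      polyNormSq (n := n) fun u => ∑ α ∈ idx n k, c α * monom α u) =
      (fun e : idx n k → ℂ =>
        polyNormSq (n := n) fun u => ∑ α : idx n k, e α * monom (α : Fin (n + 1) → ℕ) u) ∘
      fun c α => c α := by
    funext c
    simp only [Function.comp_apply]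
    congr 1
    funext u
    exact (Finset.sum_coe_sort (idx n k) fun α => c α * monom α u).symm
  rw [h2]
  exact hc.comp (continuous_pi fun α => continuous_apply _)

/-- A tensor field with square integrable values in each direction is square integrable with values in
`L²(Sⁿ)`. -/
theorem integrableOn_polyNormSq {k : ℤ} {F : Vec n → Vec n → ℂ} (hF : ∀ z, IsHomPoly k (F z))
    (hL : L2Coeff F) : IntegrableOn (fun z => polyNormSq (F z)) (box n) := by
  obtain ⟨A, hA, hle⟩ := exists_polyNormSq_le n k
  have hcoef : ∀ α, MemLp (fun z => coef k α (F z)) 2 (volume.restrict (box n)) := memLp_coef k hL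
  have hm : AEStronglyMeasurable (fun z => polyNormSq (F z)) (volume.restrict (box n)) := by
    have h1 : (fun z => polyNormSq (F z)) = fun z => polyNormSq (n := n) fun u =>
        ∑ α ∈ idx n k, coef k α (F z) * monom α u :=
      funext fun z => congrArg polyNormSq (funext fun u => (hF z).eq_sum u)
    rw [h1]
    refine (continuous_polyNormSq_sum k).comp_aestronglyMeasurable (g := fun c => _)
      (f := fun z α => coef k α (F z)) ?_
    exact (aemeasurable_pi_lambda _ fun α => (hcoef α).1.aemeasurable).aestronglyMeasurable
  have hint : Integrable (fun z => A * ∑ α ∈ idx n k, ‖coef k α (F z)‖ ^ 2) (volume.restrict (box n)) :=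
    (integrable_finsetSum _ fun α _ => (hcoef α).norm.integrable_sq).const_mul _
  refine hint.mono' hm (Filter.Eventually.of_forall fun z => ?_)
  rw [Real.norm_of_nonneg (polyNormSq_nonneg _)]
  exact hle _ (hF z)

/-- The `L²` norms of the coefficients are controlled by the `L²` norm of the tensor field. -/
theorem exists_sum_coef_le (n : ℕ) (k : ℤ) : ∃ K : ℝ, 0 ≤ K ∧ ∀ (F : Vec n → Vec n → ℂ)
    (_ : ∀ z, IsHomPoly k (F z)) (hL : L2Coeff F),
    ∑ α ∈ idx n k, multiFact α * ‖(memLp_coef k hL α).toLp _‖ ^ 2 ≤ K * slabNormSq F := by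
  obtain ⟨B, hB, hle⟩ := exists_coef_le n k
  refine ⟨∑ α ∈ idx n k, multiFact α * B, Finset.sum_nonneg fun α _ =>
    mul_nonneg (multiFact_nonneg α) hB, fun F hF hL => ?_⟩
  rw [Finset.sum_mul]
  refine Finset.sum_le_sum fun α hα => ?_
  rw [mul_assoc]
  refine mul_le_mul_of_nonneg_left ?_ (multiFact_nonneg α)
  rw [Lp_norm_sq_toLp, slabNormSq, ← integral_const_mul]
  exact integral_mono_of_nonneg (Filter.Eventually.of_forall fun z => sq_nonneg _)
    ((integrableOn_polyNormSq hF hL).const_mul B)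
    (Filter.Eventually.of_forall fun z => hle _ (hF z) α hα)

theorem hatLp_norm_le (k : Fin n → ℤ) (P : L2Box n) : ‖hatLp k P‖ ^ 2 ≤ ‖P‖ ^ 2 :=
  le_hasSum (hasSum_norm_hatLp P) k fun _ _ => sq_nonneg _

/-- The sum of Green's formulas. -/
theorem Green.sum {ι : Type*} (s : Finset ι) {G : ι → L2Box n} {D : Fin (n + 1) → ι → L2Box n}
    (h : ∀ i, Green (G i) fun j => D j i) (c : ι → ℂ) :
    Green (fun z => ∑ i ∈ s, G i z * c i) fun j z => ∑ i ∈ s, D j i z * c i := by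
  intro φ hφ hper j
  have hcd : Continuous fun z => fderiv ℝ φ z (EuclideanSpace.single j (1 : ℝ)) :=
    (hφ.continuous_fderiv (by simp)).clm_apply continuous_const
  have key : ∀ (P : ι → L2Box n) {ψ : Vec n → ℂ}, Continuous ψ →
      ∫ z in box n, (∑ i ∈ s, P i z * c i) * ψ z = ∑ i ∈ s, c i * ∫ z in box n, P i z * ψ z := by
    intro P ψ hψ
    simp only [← integral_const_mul]
    rw [← integral_finsetSum _ fun i _ =>
      (integrable_mul_of_continuous (Lp.memLp (P i)) hψ).const_mul _]
    refine integral_congr_ae (Filter.Eventually.of_forall fun z => ?_)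
    simp only [Finset.sum_mul]
    exact Finset.sum_congr rfl fun i _ => by ring
  rw [key _ hcd, key _ hφ.continuous, ← Finset.sum_neg_distrib]
  refine Finset.sum_congr rfl fun i _ => ?_
  rw [h i φ hφ hper j, mul_neg]

/-- The tensor field of order `k` on `M` with the coefficients `P β`, `|β| = k`, in `L²`. -/
def tensor (k : ℤ) (P : (Fin (n + 1) → ℕ) → L2Box n) (z u : Vec n) : ℂ := ∑ β ∈ idx n k, P β z * monom β u

theorem isHomPoly_tensor (k : ℤ) (P : (Fin (n + 1) → ℕ) → L2Box n) (z : Vec n) :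
    IsHomPoly k (tensor k P z) := isHomPoly_sum_monom _ _

theorem l2Coeff_tensor (k : ℤ) (P : (Fin (n + 1) → ℕ) → L2Box n) : L2Coeff (tensor k P) := fun _ =>
  memLp_finsetSum _ fun β _ => (Lp.memLp (P β)).mul_const _

theorem norm_tensor_sq_le (k : ℤ) (P : (Fin (n + 1) → ℕ) → L2Box n) (z : Vec n) {u : Vec n} (hu : ‖u‖ = 1) :
    ‖tensor k P z u‖ ^ 2 ≤ (idx n k).card * ∑ β ∈ idx n k, ‖P β z‖ ^ 2 := by
  have h := (isHomPoly_tensor k P z).norm_sq_le u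
  rw [hu, one_pow, mul_one] at h
  refine h.trans (le_of_eq ?_)
  congr 1
  refine Finset.sum_congr rfl fun β hβ => ?_
  have := coef_sum_monom (n := n) k (fun β => P β z) hβ
  unfold tensor
  rw [this]

theorem integrable_norm_sq_Lp (P : L2Box n) : IntegrableOn (fun z => ‖P z‖ ^ 2) (box n) :=
  (Lp.memLp P).norm.integrable_sq

variable {N : Type u} [TopologicalSpace N] {p : Slab n → N}

omit [TopologicalSpace N] in
theorem isHomPoly_deckAvg {k : ℤ} {F : (Vec n ≃ₗᵢ[ℝ] Vec n) → Vec n → Vec n → ℂ}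
    (hF : ∀ R w, IsHomPoly k (F R w)) (z : Vec n) :
    IsHomPoly k fun u => deckAvg p (fun R w => F R w u) z := by
  classical
  refine IsHomPoly.const_mul _ (IsHomPoly.sum _ fun γ _ => ?_)
  by_cases h : γ z ∈ box n
  · simp only [if_pos h]; exact hF _ _
  · simp only [if_neg h]; exact isHomPoly_zero k

theorem isHomPoly_rotGrad {k : ℤ} {D : Fin (n + 1) → Vec n → Vec n → ℂ} (hD : ∀ j z, IsHomPoly k (D j z))
    (j : Fin (n + 1)) (R : Vec n ≃ₗᵢ[ℝ] Vec n) (w : Vec n) : IsHomPoly k fun u => rotGrad D j u R w :=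
  IsHomPoly.sum _ fun l _ => IsHomPoly.const_mul _ ((hD l w).comp_linear R.toLinearEquiv.toLinearMap)

/-- The pointwise bound for the rotated gradient: `R e_j` is a unit vector. -/
theorem norm_rotGrad_sq_le (k : ℤ) (P : Fin (n + 1) → (Fin (n + 1) → ℕ) → L2Box n) (j : Fin (n + 1))
    (R : Vec n ≃ₗᵢ[ℝ] Vec n) (w : Vec n) {u : Vec n} (hu : ‖u‖ = 1) :
    ‖rotGrad (fun l => tensor k (P l)) j u R w‖ ^ 2 ≤
      (n + 1) * ((idx n k).card * ∑ l, ∑ β ∈ idx n k, ‖P l β w‖ ^ 2) := by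
  have hRu : ‖R u‖ = 1 := by rw [R.norm_map, hu]
  have h1 : ∀ l, ‖((R (EuclideanSpace.single j (1 : ℝ)) l : ℝ) : ℂ) * tensor k (P l) w (R u)‖ ≤
      ‖tensor k (P l) w (R u)‖ := by
    intro l
    rw [norm_mul, Complex.norm_real]
    refine mul_le_of_le_one_left (norm_nonneg _) ?_
    refine (PiLp.norm_apply_le _ l).trans ?_
    rw [R.norm_map]; simp
  calc ‖rotGrad (fun l => tensor k (P l)) j u R w‖ ^ 2
      ≤ (∑ l, ‖tensor k (P l) w (R u)‖) ^ 2 := by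
        gcongr
        exact norm_sum_le_of_le _ fun l _ => h1 l
    _ ≤ (Finset.univ : Finset (Fin (n + 1))).card * ∑ l, ‖tensor k (P l) w (R u)‖ ^ 2 :=
        sq_sum_le_card_mul_sum_sq
    _ ≤ (n + 1) * ((idx n k).card * ∑ l, ∑ β ∈ idx n k, ‖P l β w‖ ^ 2) := by
        rw [Finset.card_univ, Fintype.card_fin, Finset.mul_sum (s := Finset.univ) (a := ((idx n k).card : ℝ))]
        push_cast
        gcongr with l _
        exact norm_tensor_sq_le k (P l) w hRu

end

/-! ### The decomposition on `N` -/

section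

variable {n : ℕ} {N : Type u} [TopologicalSpace N] {p : Slab n → N}

theorem slabNormSq_congr {F G : Vec n → Vec n → ℂ} (h : ∀ z ∈ box n, F z = G z) :
    slabNormSq F = slabNormSq G :=
  setIntegral_congr_fun measurableSet_box fun z hz => by simp only [h z hz]

/-- The decomposition of the pullback to `M` of a tensor field whose ray transform vanishes, with
estimates by a constant `K` that depends on the dimension and the order only. -/
theorem exists_tensor_decomposition (n m : ℕ) : ∃ K : ℝ, 0 ≤ K ∧ ∀ P : Vec n → Vec n → ℂ,
    (∀ z, IsHomPoly m (P z)) → L2Coeff P →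
    (∀ b k, ∫ z in box n, P z (vec 1 b) * rayExpo k b z = 0) →
    ∃ (h : ℝ → Vec n → ℂ) (G : (Fin (n + 1) → ℕ) → L2Box n)
      (D : Fin (n + 1) → (Fin (n + 1) → ℕ) → L2Box n),
      (∀ x, IsHomPoly m (h x)) ∧ (∀ u, MemLp (fun x => h x u) 2 unitMeasure) ∧
      (∀ u, ∫ x in (0 : ℝ)..1, h x u = 0) ∧ (∀ β, Green (G β) fun j => D j β) ∧
      (∀ᵐ z ∂(volume.restrict (box n)), ∀ u : Vec n, P z u =
        h (z 0) u + ∑ j, ((u j : ℝ) : ℂ) * tensor (m - 1) (D j) z u) ∧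
      intervalNorm h ≤ √(K * slabNormSq P) ∧
      ∑ β ∈ idx n (m - 1), (‖G β‖ ^ 2 + ∑ j, ‖D j β‖ ^ 2) ≤ K * slabNormSq P := by
  obtain ⟨K, hK, hcoef⟩ := exists_sum_coef_le n m
  obtain ⟨A, hA, hpoly⟩ := exists_polyNormSq_le n m
  refine ⟨A * K + 2 * K, by positivity, fun P hP hL hW => ?_⟩
  set F : (Fin (n + 1) → ℕ) → L2Box n := fun α => (memLp_coef m hL α).toLp _ with hF
  have hFK : ∑ α ∈ idx n m, multiFact α * ‖F α‖ ^ 2 ≤ K * slabNormSq P := hcoef P hP hL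
  have hs : 0 ≤ slabNormSq P := integral_nonneg fun z => polyNormSq_nonneg _
  have hFae : ∀ᵐ z ∂(volume.restrict (box n)), ∀ α, F α z = coef m α (P z) := by
    rw [ae_all_iff]
    exact fun α => (memLp_coef m hL α).coeFn_toLp
  obtain ⟨G, D, hmean, hgreen, hsum, hbound⟩ := exists_slab_decomposition m F fun b k => by
    rw [← hW b k]
    refine integral_congr_ae ?_
    filter_upwards [hFae] with z hz
    rw [(hP z).eq_sum]
    simp only [hz]
  refine ⟨fun x u => ∑ α ∈ idx n m, hatLp 0 (F α) x * monom α u, G, D,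
    fun x => isHomPoly_sum_monom _ _, fun u => memLp_finsetSum _ fun α _ => (Lp.memLp _).mul_const _,
    hmean, hgreen, ?_, ?_, ?_⟩
  · have h1 : ∀ᵐ z ∂(volume.restrict (box n)), ∀ α ∈ idx n m,
        F α z = hatLp 0 (F α) (z 0) + symCoef (fun j β => D j β z) α := by
      rw [Finset.eventually_all]
      intro α hα
      have h2 := hsum α hα
      filter_upwards [Lp.coeFn_add (modeMap 0 (hatLp 0 (F α))) (symCoef D α),
        modeMap_coeFn 0 (hatLp 0 (F α)), symCoef_coeFn D α] with z ha hb hc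
      rw [← h2, Pi.add_apply, hb, hc, modeFun, expo_zero_left, mul_one] at ha
      exact ha
    filter_upwards [h1, hFae] with z hz hz' u
    rw [(hP z).eq_sum, Finset.sum_congr rfl fun α hα => by rw [← hz' α, hz α hα, add_mul],
      Finset.sum_add_distrib, sum_symCoef]
    rfl
  · refine Real.sqrt_le_sqrt ?_
    have h1 : ∫ x in Icc (0 : ℝ) 1, polyNormSq (fun u => ∑ α ∈ idx n m, hatLp 0 (F α) x * monom α u) ≤
        ∫ x in Icc (0 : ℝ) 1, A * ∑ α ∈ idx n m, ‖hatLp 0 (F α) x‖ ^ 2 := by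
      refine integral_mono_of_nonneg (Filter.Eventually.of_forall fun x => polyNormSq_nonneg _)
        ((integrable_finsetSum _ fun α _ => (Lp.memLp (hatLp 0 (F α))).norm.integrable_sq).const_mul A)
        (Filter.Eventually.of_forall fun x => ?_)
      refine (hpoly _ (isHomPoly_sum_monom _ _)).trans (le_of_eq ?_)
      congr 1
      exact Finset.sum_congr rfl fun α hα => by
        rw [coef_sum_monom (m : ℤ) (fun α => hatLp 0 (F α) x) hα]
    refine h1.trans ?_
    rw [integral_const_mul, integral_finsetSum _ fun α _ =>
      (Lp.memLp (hatLp 0 (F α))).norm.integrable_sq]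
    have h2 : ∑ α ∈ idx n m, ∫ x in Icc (0 : ℝ) 1, ‖hatLp 0 (F α) x‖ ^ 2 ≤ K * slabNormSq P := by
      refine le_trans (Finset.sum_le_sum fun α _ => ?_) hFK
      rw [← Lp_norm_sq]
      exact (hatLp_norm_le 0 (F α)).trans (norm_sq_le_multiFact_mul α (F α))
    calc A * ∑ α ∈ idx n m, ∫ x in Icc (0 : ℝ) 1, ‖hatLp 0 (F α) x‖ ^ 2
        ≤ A * (K * slabNormSq P) := mul_le_mul_of_nonneg_left h2 hA
      _ ≤ (A * K + 2 * K) * slabNormSq P := by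
          have : 0 ≤ K * slabNormSq P := mul_nonneg hK hs
          linarith
  · refine hbound.trans ?_
    have : 0 ≤ A * K * slabNormSq P := by positivity
    linarith

theorem isHomPoly_pullback [ChartedSpace (EuclideanHalfSpace (n + 1)) N] {k : ℤ}
    {f : (x : N) → TangentSpace (𝓡∂ (n + 1)) x → ℂ} (hf : IsTensorField k f) (z : Vec n) :
    IsHomPoly k (pullback p f z) := by
  have h1 : IsHomPoly (n := n) k (f (lift p z)) := hf _
  exact h1.comp_linear (dpV p z).toLinearMap

namespace IsTwistedSlab

variable [ChartedSpace (EuclideanHalfSpace (n + 1)) N]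
  [IsManifold (𝓡∂ (n + 1)) ∞ N] {g : SmoothMetric n N} (H : IsTwistedSlab g p) [T2Space N]
include H

theorem isTensorField_pushforward {k : ℤ} {F : Vec n → Vec n → ℂ} (hF : ∀ z, IsHomPoly k (F z)) :
    IsTensorField k (pushforward p F) := by
  intro x
  have hfin : {z : Vec n | z ∈ box n ∧ lift p z = x}.Finite :=
    (H.finite_fibre_ball x (√(n + 1))).subset fun z hz => ⟨hz.1.1, hz.2, norm_le_of_mem_box hz.1⟩
  have h1 : ∀ ξ : Vec n, pushforward p F x ξ = ((sheets p : ℂ))⁻¹ *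
      ∑ z ∈ hfin.toFinset, F z ((dpV p z).inverse ξ) := by
    intro ξ
    rw [← finsum_mem_eq_finite_toFinset_sum _ hfin]
    rfl
  have h2 : IsHomPoly (n := n) k fun ξ => ((sheets p : ℂ))⁻¹ *
      ∑ z ∈ hfin.toFinset, F z ((dpV p z).inverse ξ) :=
    IsHomPoly.const_mul _ (IsHomPoly.sum _ fun z _ =>
      (hF z).comp_linear (dpV p z).inverse.toLinearMap)
  exact (funext h1 : (pushforward p F x : Vec n → ℂ) = _) ▸ h2

end IsTwistedSlab

/-- The decomposition of a tensor field whose ray transform vanishes: the average over the deck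
transformations of the decomposition on `M`. -/
theorem exists_isKernelDecomp (n m : ℕ) : ∃ C : ℝ, ∀ (N : Type u) [TopologicalSpace N] [T2Space N]
      [ChartedSpace (EuclideanHalfSpace (n + 1)) N] [IsManifold (𝓡∂ (n + 1)) ∞ N]
      (g : SmoothMetric n N) (p : Slab n → N), IsTwistedSlab g p →
      ∀ f : (x : N) → TangentSpace (𝓡∂ (n + 1)) x → ℂ,
        IsTensorField (m : ℤ) f → L2Coeff (pullback p f) → XrayVanishes g p f →
        ∃ h φ Dφ, IsKernelDecomp p m f h φ Dφ ∧
          intervalNorm h + h1Norm p (pullback p φ) Dφ ≤ C * √(sheets p : ℝ) * l2Norm p (pullback p f) := by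
  obtain ⟨K, hK, hdec⟩ := exists_tensor_decomposition n m
  set σ := ((volume : Measure (Vec n)).toSphere).real univ with hσ
  set c : ℝ := ((idx n ((m : ℤ) - 1)).card : ℝ) with hc
  have hσ0 : 0 ≤ σ := measureReal_nonneg
  have hc0 : 0 ≤ c := Nat.cast_nonneg _
  refine ⟨√K + √(σ * c * (n + 1) ^ 2 * K), fun N _ _ _ _ g p H f hf hL hX => ?_⟩
  have hP : ∀ z, IsHomPoly m (pullback p f z) := isHomPoly_pullback hf
  obtain ⟨h, G, D, hhp, hh2, hhm, hgreen, hE, hhn, hbd⟩ := hdec _ hP hL ((H.xrayVanishes_iff_integral hL).1 hX)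
  set s := slabNormSq (pullback p f) with hs
  have hs0 : 0 ≤ s := integral_nonneg fun z => polyNormSq_nonneg _
  set G₀ := tensor ((m : ℤ) - 1) G with hG₀
  set D₀ : Fin (n + 1) → Vec n → Vec n → ℂ := fun j => tensor ((m : ℤ) - 1) (D j) with hD₀
  have hgr : ∀ u, Green (fun z => G₀ z u) fun j z => D₀ j z u := fun u =>
    Green.sum (idx n ((m : ℤ) - 1)) hgreen fun β => monom β u
  have hG2 : L2Coeff G₀ := l2Coeff_tensor _ _
  have hD2 : ∀ j, L2Coeff (D₀ j) := fun j => l2Coeff_tensor _ _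
  set φ := pushforward p G₀ with hφ
  set Dφ : Fin (n + 1) → Vec n → Vec n → ℂ := fun j z u => deckAvg p (rotGrad D₀ j u) z with hDφ
  have hφz : ∀ z ∈ box n, pullback p φ z = fun u => deckAvg p (fun R w => G₀ w (R u)) z := fun z hz =>
    funext fun u => H.pullback_pushforward_eq_deckAvg G₀ hz u
  have hφae : ∀ u, (fun z => pullback p φ z u) =ᵐ[volume.restrict (box n)]
      deckAvg p fun R w => G₀ w (R u) := fun u => by
    filter_upwards [ae_restrict_mem measurableSet_box] with z hz
    rw [hφz z hz]
  refine ⟨h, φ, Dφ, ⟨hhp, hh2, hhm, H.isTensorField_pushforward (isHomPoly_tensor _ _),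
    ⟨fun u => (memLp_deckAvg fun R => hG2 (R u)).ae_eq (hφae u).symm,
      fun j z => isHomPoly_deckAvg (F := fun R w u => rotGrad D₀ j u R w)
        (fun R w => isHomPoly_rotGrad (fun j z => isHomPoly_tensor _ _ _) j R w) z,
      fun j u => memLp_deckAvg fun R => memLp_rotGrad hD2 j u R,
      fun ψ hψ hper u j => ((H.green_deckAvg hG2 hD2 hgr u).congr (hφae u)
        fun j => Filter.EventuallyEq.rfl) ψ hψ hper j⟩, ?_⟩, ?_⟩
  · filter_upwards [H.pullback_eq_deckAvg hE, ae_restrict_mem measurableSet_box] with z hz hzb u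
    rw [H.pullback_pushforward_eq_deckAvg _ hzb, hz u]
  · have hsG : slabNormSq (pullback p φ) ≤ σ * (c * ∑ β ∈ idx n ((m : ℤ) - 1), ‖G β‖ ^ 2) := by
      rw [slabNormSq_congr hφz]
      refine (H.slabNormSq_deckAvg_le (F := fun R w u => G₀ w (R u))
        (Q := fun w => c * ∑ β ∈ idx n ((m : ℤ) - 1), ‖G β w‖ ^ 2)
        ((integrable_finsetSum _ fun β _ => integrable_norm_sq_Lp (G β)).const_mul c)
        fun R w u hu => norm_tensor_sq_le _ G w (by rw [R.norm_map, hu])).trans (le_of_eq ?_)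
      rw [integral_const_mul, integral_finsetSum _ fun β _ => integrable_norm_sq_Lp (G β)]
      simp only [Lp_norm_sq]
      rfl
    have hsD : ∀ j, slabNormSq (Dφ j) ≤
        σ * ((n + 1) * (c * ∑ l, ∑ β ∈ idx n ((m : ℤ) - 1), ‖D l β‖ ^ 2)) := by
      intro j
      have hi : ∀ l, IntegrableOn (fun w => ∑ β ∈ idx n ((m : ℤ) - 1), ‖D l β w‖ ^ 2) (box n) := fun l =>
        integrable_finsetSum _ fun β _ => integrable_norm_sq_Lp (D l β)
      refine (H.slabNormSq_deckAvg_le (F := fun R w u => rotGrad D₀ j u R w)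
        (Q := fun w => (n + 1) * (c * ∑ l, ∑ β ∈ idx n ((m : ℤ) - 1), ‖D l β w‖ ^ 2))
        (((integrable_finsetSum _ fun l _ => hi l).const_mul c).const_mul _)
        fun R w u hu => norm_rotGrad_sq_le _ D j R w hu).trans (le_of_eq ?_)
      rw [integral_const_mul, integral_const_mul, integral_finsetSum _ fun l _ => hi l]
      simp only [Lp_norm_sq]
      congr 4
      exact funext fun l => integral_finsetSum _ fun β _ => integrable_norm_sq_Lp (D l β)
    -- The norm on `N` carries the factor `1/d`; it is not needed on the left, and on the right it is
    -- where `√d` comes from.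
    have hd : (1 : ℝ) ≤ sheets p := by exact_mod_cast H.sheets_pos
    have htot : slabNormSq (pullback p φ) + ∑ j, slabNormSq (Dφ j) ≤ σ * c * (n + 1) ^ 2 * K * s := by
      set SG := ∑ β ∈ idx n ((m : ℤ) - 1), ‖G β‖ ^ 2 with hSG
      set SD := ∑ l, ∑ β ∈ idx n ((m : ℤ) - 1), ‖D l β‖ ^ 2 with hSD
      have hSG0 : 0 ≤ SG := Finset.sum_nonneg fun _ _ => sq_nonneg _
      have hSD0 : 0 ≤ SD := Finset.sum_nonneg fun _ _ => Finset.sum_nonneg fun _ _ => sq_nonneg _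
      have hbd' : SG + SD ≤ K * s := by
        refine le_trans (le_of_eq ?_) hbd
        rw [Finset.sum_add_distrib, hSD, Finset.sum_comm]
      have h1 : ∑ j, slabNormSq (Dφ j) ≤ (n + 1) * (σ * ((n + 1) * (c * SD))) := by
        refine (Finset.sum_le_sum fun j _ => hsD j).trans (le_of_eq ?_)
        rw [Finset.sum_const, Finset.card_univ, Fintype.card_fin, nsmul_eq_mul]
        push_cast
        rfl
      have h2 : (1 : ℝ) ≤ (n + 1) ^ 2 := by nlinarith [Nat.cast_nonneg (α := ℝ) n]
      calc slabNormSq (pullback p φ) + ∑ j, slabNormSq (Dφ j)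
          ≤ σ * (c * SG) + (n + 1) * (σ * ((n + 1) * (c * SD))) := add_le_add hsG h1
        _ = σ * c * (1 * SG + (n + 1) ^ 2 * SD) := by ring
        _ ≤ σ * c * ((n + 1) ^ 2 * SG + (n + 1) ^ 2 * SD) := by gcongr
        _ = σ * c * (n + 1) ^ 2 * (SG + SD) := by ring
        _ ≤ σ * c * (n + 1) ^ 2 * (K * s) := by gcongr
        _ = σ * c * (n + 1) ^ 2 * K * s := by ring
    have hh1 : h1Norm p (pullback p φ) Dφ ≤ √(σ * c * (n + 1) ^ 2 * K) * √s := by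
      rw [← Real.sqrt_mul (by positivity), h1Norm]
      refine Real.sqrt_le_sqrt (le_trans ?_ htot)
      refine mul_le_of_le_one_left (add_nonneg (integral_nonneg fun z => polyNormSq_nonneg _)
        (Finset.sum_nonneg fun j _ => integral_nonneg fun z => polyNormSq_nonneg _)) (inv_le_one_of_one_le₀ hd)
    have hl2 : √(sheets p : ℝ) * l2Norm p (pullback p f) = √s := by
      rw [l2Norm, ← Real.sqrt_mul (by positivity), mul_inv_cancel_left₀ (by positivity)]
    rw [mul_assoc, hl2, add_mul, ← Real.sqrt_mul hK]
    exact add_le_add hhn hh1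

end

end TwistedSlab

end

theorem theorem3p2 (n m : ℕ) (hn : 1 ≤ n) :
    ∃ C : ℝ, ∀ (N : Type u) [TopologicalSpace N] [T2Space N]
      [ChartedSpace (EuclideanHalfSpace (n + 1)) N] [IsManifold (𝓡∂ (n + 1)) ∞ N]
      (g : TwistedSlab.SmoothMetric n N) (p : TwistedSlab.Slab n → N), TwistedSlab.IsTwistedSlab g p →
      ∀ f : (x : N) → TangentSpace (𝓡∂ (n + 1)) x → ℂ,
        TwistedSlab.IsTensorField (m : ℤ) f → TwistedSlab.L2Coeff (TwistedSlab.pullback p f) →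
        (TwistedSlab.XrayVanishes g p f ↔
          ∃ h φ Dφ, TwistedSlab.IsKernelDecomp p m f h φ Dφ) ∧
        (TwistedSlab.XrayVanishes g p f →
          ∃ h φ Dφ, TwistedSlab.IsKernelDecomp p m f h φ Dφ ∧
            TwistedSlab.intervalNorm h +
                TwistedSlab.h1Norm p (TwistedSlab.pullback p φ) Dφ ≤
              C * √(TwistedSlab.sheets p : ℝ) *
                TwistedSlab.l2Norm p (TwistedSlab.pullback p f)) := by
  obtain ⟨C, hC⟩ := TwistedSlab.exists_isKernelDecomp.{u} n m
  refine ⟨C, fun N _ _ _ _ g p H f hf hL => ⟨⟨fun hX => ?_, ?_⟩, hC N g p H f hf hL⟩⟩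
  · obtain ⟨h, φ, Dφ, hd, -⟩ := hC N g p H f hf hL hX
    exact ⟨h, φ, Dφ, hd⟩
  · rintro ⟨h, φ, Dφ, hd⟩
    exact H.xrayVanishes_of_isKernelDecomp hL hd
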